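/- **Setting.** Attitudes are rotations $R\in SO(3)$ from the body frame to a space fixed frame, $\boldsymbol\ell\ne0$ is the constant angular momentum in space, $l=|\boldsymbol\ell|$, and $L=R^t\boldsymbol\ell$ is the angular momentum in the body frame. A free rigid motion with tensor of inertia $I$ satisfies $R^t\dot R v=\Omega\times v$ with $\Omega=I^{-1}L$, so that $\dot L=L\times I^{-1}L$; its energy is $\frac12L\cdot I^{-1}L$. $R_x(\theta)$ is the right-handed rotation by $\theta$ about the $x$-axis. For each arm angle $\alpha\in[0,\pi]$ ($\alpha=\pi$ up, $\alpha=0$ down) let $I(\alpha)$ be the tensor of inertia (symmetric, positive definite, continuous in $\alpha$, with $I_{xy}=I_{xz}=0$) and let $(A_x(\alpha)\dot\alpha,0,0)$, with $A_x$ continuous, be the internal angular momentum generated by moving the arm. Put $I_s=I(\pi)$, which is assumed to be diagonal, $I_t=I(0)$, and $\chi=\int_0^\pi (I(\alpha)^{-1})_{xx}A_x(\alpha)\,d\alpha$. Let $R_x(-P)\,I_t\,R_x(P)=\mathrm{diag}(J_x,J_y,J_z)$ with $J_z<J_y\le J_x$, where $\sin(\chi+P)>0$ and $\cos(\chi+P)\neq0$.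 The twist axis is $a=R_x(P)e_z$. A dive in the kick model consists of: a rigid motion with tensor $I_s$ for a time $\tau_1\ge0$, starting with $L=L_s=(0,l,0)^t$; an instantaneous arm motion from $\alpha=\pi$ to $\alpha=0$ (a kick: the motion with angular velocity $\Omega=-I^{-1}A$, with $\alpha$ as independent variable); a rigid motion with tensor $I_t$ for a time $\tau_3\ge0$; the reverse kick; and a rigid motion with tensor $I_s$ for a time $\tau_5\ge0$. It performs $n\in\mathbb{N}$ twists if in stage 3 the vector $L$ makes exactly $n$ full revolutions about $a$ in the body frame. Let $E_s$ be the energy at the start of stage 1 and $E_t$ the energy at the start of stage 3. The total rotation $\Delta\phi_{kick}$ about $\boldsymbol\ell$ is the sum over all five stages of the changes of the continuously followed azimuth about $\boldsymbol\ell$, not reduced mod $2\pi$, of a body-fixed axis: of the twist axis in stage 3, and of the body $x$-axis in the other stages. **Theorem.** (a) In stage 3 the vector $L$ (with the rigid motion continued to all times) traces exactly the orbit $\{|L|=l,\ a\cdot L<0,\ \frac12L\cdot I_t^{-1}L=E_t\}$ and is periodic. Let $S$ be the solid angle on the sphere $|L|=l$ between this orbit and the equator $a\cdot L=0$, and let $T_t$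 be the minimal period of $L$. (b) For every $n\in\mathbb{N}$ the dive performs $n$ twists if and only if $\tau_3=nT_t$. (c) If the dive performs $n$ twists, then the energy is $E_s$ throughout stages 1 and 5 and $E_t$ throughout stage 3, the total rotation about $\boldsymbol\ell$ is well-defined, and $$\Delta\phi_{kick}=(\tau_1+\tau_5)\frac{2E_s}{l}+\tau_3\frac{2E_t}{l}-nS .$$ Moreover the final attitude is the initial attitude rotated in space about $\boldsymbol\ell$ by the angle $\Delta\phi_{kick}$. (d) If $J_x=J_y$, then $$S=2\pi\sin(\chi+P),\qquad T_t=\frac{2\pi}{l}\,\frac{(J_z^{-1}-J_y^{-1})^{-1}}{\sin(\chi+P)} .$$ (e) If $J_y<J_x$, put $$\rho=\sqrt{\frac{1-J_y/J_x}{J_y/J_z-1}},\quad \mu=2\sqrt{(1-J_y/J_x)(J_y/J_z-1)},\quad h=\frac1\mu\Big(\frac{2E_tJ_y}{l^2}-1\Big),$$ $$g=(1+2h/\rho)^{-1/2},\qquad \nu=1-2h\rho,\qquad m=\frac{\rho(1-2h\rho)}{2h+\rho}.$$ Then $$S=2\pi-8hg\big(\Pi(\nu,m)-K(m)\big),\qquad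 T_t=\frac{8J_y\,g}{\mu\, l}K(m),$$ with the complete elliptic integrals $K(m)=\int_0^{\pi/2}\frac{d\theta}{\sqrt{1-m\sin^2\theta}}$ and $\Pi(\nu,m)=\int_0^{\pi/2}\frac{d\theta}{(1-\nu\sin^2\theta)\sqrt{1-m\sin^2\theta}}$. -/

import Mathlib

open Set MeasureTheory

noncomputable section

namespace TwistingSomersault

/-- Vectors of `ℝ³` by coordinates. No norm on this type is used; lengths are `len`. -/
abbrev Vec : Type := Fin 3 → ℝ

abbrev Mat : Type := Matrix (Fin 3) (Fin 3) ℝ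

/-- Euclidean length. -/
def len (v : Vec) : ℝ := Real.sqrt (v ⬝ᵥ v)

/-- The unit vector in the direction of a non-zero `v`. -/
def dir (v : Vec) : Vec := (len v)⁻¹ • v

/-- The skew matrix of the cross product, `hat w *ᵥ v = w × v`. -/
def hat (w : Vec) : Mat :=
  !![0, -w 2, w 1; w 2, 0, -w 0; -w 1, w 0, 0]

theorem hat_mulVec (w v : Vec) : Matrix.mulVec (hat w) v = crossProduct w v := by
  funext i
  fin_cases i <;>
    simp [hat, crossProduct, Matrix.mulVec, dotProduct, Fin.sum_univ_three] <;> ring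

/-- Rotation by the angle `θ` about the first coordinate axis. -/
def rotX (θ : ℝ) : Mat :=
  !![1, 0, 0; 0, Real.cos θ, -Real.sin θ; 0, Real.sin θ, Real.cos θ]

/-- Right-handed rotation by the angle `φ` about the axis spanned by `u ≠ 0`. -/
def rotAbout (u : Vec) (φ : ℝ) : Mat :=
  Real.cos φ • (1 : Mat) + Real.sin φ • hat (dir u)
    + (1 - Real.cos φ) • Matrix.vecMulVec (dir u) (dir u)

/-- The component of `v` orthogonal to `u`. -/
def perp (u v : Vec) : Vec := v - (dir u ⬝ᵥ v) • dir u

/-- Along the parameter interval with end points `s`, `t` (traversed from `s` to `t`), the half-plane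
that is bounded by the axis `ℝ u` and contains the moving vector `v` turns about `u` by the total
angle `δ`. The angle is followed continuously: it is a real number, not reduced modulo `2π`.
It requires that `v` is never parallel to `u`. -/
def TurnsBy (u : Vec) (v : ℝ → Vec) (s t δ : ℝ) : Prop :=
  perp u (v s) ≠ 0 ∧
  ∃ φ c : ℝ → ℝ, ContinuousOn φ (uIcc s t) ∧ φ s = 0 ∧ φ t = δ ∧
    ∀ x ∈ uIcc s t, 0 < c x ∧
      perp u (v x) = c x • Matrix.mulVec (rotAbout u (φ x)) (perp u (v s))

/-- Angular momentum in the body frame, `L = Rᵀ ℓ`, for the attitude `R` and the angular momentum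
`ℓ` in the space fixed frame. -/
def bodyMomentum (ℓ : Vec) (R : Mat) : Vec := Matrix.mulVec R.transpose ℓ

/-- Rotational energy `½ L · I⁻¹ L`. -/
def energy (I : Mat) (L : Vec) : ℝ := (L ⬝ᵥ Matrix.mulVec I⁻¹ L) / 2

/-- `R' = R hat(Ω)` at `t`, relative to the set `s`, entry by entry: `Ω` is the angular velocity in
the body frame, `Ω × v = Rᵀ R' v`. -/
def HasBodyVelocity (R : ℝ → Mat) (Ω : Vec) (s : Set ℝ) (t : ℝ) : Prop :=
  ∀ i j, HasDerivWithinAt (fun x => R x i j) ((R t * hat Ω) i j) s t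

/-- Free motion of a rigid body with tensor of inertia `I` and constant angular momentum `ℓ` in
space: the attitude `R` is a rotation and the angular velocity in the body frame is `I⁻¹ L`.
As `L = Rᵀ ℓ`, this contains the Euler equations `L' = L × I⁻¹ L`. -/
def IsRigidMotion (I : Mat) (ℓ : Vec) (R : ℝ → Mat) : Prop :=
  ∀ t, R t ∈ Matrix.specialOrthogonalGroup (Fin 3) ℝ ∧
    HasBodyVelocity R (Matrix.mulVec I⁻¹ (bodyMomentum ℓ (R t))) univ t

/-- The mechanical data of the athlete: for each angle `α` of the moving arm (`π` is up, `0` is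
down) the tensor of inertia, and the coefficient `A_x` of the internal angular momentum
`A = (A_x(α) α', 0, 0)` that is generated when the arm moves in the `yz`-plane. With the arm up, the
`y`-axis is a principal axis. -/
structure KickModel where
  inertia : ℝ → Mat
  Ax : ℝ → ℝ
  continuousOn_inertia : ContinuousOn inertia (Icc 0 Real.pi)
  continuousOn_Ax : ContinuousOn Ax (Icc 0 Real.pi)
  posDef : ∀ α ∈ Icc 0 Real.pi, (inertia α).PosDef
  inertia_xy : ∀ α ∈ Icc 0 Real.pi, inertia α 0 1 = 0
  inertia_xz : ∀ α ∈ Icc 0 Real.pi, inertia α 0 2 = 0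
  inertia_yz_up : inertia Real.pi 1 2 = 0

namespace KickModel

variable (M : KickModel)

/-- The tensor of inertia `I_s` in the pure somersault (arm up). -/
def Is : Mat := M.inertia Real.pi

/-- The tensor of inertia `I_t` in the twisting somersault (arm down). -/
def It : Mat := M.inertia 0

/-- The tilt angle `χ`, the integral of `(I⁻¹)_xx A_x` over the arm angle. -/
def tilt : ℝ := ∫ α in (0 : ℝ)..Real.pi, (M.inertia α)⁻¹ 0 0 * M.Ax α

/-- The attitude during an instantaneous arm motion, as a function of the arm angle. In
`Ω = I⁻¹ (L - A)` the term `A = (A_x α', 0, 0)` diverges for an instantaneous motion, so that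
`Ω = -I⁻¹ A`; with `α` in place of time as the independent variable, the factor `α'` drops out. -/
def IsKick (R : ℝ → Mat) : Prop :=
  ∀ α ∈ Icc 0 Real.pi, R α ∈ Matrix.specialOrthogonalGroup (Fin 3) ℝ ∧
    HasBodyVelocity R (-Matrix.mulVec (M.inertia α)⁻¹ ![M.Ax α, 0, 0]) (Icc 0 Real.pi) α

end KickModel

/-- A twisting somersault in the kick-model with angular momentum `ℓ`: pure somersault about the
`y`-axis for the time `τ₁`, a kick (arm from up to down), rigid motion with the tensor of inertia
`I_t` for the time `τ₃`, the reverse kick (arm from down to up), and rigid motion with the tensor of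
inertia `I_s` for the time `τ₅`. Each rigid stage has its own clock, starting at `0`; its attitude
curve is the solution for all times, and the stage itself is its restriction to `[0, τᵢ]`. -/
structure Dive (M : KickModel) (ℓ : Vec) where
  τ₁ : ℝ
  τ₃ : ℝ
  τ₅ : ℝ
  τ₁_nonneg : 0 ≤ τ₁
  τ₃_nonneg : 0 ≤ τ₃
  τ₅_nonneg : 0 ≤ τ₅
  R₁ : ℝ → Mat
  R₂ : ℝ → Mat
  R₃ : ℝ → Mat
  R₄ : ℝ → Mat
  R₅ : ℝ → Mat
  stage1 : IsRigidMotion M.Is ℓ R₁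
  stage2 : M.IsKick R₂
  stage3 : IsRigidMotion M.It ℓ R₃
  stage4 : M.IsKick R₄
  stage5 : IsRigidMotion M.Is ℓ R₅
  start : bodyMomentum ℓ (R₁ 0) = ![0, len ℓ, 0]
  join12 : R₂ Real.pi = R₁ τ₁
  join23 : R₃ 0 = R₂ 0
  join34 : R₄ 0 = R₃ τ₃
  join45 : R₅ 0 = R₄ Real.pi

/-- The twist axis in the body, `R_x(P) e_z`. It is the principal axis of `I_t` that belongs to
`J_z` if `R_x(-P) I_t R_x(P) = diag(J_x, J_y, J_z)`. -/
def twistAxis (P : ℝ) : Vec := Matrix.mulVec (rotX P) ![0, 0, 1]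

namespace Dive

variable {M : KickModel} {ℓ : Vec} (D : Dive M ℓ)

/-- Angular momentum in the body frame in the stages 1, 3 and 5. -/
def L₁ (t : ℝ) : Vec := bodyMomentum ℓ (D.R₁ t)

def L₃ (t : ℝ) : Vec := bodyMomentum ℓ (D.R₃ t)

def L₅ (t : ℝ) : Vec := bodyMomentum ℓ (D.R₅ t)

/-- Energy at the start of the pure somersault. -/
def Es : ℝ := energy M.Is (D.L₁ 0)

/-- Energy at the start of the twisting somersault. -/
def Et : ℝ := energy M.It (D.L₃ 0)

/-- In stage 3 the angular momentum in the body frame makes exactly `n` full revolutions about the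
twist axis, in one sense or the other. -/
def PerformsTwists (P : ℝ) (n : ℕ) : Prop :=
  ∃ δ, |δ| = 2 * Real.pi * n ∧ TurnsBy (twistAxis P) D.L₃ 0 D.τ₃ δ

/-- `Δ` is the total angle, not reduced modulo `2π`, by which the body turns about `ℓ` in space: the
sum over the five stages of the continuously followed azimuth about `ℓ` of a body-fixed axis.
This axis is the twist axis in the twisting stage (so that the angle there is the precession angle
of the twist axis), and the body `x`-axis in the somersault stages and in the kicks. -/
def IsTotalRotation (P Δ : ℝ) : Prop :=
  ∃ δ₁ δ₂ δ₃ δ₄ δ₅ : ℝ, Δ = δ₁ + δ₂ + δ₃ + δ₄ + δ₅ ∧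
    TurnsBy ℓ (fun t => Matrix.mulVec (D.R₁ t) ![1, 0, 0]) 0 D.τ₁ δ₁ ∧
    TurnsBy ℓ (fun α => Matrix.mulVec (D.R₂ α) ![1, 0, 0]) Real.pi 0 δ₂ ∧
    TurnsBy ℓ (fun t => Matrix.mulVec (D.R₃ t) (twistAxis P)) 0 D.τ₃ δ₃ ∧
    TurnsBy ℓ (fun α => Matrix.mulVec (D.R₄ α) ![1, 0, 0]) 0 Real.pi δ₄ ∧
    TurnsBy ℓ (fun t => Matrix.mulVec (D.R₅ t) ![1, 0, 0]) 0 D.τ₅ δ₅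

end Dive

/-- The orbit of energy `E` on the momentum sphere `|L| = l`, on the negative side of the equator
`a · L = 0`. -/
def orbit (I : Mat) (a : Vec) (l E : ℝ) : Set Vec :=
  {L | L ⬝ᵥ L = l ^ 2 ∧ a ⬝ᵥ L < 0 ∧ energy I L = E}

/-- The solid angle of the region of the momentum sphere `|L| = l` between the equator `a · L = 0`
and the orbit of energy `E` on its negative side. The points between the equator and the
orbit are those with energy at most `E`, the pole with direction `-a` being a maximum of the energy;
`volume.toSphere` is the surface measure of the unit sphere. -/
def solidAngle (I : Mat) (a : Vec) (l E : ℝ) : ℝ :=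
  (volume : Measure (EuclideanSpace ℝ (Fin 3))).toSphere.real
    {u | a ⬝ᵥ (u : EuclideanSpace ℝ (Fin 3)).ofLp ≤ 0 ∧
      energy I (l • (u : EuclideanSpace ℝ (Fin 3)).ofLp) ≤ E}

/-- Complete elliptic integral of the first kind, of parameter `m`. -/
def ellipticK (m : ℝ) : ℝ :=
  ∫ θ in (0 : ℝ)..(Real.pi / 2), 1 / Real.sqrt (1 - m * Real.sin θ ^ 2)

/-- Complete elliptic integral of the third kind, of characteristic `n` and parameter `m`. -/
def ellipticPi (n m : ℝ) : ℝ :=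
  ∫ θ in (0 : ℝ)..(Real.pi / 2),
    1 / ((1 - n * Real.sin θ ^ 2) * Real.sqrt (1 - m * Real.sin θ ^ 2))

/-! Dimensionless parameters for `J_z < J_y < J_x`. -/

def paramRho (Jx Jy Jz : ℝ) : ℝ := Real.sqrt ((1 - Jy / Jx) / (Jy / Jz - 1))

def paramMu (Jx Jy Jz : ℝ) : ℝ := 2 * Real.sqrt ((1 - Jy / Jx) * (Jy / Jz - 1))

def paramH (Jx Jy Jz l E : ℝ) : ℝ := (2 * E * Jy / l ^ 2 - 1) / paramMu Jx Jy Jz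

def paramG (h ρ : ℝ) : ℝ := 1 / Real.sqrt (1 + 2 * h / ρ)

def paramN (h ρ : ℝ) : ℝ := 1 - 2 * h * ρ

def paramM (h ρ : ℝ) : ℝ := ρ * (1 - 2 * h * ρ) / (2 * h + ρ)

/-- The solid angle enclosed by the orbit around the pole. -/
def capAngle (h ρ : ℝ) : ℝ :=
  8 * h * paramG h ρ * (ellipticPi (paramN h ρ) (paramM h ρ) - ellipticK (paramM h ρ))

end TwistingSomersault

end

open scoped Pointwise

noncomputable section

namespace TwistingSomersault

/-! Write A = 1/J_x ≤ B = 1/J_y < C = 1/J_z, s = sin(χ+P), c = cos(χ+P). A kick only turns the body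
about its own x-axis by the tilt χ (`KickModel.IsKick.eq_mul_rotX`), so in the principal frame of
I_t stage 3 starts at L = l(0, c, -s).

There the Euler equations are solved by one angle ψ: L = l(-k c sin ψ, c cos ψ, -`axial` ψ) with k²
= (C-B)/(C-A), where ψ' is a positive 2π-periodic function of ψ (`exists_angle_of_euler`). Hence L
is periodic, its period is the integral of 1/ψ' over a turn of ψ, and n twists mean exactly that ψ
advances by 2πn.

The azimuth of the twist axis about ℓ changes at the rate l(A x² + B y²)/(x² + y²). This is 2E_t/l
minus `geometricRate` ψ · ψ' (`IsRigidMotion.turnsBy_precession`). So n twists give τ₃ · 2E_t/l - n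
∫ `geometricRate`, the integral being over one turn.

That integral is the solid angle S. By Archimedes' theorem the area between the equator and a curve
on the unit sphere is the integral of the height over the azimuth, and `geometricRate` is height
times azimuth rate (`solidAngle_eq_integral`, `integral_height_eq`). Subtracting an exact derivative
reduces it to complete elliptic integrals (`geometricRate_add`, `integral_geometricRate`).

After whole twists L has returned, so the reverse kick restores L = (0, l, 0). Stages 1 and 5 are
steady rotations about ℓ at the rate 2E_s/l, the kicks leave the body x-axis fixed in space, and the
attitudes compose to a rotation about ℓ by the total angle. -/

/-! ### Rotations, the cross product and rotations about an axis. -/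

/-- A matrix multiplies triple products by its determinant; with the adjugate in place of the
inverse this is a polynomial identity for every matrix. For a rotation the adjugate is the
transpose, which gives `mul_hat`. -/
theorem transpose_mul_hat_mul (R : Mat) (w : Vec) :
    R.transpose * hat w * R = hat (Matrix.mulVec R.adjugate w) := by
  ext i j
  fin_cases i <;> fin_cases j <;>
    simp [hat, Matrix.mul_apply, Matrix.mulVec, dotProduct, Fin.sum_univ_three,
      Matrix.adjugate_fin_three] <;> ring

theorem transpose_mul_self_of_mem {R : Mat} (hR : R ∈ Matrix.specialOrthogonalGroup (Fin 3) ℝ) :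
    R.transpose * R = 1 :=
  (Matrix.mem_orthogonalGroup_iff' (Fin 3) ℝ).1 (Matrix.mem_specialOrthogonalGroup_iff.1 hR).1

theorem mul_transpose_self_of_mem {R : Mat} (hR : R ∈ Matrix.specialOrthogonalGroup (Fin 3) ℝ) :
    R * R.transpose = 1 :=
  (Matrix.mem_orthogonalGroup_iff (Fin 3) ℝ).1 (Matrix.mem_specialOrthogonalGroup_iff.1 hR).1

theorem adjugate_of_mem {R : Mat} (hR : R ∈ Matrix.specialOrthogonalGroup (Fin 3) ℝ) :
    R.adjugate = R.transpose := by
  have h1 := R.adjugate_mul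
  rw [(Matrix.mem_specialOrthogonalGroup_iff.1 hR).2, one_smul] at h1
  calc R.adjugate = R.adjugate * (R * R.transpose) := by
        rw [mul_transpose_self_of_mem hR, mul_one]
    _ = R.transpose := by rw [← mul_assoc, h1, one_mul]

theorem mul_hat {R : Mat} (hR : R ∈ Matrix.specialOrthogonalGroup (Fin 3) ℝ) (w : Vec) :
    R * hat w = hat (Matrix.mulVec R w) * R := by
  have h := transpose_mul_hat_mul R (Matrix.mulVec R w)
  rw [adjugate_of_mem hR, Matrix.mulVec_mulVec, transpose_mul_self_of_mem hR,
    Matrix.one_mulVec] at h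
  rw [← h, ← mul_assoc, ← mul_assoc, mul_transpose_self_of_mem hR, one_mul]

theorem mul_hat_transpose_mulVec {R : Mat} (hR : R ∈ Matrix.specialOrthogonalGroup (Fin 3) ℝ)
    (w : Vec) : R * hat (Matrix.mulVec R.transpose w) = hat w * R := by
  rw [mul_hat hR, Matrix.mulVec_mulVec, mul_transpose_self_of_mem hR, Matrix.one_mulVec]

theorem mulVec_dotProduct_mulVec {R : Mat} (hR : R ∈ Matrix.specialOrthogonalGroup (Fin 3) ℝ)
    (v w : Vec) : Matrix.mulVec R v ⬝ᵥ Matrix.mulVec R w = v ⬝ᵥ w := by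
  rw [Matrix.dotProduct_mulVec, ← Matrix.mulVec_transpose, Matrix.mulVec_mulVec,
    transpose_mul_self_of_mem hR, Matrix.one_mulVec]

theorem transpose_mem {R : Mat} (hR : R ∈ Matrix.specialOrthogonalGroup (Fin 3) ℝ) :
    R.transpose ∈ Matrix.specialOrthogonalGroup (Fin 3) ℝ := by
  rw [Matrix.mem_specialOrthogonalGroup_iff, Matrix.mem_orthogonalGroup_iff]
  refine ⟨?_, ?_⟩
  · simpa using transpose_mul_self_of_mem hR
  · rw [Matrix.det_transpose, (Matrix.mem_specialOrthogonalGroup_iff.1 hR).2]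

theorem len_mulVec {R : Mat} (hR : R ∈ Matrix.specialOrthogonalGroup (Fin 3) ℝ) (v : Vec) :
    len (Matrix.mulVec R v) = len v := by
  rw [len, mulVec_dotProduct_mulVec hR, len]

theorem dir_mulVec {R : Mat} (hR : R ∈ Matrix.specialOrthogonalGroup (Fin 3) ℝ) (v : Vec) :
    dir (Matrix.mulVec R v) = Matrix.mulVec R (dir v) := by
  rw [dir, len_mulVec hR, dir, Matrix.mulVec_smul]

theorem dotProduct_self_pos {v : Vec} (hv : v ≠ 0) : 0 < v ⬝ᵥ v :=
  lt_of_le_of_ne (Finset.sum_nonneg fun _ _ => mul_self_nonneg _)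
    fun h => hv (dotProduct_self_eq_zero.1 h.symm)

theorem len_pos {v : Vec} (hv : v ≠ 0) : 0 < len v :=
  Real.sqrt_pos.2 (dotProduct_self_pos hv)

theorem len_sq (v : Vec) : len v ^ 2 = v ⬝ᵥ v :=
  Real.sq_sqrt (Finset.sum_nonneg fun _ _ => mul_self_nonneg _)

theorem dir_dotProduct_self {u : Vec} (hu : u ≠ 0) : dir u ⬝ᵥ dir u = 1 := by
  have h := len_pos hu
  rw [dir, smul_dotProduct, dotProduct_smul, ← len_sq, smul_eq_mul, smul_eq_mul]
  field_simp

theorem len_smul_dir {u : Vec} (hu : u ≠ 0) : len u • dir u = u := by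
  rw [dir, smul_smul, mul_inv_cancel₀ (len_pos hu).ne', one_smul]

theorem rotAbout_zero (u : Vec) : rotAbout u 0 = 1 := by
  simp [rotAbout]

theorem hat_mul_hat_self (u : Vec) :
    hat u * hat u = Matrix.vecMulVec u u - (u ⬝ᵥ u) • (1 : Mat) := by
  ext i j
  fin_cases i <;> fin_cases j <;>
    simp [hat, Matrix.mul_apply, dotProduct, Fin.sum_univ_three, Matrix.vecMulVec_apply] <;> ring

theorem hat_mulVec_self (u : Vec) : Matrix.mulVec (hat u) u = 0 := by
  rw [hat_mulVec, cross_self]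

theorem vecMul_hat_self (u : Vec) : Matrix.vecMul u (hat u) = 0 := by
  ext i
  fin_cases i <;> simp [hat, Matrix.vecMul, dotProduct, Fin.sum_univ_three] <;> ring

theorem rotAbout_mul {u : Vec} (hu : u ≠ 0) (a b : ℝ) :
    rotAbout u a * rotAbout u b = rotAbout u (a + b) := by
  have h1 := hat_mul_hat_self (dir u)
  rw [dir_dotProduct_self hu, one_smul] at h1
  have h2 : hat (dir u) * Matrix.vecMulVec (dir u) (dir u) = 0 := by
    rw [Matrix.mul_vecMulVec, hat_mulVec_self, Matrix.zero_vecMulVec]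
  have h3 : Matrix.vecMulVec (dir u) (dir u) * hat (dir u) = 0 := by
    rw [Matrix.vecMulVec_mul, vecMul_hat_self, Matrix.vecMulVec_zero]
  have h4 : Matrix.vecMulVec (dir u) (dir u) * Matrix.vecMulVec (dir u) (dir u)
      = Matrix.vecMulVec (dir u) (dir u) := by
    rw [Matrix.vecMulVec_mul_vecMulVec, dir_dotProduct_self hu]
    simp
  simp only [rotAbout, add_mul, mul_add, smul_mul_smul, h1, h2, h3, h4, one_mul, mul_one,
    Real.cos_add, Real.sin_add]
  module

theorem rotAbout_mulVec_of_orthogonal (u : Vec) (φ : ℝ) {w : Vec} (hw : dir u ⬝ᵥ w = 0) :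
    Matrix.mulVec (rotAbout u φ) w
      = Real.cos φ • w + Real.sin φ • crossProduct (dir u) w := by
  rw [rotAbout, Matrix.add_mulVec, Matrix.add_mulVec, Matrix.smul_mulVec,
    Matrix.smul_mulVec, Matrix.smul_mulVec, hat_mulVec, Matrix.vecMulVec_mulVec, hw]
  simp

theorem rotAbout_mulVec_dir {u : Vec} (hu : u ≠ 0) (φ : ℝ) :
    Matrix.mulVec (rotAbout u φ) (dir u) = dir u := by
  rw [rotAbout, Matrix.add_mulVec, Matrix.add_mulVec, Matrix.smul_mulVec,
    Matrix.smul_mulVec, Matrix.smul_mulVec, hat_mulVec_self, Matrix.vecMulVec_mulVec,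
    dir_dotProduct_self hu]
  simp only [Matrix.one_mulVec, smul_zero, add_zero, MulOpposite.op_one, one_smul]
  module

theorem rotAbout_mulVec_self {u : Vec} (hu : u ≠ 0) (φ : ℝ) :
    Matrix.mulVec (rotAbout u φ) u = u := by
  calc Matrix.mulVec (rotAbout u φ) u
      = Matrix.mulVec (rotAbout u φ) (len u • dir u) := by rw [len_smul_dir hu]
    _ = u := by rw [Matrix.mulVec_smul, rotAbout_mulVec_dir hu, len_smul_dir hu]

theorem rotAbout_mulVec_covariant {R : Mat} (hR : R ∈ Matrix.specialOrthogonalGroup (Fin 3) ℝ)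
    (u : Vec) (φ : ℝ) :
    rotAbout (Matrix.mulVec R u) φ * R = R * rotAbout u φ := by
  have h : Matrix.vecMulVec (Matrix.mulVec R (dir u)) (Matrix.mulVec R (dir u)) * R
      = R * Matrix.vecMulVec (dir u) (dir u) := by
    rw [Matrix.mul_vecMulVec, Matrix.vecMulVec_mul, ← Matrix.mulVec_transpose,
      Matrix.mulVec_mulVec, transpose_mul_self_of_mem hR, Matrix.one_mulVec]
  simp only [rotAbout, dir_mulVec hR, add_mul, mul_add, smul_mul_assoc, mul_smul_comm, h,
    mul_hat hR, one_mul, mul_one]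

theorem perp_mulVec {R : Mat} (hR : R ∈ Matrix.specialOrthogonalGroup (Fin 3) ℝ) (u v : Vec) :
    perp (Matrix.mulVec R u) (Matrix.mulVec R v) = Matrix.mulVec R (perp u v) := by
  rw [perp, dir_mulVec hR, mulVec_dotProduct_mulVec hR, perp, Matrix.mulVec_sub,
    Matrix.mulVec_smul]

theorem dir_dotProduct_perp {u : Vec} (hu : u ≠ 0) (v : Vec) : dir u ⬝ᵥ perp u v = 0 := by
  rw [perp, dotProduct_sub, dotProduct_smul, dir_dotProduct_self hu]
  simp

theorem perp_rotAbout {u : Vec} (hu : u ≠ 0) (φ : ℝ) (v : Vec) :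
    perp u (Matrix.mulVec (rotAbout u φ) v) = Matrix.mulVec (rotAbout u φ) (perp u v) := by
  have h : dir u ⬝ᵥ Matrix.mulVec (rotAbout u φ) v = dir u ⬝ᵥ v := by
    rw [Matrix.dotProduct_mulVec]
    congr 1
    rw [rotAbout, Matrix.vecMul_add, Matrix.vecMul_add, Matrix.vecMul_smul, Matrix.vecMul_smul,
      Matrix.vecMul_smul, vecMul_hat_self, Matrix.vecMul_vecMulVec, dir_dotProduct_self hu]
    simp only [Matrix.vecMul_one, smul_zero, add_zero, one_smul]
    module
  rw [perp, h, perp, Matrix.mulVec_sub, Matrix.mulVec_smul, rotAbout_mulVec_dir hu]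

theorem det_frame {e w : Vec} (he : e ⬝ᵥ e = 1) (hw : e ⬝ᵥ w = 0) :
    (Matrix.of ![e, w, crossProduct e w]).det = w ⬝ᵥ w := by
  have h : (Matrix.of ![e, w, crossProduct e w]).det
      = (e ⬝ᵥ e) * (w ⬝ᵥ w) - (e ⬝ᵥ w) ^ 2 := by
    rw [Matrix.det_fin_three]
    simp [cross_apply, dotProduct, Fin.sum_univ_three]
    ring
  rw [h, he, hw]
  ring

theorem mulVec_crossProduct {R : Mat} (hR : R ∈ Matrix.specialOrthogonalGroup (Fin 3) ℝ)
    (v w : Vec) : Matrix.mulVec R (crossProduct v w)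
      = crossProduct (Matrix.mulVec R v) (Matrix.mulVec R w) := by
  rw [← hat_mulVec, ← hat_mulVec, Matrix.mulVec_mulVec, mul_hat hR, Matrix.mulVec_mulVec]

/-- A rotation that fixes the axis of `u` and turns one vector orthogonal to it by `φ` is
the rotation about `u` by `φ`. -/
theorem eq_rotAbout {R : Mat} (hR : R ∈ Matrix.specialOrthogonalGroup (Fin 3) ℝ) {u w : Vec}
    (hu : u ≠ 0) (hRu : Matrix.mulVec R u = u) (hw : dir u ⬝ᵥ w = 0) (hw0 : w ≠ 0) {φ : ℝ}
    (hRw : Matrix.mulVec R w = Matrix.mulVec (rotAbout u φ) w) : R = rotAbout u φ := by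
  have hRe : Matrix.mulVec R (dir u) = dir u := by rw [← dir_mulVec hR, hRu]
  have hc : Matrix.mulVec R (crossProduct (dir u) w)
      = Matrix.mulVec (rotAbout u φ) (crossProduct (dir u) w) := by
    rw [mulVec_crossProduct hR, hRe, hRw, rotAbout_mulVec_of_orthogonal u φ hw,
      rotAbout_mulVec_of_orthogonal u φ (dot_self_cross _ _), map_add, map_smul, map_smul]
  set F : Mat := Matrix.of ![dir u, w, crossProduct (dir u) w] with hF
  have hdet : IsUnit F.transpose.det := by
    rw [Matrix.det_transpose, hF, det_frame (dir_dotProduct_self hu) hw]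
    exact (dotProduct_self_pos hw0).ne'.isUnit
  have hmul : R * F.transpose = rotAbout u φ * F.transpose := by
    have key : ∀ j, Matrix.mulVec R (F j) = Matrix.mulVec (rotAbout u φ) (F j) := by
      intro j
      fin_cases j
      · exact hRe.trans (rotAbout_mulVec_dir hu φ).symm
      · exact hRw
      · exact hc
    ext i j
    exact congrFun (key j) i
  calc R = R * (F.transpose * F.transpose⁻¹) := by rw [Matrix.mul_nonsing_inv _ hdet, mul_one]
    _ = rotAbout u φ * (F.transpose * F.transpose⁻¹) := by
      rw [← mul_assoc, hmul, mul_assoc]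
    _ = rotAbout u φ := by rw [Matrix.mul_nonsing_inv _ hdet, mul_one]

theorem rotX_eq_rotAbout (θ : ℝ) : rotX θ = rotAbout ![1, 0, 0] θ := by
  have h : dir ![1, 0, 0] = ![1, 0, 0] := by simp [dir, len]
  rw [rotAbout, h]
  ext i j
  fin_cases i <;> fin_cases j <;> simp [rotX, hat]

theorem rotX_mul (a b : ℝ) : rotX a * rotX b = rotX (a + b) := by
  simp only [rotX_eq_rotAbout]
  exact rotAbout_mul (by simp) a b

theorem rotX_zero : rotX 0 = 1 := by rw [rotX_eq_rotAbout, rotAbout_zero]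

theorem transpose_rotX (θ : ℝ) : (rotX θ).transpose = rotX (-θ) := by
  ext i j
  fin_cases i <;> fin_cases j <;> simp [rotX]

theorem rotX_mem (θ : ℝ) : rotX θ ∈ Matrix.specialOrthogonalGroup (Fin 3) ℝ := by
  rw [Matrix.mem_specialOrthogonalGroup_iff, Matrix.mem_orthogonalGroup_iff]
  refine ⟨?_, ?_⟩
  · change rotX θ * (rotX θ).transpose = 1
    rw [transpose_rotX, rotX_mul, add_neg_cancel, rotX_zero]
  · rw [Matrix.det_fin_three]
    simp [rotX]
    nlinarith [Real.sin_sq_add_cos_sq θ]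

/-! ### Continuously followed angles and their uniqueness. -/

/-- The image is an interval containing 0 on which the cosine is 1, and multiples of 2π are
isolated. Applied to the difference of two lifts of one angle, it makes `TurnsBy` determine its
angle. -/
theorem eq_zero_of_cos_eq_one {d : ℝ → ℝ} {s t : ℝ} (hd : ContinuousOn d (uIcc s t))
    (hs : d s = 0) (hcos : ∀ x ∈ uIcc s t, Real.cos (d x) = 1) : d t = 0 := by
  have hpi := Real.pi_pos
  have himg : ∀ y ∈ uIcc (d s) (d t), Real.cos y = 1 := by
    intro y hy
    obtain ⟨x, hx, rfl⟩ := intermediate_value_uIcc hd hy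
    exact hcos x hx
  rw [hs] at himg
  rcases lt_trichotomy (d t) 0 with h | h | h
  -- Truncation at -π gives a non-zero value of the image within (-2π, 2π), where cos = 1 forces 0.
  · have hm : max (d t) (-Real.pi) ∈ uIcc 0 (d t) := by
      rw [uIcc_of_ge h.le]
      exact ⟨le_max_left _ _, max_le h.le (by linarith)⟩
    have h0 := (Real.cos_eq_one_iff_of_lt_of_lt
      (by linarith [le_max_right (d t) (-Real.pi)])
      (by linarith [hm.2, max_lt h (by linarith : -Real.pi < 0)])).1 (himg _ hm)
    exact absurd h0 (max_lt h (by linarith)).ne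
  · exact h
  · have hm : min (d t) Real.pi ∈ uIcc 0 (d t) := by
      rw [uIcc_of_le h.le]
      exact ⟨le_min h.le hpi.le, min_le_left _ _⟩
    have h0 := (Real.cos_eq_one_iff_of_lt_of_lt
      (by linarith [lt_min h hpi])
      (by linarith [min_le_right (d t) Real.pi])).1 (himg _ hm)
    exact absurd h0 (lt_min h hpi).ne'

theorem cos_sub_eq_one_of_smul_rotAbout {u w : Vec} (hu : u ≠ 0) (hw : dir u ⬝ᵥ w = 0)
    (hw0 : w ≠ 0) {a b c d : ℝ} (hc : 0 < c) (hd : 0 < d)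
    (h : c • Matrix.mulVec (rotAbout u a) w = d • Matrix.mulVec (rotAbout u b) w) :
    Real.cos (a - b) = 1 := by
  rw [rotAbout_mulVec_of_orthogonal u a hw, rotAbout_mulVec_of_orthogonal u b hw] at h
  have hww := dotProduct_self_pos hw0
  have hcc : crossProduct (dir u) w ⬝ᵥ crossProduct (dir u) w = w ⬝ᵥ w := by
    rw [cross_dot_cross, dir_dotProduct_self hu, hw]
    ring
  have h1 := congrArg (fun v => w ⬝ᵥ v) h
  have h2 := congrArg (fun v => crossProduct (dir u) w ⬝ᵥ v) h
  have hx : crossProduct (dir u) w ⬝ᵥ w = 0 := by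
    rw [dotProduct_comm, dot_cross_self]
  simp only [dotProduct_smul, dotProduct_add, dot_cross_self, hx, hcc, smul_eq_mul, mul_zero,
    add_zero, zero_add] at h1 h2
  have e1 : c * Real.cos a = d * Real.cos b :=
    mul_right_cancel₀ hww.ne' (by linear_combination h1)
  have e2 : c * Real.sin a = d * Real.sin b :=
    mul_right_cancel₀ hww.ne' (by linear_combination h2)
  have hcd : c = d := by
    have : c ^ 2 = d ^ 2 := by
      have ha := Real.sin_sq_add_cos_sq a
      have hb := Real.sin_sq_add_cos_sq b
      linear_combination (c * Real.cos a + d * Real.cos b) * e1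
        + (c * Real.sin a + d * Real.sin b) * e2 - c ^ 2 * ha + d ^ 2 * hb
    exact (pow_left_inj₀ hc.le hd.le two_ne_zero).1 this
  subst hcd
  have e1' := mul_left_cancel₀ hc.ne' e1
  have e2' := mul_left_cancel₀ hc.ne' e2
  rw [Real.cos_sub, e1', e2']
  linarith [Real.sin_sq_add_cos_sq b]

theorem TurnsBy.unique {u : Vec} (hu : u ≠ 0) {v : ℝ → Vec} {s t δ₁ δ₂ : ℝ}
    (h₁ : TurnsBy u v s t δ₁) (h₂ : TurnsBy u v s t δ₂) : δ₁ = δ₂ := by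
  obtain ⟨hw, φ₁, c₁, hφ₁, hs₁, rfl, H₁⟩ := h₁
  obtain ⟨-, φ₂, c₂, hφ₂, hs₂, rfl, H₂⟩ := h₂
  have := eq_zero_of_cos_eq_one (d := fun x => φ₁ x - φ₂ x) (hφ₁.sub hφ₂) (by simp [hs₁, hs₂])
    fun x hx => cos_sub_eq_one_of_smul_rotAbout hu (dir_dotProduct_perp hu _) hw (H₁ x hx).1
      (H₂ x hx).1 ((H₁ x hx).2.symm.trans (H₂ x hx).2)
  exact sub_eq_zero.1 this

theorem TurnsBy.mulVec {Q : Mat} (hQ : Q ∈ Matrix.specialOrthogonalGroup (Fin 3) ℝ) {u : Vec}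
    {v : ℝ → Vec} {s t δ : ℝ} (h : TurnsBy u v s t δ) :
    TurnsBy (Matrix.mulVec Q u) (fun x => Matrix.mulVec Q (v x)) s t δ := by
  obtain ⟨hw, φ, c, hφ, hs, ht, H⟩ := h
  refine ⟨?_, φ, c, hφ, hs, ht, fun x hx => ⟨(H x hx).1, ?_⟩⟩
  · rw [perp_mulVec hQ]
    intro h0
    apply hw
    rw [← Matrix.one_mulVec (perp u (v s)), ← transpose_mul_self_of_mem hQ,
      ← Matrix.mulVec_mulVec, h0, Matrix.mulVec_zero]
  · rw [perp_mulVec hQ, perp_mulVec hQ, (H x hx).2, Matrix.mulVec_mulVec,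
      rotAbout_mulVec_covariant hQ, ← Matrix.mulVec_mulVec, Matrix.mulVec_smul]

theorem turnsBy_rotAbout {u w : Vec} (hu : u ≠ 0) (hw : perp u w ≠ 0) {φ : ℝ → ℝ} {s t : ℝ}
    (hφ : ContinuousOn φ (uIcc s t)) (hs : φ s = 0) :
    TurnsBy u (fun x => Matrix.mulVec (rotAbout u (φ x)) w) s t (φ t) := by
  refine ⟨?_, φ, fun _ => 1, hφ, hs, rfl, fun x _ => ⟨one_pos, ?_⟩⟩
  · simpa [hs, rotAbout_zero] using hw
  · simp only [hs, rotAbout_zero, Matrix.one_mulVec, one_smul]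
    exact perp_rotAbout hu _ _

theorem turnsBy_of_eqOn_const {u w : Vec} (hw : perp u w ≠ 0) {v : ℝ → Vec}
    {s t : ℝ} (hv : ∀ x ∈ uIcc s t, v x = w) : TurnsBy u v s t 0 := by
  refine ⟨by rwa [hv s left_mem_uIcc], fun _ => 0, fun _ => 1, continuousOn_const, rfl, rfl,
    fun x hx => ⟨one_pos, ?_⟩⟩
  rw [hv x hx, hv s left_mem_uIcc, rotAbout_zero, Matrix.one_mulVec, one_smul]

/-- If the moving axis were parallel to ℓ, Cauchy–Schwarz would be an equality. The condition is
stated in the body frame, where L is known. -/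
theorem perp_ne_zero {R : Mat} (hR : R ∈ Matrix.specialOrthogonalGroup (Fin 3) ℝ) {ℓ v : Vec}
    (h : (bodyMomentum ℓ R ⬝ᵥ v) ^ 2 < (ℓ ⬝ᵥ ℓ) * (v ⬝ᵥ v)) :
    perp ℓ (Matrix.mulVec R v) ≠ 0 := by
  intro h0
  have hℓ : ℓ ≠ 0 := by
    rintro rfl
    simp [bodyMomentum] at h
  have h1 : Matrix.mulVec R v = (dir ℓ ⬝ᵥ Matrix.mulVec R v) • dir ℓ := sub_eq_zero.1 h0
  have h2 : bodyMomentum ℓ R ⬝ᵥ v = len ℓ * (dir ℓ ⬝ᵥ Matrix.mulVec R v) := by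
    rw [bodyMomentum, Matrix.mulVec_transpose, ← Matrix.dotProduct_mulVec, ← smul_eq_mul,
      ← smul_dotProduct, len_smul_dir hℓ]
  have h3 : v ⬝ᵥ v = (dir ℓ ⬝ᵥ Matrix.mulVec R v) ^ 2 := by
    rw [← mulVec_dotProduct_mulVec hR v v]
    conv_lhs => rw [h1]
    rw [smul_dotProduct, dotProduct_smul, dir_dotProduct_self hℓ]
    simp [sq]
  rw [h2, h3, ← len_sq, mul_pow] at h
  exact lt_irrefl _ h

/-! ### Entrywise calculus for curves of matrices. -/

/-- `A'` is the derivative at `t`, relative to `s`, of the matrix-valued `A`, entry by entry. -/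
def HasMatDerivWithinAt (A : ℝ → Mat) (A' : Mat) (s : Set ℝ) (t : ℝ) : Prop :=
  ∀ i j, HasDerivWithinAt (fun x => A x i j) (A' i j) s t

section Derivatives

variable {A B : ℝ → Mat} {A' B' : Mat} {s : Set ℝ} {t : ℝ}

theorem HasMatDerivWithinAt.mul (hA : HasMatDerivWithinAt A A' s t)
    (hB : HasMatDerivWithinAt B B' s t) :
    HasMatDerivWithinAt (fun x => A x * B x) (A' * B t + A t * B') s t := by
  intro i j
  have h := HasDerivWithinAt.fun_sum (u := Finset.univ) fun k _ => (hA i k).mul (hB k j)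
  simp only [Matrix.add_apply, Matrix.mul_apply, ← Finset.sum_add_distrib]
  exact h

theorem HasMatDerivWithinAt.mul_const (hA : HasMatDerivWithinAt A A' s t) (C : Mat) :
    HasMatDerivWithinAt (fun x => A x * C) (A' * C) s t := by
  have h := hA.mul (B := fun _ => C) (B' := 0) fun i j => hasDerivWithinAt_const _ _ _
  simpa using h

theorem HasMatDerivWithinAt.transpose (hA : HasMatDerivWithinAt A A' s t) :
    HasMatDerivWithinAt (fun x => (A x).transpose) A'.transpose s t :=
  fun i j => hA j i

theorem HasMatDerivWithinAt.mulVec (hA : HasMatDerivWithinAt A A' s t) {v : ℝ → Vec} {v' : Vec}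
    (hv : ∀ i, HasDerivWithinAt (fun x => v x i) (v' i) s t) (i : Fin 3) :
    HasDerivWithinAt (fun x => Matrix.mulVec (A x) (v x) i)
      ((Matrix.mulVec A' (v t) + Matrix.mulVec (A t) v') i) s t := by
  have h := HasDerivWithinAt.fun_sum (u := Finset.univ) fun k _ => (hA i k).mul (hv k)
  simp only [Pi.add_apply, Matrix.mulVec, dotProduct, ← Finset.sum_add_distrib]
  exact h

theorem hasMatDerivWithinAt_rotAbout {u : Vec} (hu : u ≠ 0) {θ : ℝ → ℝ} {θ' : ℝ}
    (hθ : HasDerivWithinAt θ θ' s t) :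
    HasMatDerivWithinAt (fun x => rotAbout u (θ x)) (θ' • (rotAbout u (θ t) * hat (dir u))) s t := by
  have hE : rotAbout u (θ t) * hat (dir u) = -Real.sin (θ t) • (1 : Mat)
      + Real.cos (θ t) • hat (dir u)
      + Real.sin (θ t) • Matrix.vecMulVec (dir u) (dir u) := by
    have h1 := hat_mul_hat_self (dir u)
    rw [dir_dotProduct_self hu, one_smul] at h1
    have h3 : Matrix.vecMulVec (dir u) (dir u) * hat (dir u) = 0 := by
      rw [Matrix.vecMulVec_mul, vecMul_hat_self, Matrix.vecMulVec_zero]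
    simp only [rotAbout, add_mul, smul_mul_assoc, h1, h3, one_mul]
    module
  intro i j
  have h := ((hθ.cos.mul_const ((1 : Mat) i j)).add (hθ.sin.mul_const (hat (dir u) i j))).add
    (((hasDerivWithinAt_const t s (1 : ℝ)).sub hθ.cos).mul_const
      (Matrix.vecMulVec (dir u) (dir u) i j))
  rw [hE]
  refine h.congr_deriv ?_
  simp only [Matrix.smul_apply, Matrix.add_apply, smul_eq_mul]
  ring

theorem eq_of_hasMatDerivWithinAt_zero (hs : Convex ℝ s)
    (h : ∀ x ∈ s, HasMatDerivWithinAt A 0 s x) {a b : ℝ} (ha : a ∈ s) (hb : b ∈ s) :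
    A a = A b := by
  ext i j
  have := hs.norm_image_sub_le_of_norm_hasDerivWithin_le (C := 0) (fun x hx => h x hx i j)
    (by simp) hb ha
  rw [zero_mul] at this
  exact sub_eq_zero.1 (norm_le_zero_iff.1 this)

end Derivatives

theorem rotAbout_mul_hat_dir (u : Vec) (φ : ℝ) :
    rotAbout u φ * hat (dir u) = hat (dir u) * rotAbout u φ := by
  have h1 : Matrix.mulVec (hat (dir u)) (dir u) = 0 := hat_mulVec_self _
  have h2 : Matrix.vecMul (dir u) (hat (dir u)) = 0 := vecMul_hat_self _
  simp only [rotAbout, add_mul, mul_add, smul_mul_assoc, mul_smul_comm, Matrix.vecMulVec_mul,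
    Matrix.mul_vecMulVec, h1, h2, Matrix.vecMulVec_zero, Matrix.zero_vecMulVec, one_mul, mul_one]

/-! ### Rigid motions: the Euler equations and steady rotations. -/

section RigidMotion

variable {I : Mat} {ℓ : Vec} {R : ℝ → Mat}

theorem bodyMomentum_dotProduct_self {S : Mat}
    (hS : S ∈ Matrix.specialOrthogonalGroup (Fin 3) ℝ) (ℓ : Vec) :
    bodyMomentum ℓ S ⬝ᵥ bodyMomentum ℓ S = ℓ ⬝ᵥ ℓ :=
  mulVec_dotProduct_mulVec (transpose_mem hS) ℓ ℓ

theorem IsRigidMotion.hasDerivAt_bodyMomentum (h : IsRigidMotion I ℓ R) (t : ℝ) (i : Fin 3) :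
    HasDerivAt (fun x => bodyMomentum ℓ (R x) i)
      (crossProduct (bodyMomentum ℓ (R t)) (Matrix.mulVec I⁻¹ (bodyMomentum ℓ (R t))) i) t := by
  have h1 : HasMatDerivWithinAt R _ univ t := (h t).2
  have h2 := h1.transpose.mulVec (v := fun _ => ℓ) (v' := 0)
    (fun i => hasDerivWithinAt_const _ _ _) i
  rw [hasDerivWithinAt_univ] at h2
  refine h2.congr_deriv (congrFun ?_ i)
  have hT : ∀ w : Vec, (hat w).transpose = -hat w := by
    intro w
    ext a b
    fin_cases a <;> fin_cases b <;> simp [hat]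
  rw [Matrix.transpose_mul, hT, Matrix.mulVec_zero, add_zero, ← Matrix.mulVec_mulVec,
    Matrix.neg_mulVec, hat_mulVec, cross_anticomm]
  rfl

/-- Rotation about a principal axis, with the constant angular velocity `w`. -/
theorem IsRigidMotion.eq_rotAbout_mul (h : IsRigidMotion I ℓ R) (hℓ : ℓ ≠ 0) {w : ℝ}
    (hw : ∀ t, Matrix.mulVec I⁻¹ (bodyMomentum ℓ (R t)) = (w / len ℓ) • bodyMomentum ℓ (R t))
    (t : ℝ) : R t = rotAbout ℓ (w * t) * R 0 := by
  have key : ∀ x ∈ univ, HasMatDerivWithinAt (fun y => rotAbout ℓ (-(w * y)) * R y) 0 univ x := by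
    intro x _
    have h1 : HasMatDerivWithinAt R _ univ x := (h x).2
    have hθ : HasDerivWithinAt (fun y => -(w * y)) (-(w * 1)) univ x :=
      ((hasDerivWithinAt_id x univ).const_mul w).neg
    have h2 := (hasMatDerivWithinAt_rotAbout hℓ hθ).mul h1
    have hz : R x * hat (Matrix.mulVec I⁻¹ (bodyMomentum ℓ (R x)))
        = w • (hat (dir ℓ) * R x) := by
      have : (w / len ℓ) • bodyMomentum ℓ (R x)
          = w • Matrix.mulVec (R x).transpose (dir ℓ) := by
        rw [bodyMomentum, dir, Matrix.mulVec_smul, smul_smul, div_eq_mul_inv]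
      have hs : ∀ v : Vec, hat (w • v) = w • hat v := by
        intro v
        ext a b
        fin_cases a <;> fin_cases b <;> simp [hat]
      rw [hw, this, hs, mul_smul_comm, mul_hat_transpose_mulVec (h x).1]
    rw [hz, mul_smul_comm, smul_mul_assoc, ← mul_assoc] at h2
    convert h2 using 1
    module
  have := eq_of_hasMatDerivWithinAt_zero convex_univ key (mem_univ t) (mem_univ 0)
  simp only [mul_zero, neg_zero, rotAbout_zero, one_mul] at this
  rw [← this, ← mul_assoc, rotAbout_mul hℓ, add_neg_cancel, rotAbout_zero, one_mul]

end RigidMotion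

/-! ### From the parameter of an ellipse to the polar angle. -/

/-- The continuous solution `Θ` of `tan Θ = σ tan ψ` for `σ > 0` that agrees with `ψ` at the
multiples of `π / 2`. -/
def scaledAngle (σ ψ : ℝ) : ℝ :=
  ψ + Real.arctan ((σ - 1) * Real.sin ψ * Real.cos ψ / (Real.cos ψ ^ 2 + σ * Real.sin ψ ^ 2))

section ScaledAngle

variable {σ : ℝ}

theorem cos_sq_add_mul_sin_sq_pos (hσ : 0 < σ) (ψ : ℝ) :
    0 < Real.cos ψ ^ 2 + σ * Real.sin ψ ^ 2 := by
  rcases eq_or_ne (Real.sin ψ) 0 with h | h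
  · have := Real.sin_sq_add_cos_sq ψ
    rw [h] at this ⊢
    linarith
  · have := mul_pos hσ (sq_pos_of_ne_zero h)
    positivity

/-- The squared quotient is tan²(Θ - ψ), by the subtraction formula for the tangent; its denominator
never vanishes, so no branch of the arctangent has to be chosen. The identity behind it is (cos² + σ
sin²)² + (σ-1)² sin² cos² = (cos² + σ² sin²)(cos² + sin²). -/
theorem one_add_sq_scaledAngle (hσ : 0 < σ) (ψ : ℝ) :
    1 + ((σ - 1) * Real.sin ψ * Real.cos ψ / (Real.cos ψ ^ 2 + σ * Real.sin ψ ^ 2)) ^ 2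
      = (Real.cos ψ ^ 2 + σ ^ 2 * Real.sin ψ ^ 2)
        / (Real.cos ψ ^ 2 + σ * Real.sin ψ ^ 2) ^ 2 := by
  have hD := (cos_sq_add_mul_sin_sq_pos hσ ψ).ne'
  rw [div_pow, eq_div_iff (pow_ne_zero 2 hD), add_mul, div_mul_cancel₀ _ (pow_ne_zero 2 hD)]
  linear_combination (Real.cos ψ ^ 2 + σ ^ 2 * Real.sin ψ ^ 2) * Real.sin_sq_add_cos_sq ψ

theorem sqrt_one_add_sq_scaledAngle (hσ : 0 < σ) (ψ : ℝ) :
    Real.sqrt (1 + ((σ - 1) * Real.sin ψ * Real.cos ψ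
        / (Real.cos ψ ^ 2 + σ * Real.sin ψ ^ 2)) ^ 2)
      = Real.sqrt (Real.cos ψ ^ 2 + σ ^ 2 * Real.sin ψ ^ 2)
        / (Real.cos ψ ^ 2 + σ * Real.sin ψ ^ 2) := by
  rw [one_add_sq_scaledAngle hσ, Real.sqrt_div' _ (sq_nonneg _),
    Real.sqrt_sq (cos_sq_add_mul_sin_sq_pos hσ ψ).le]

theorem sin_scaledAngle (hσ : 0 < σ) (ψ : ℝ) :
    Real.sin (scaledAngle σ ψ)
      = σ * Real.sin ψ / Real.sqrt (Real.cos ψ ^ 2 + σ ^ 2 * Real.sin ψ ^ 2) := by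
  have hD := (cos_sq_add_mul_sin_sq_pos hσ ψ).ne'
  have hW := (Real.sqrt_pos.2 (cos_sq_add_mul_sin_sq_pos (pow_pos hσ 2) ψ)).ne'
  rw [scaledAngle, Real.sin_add, Real.sin_arctan, Real.cos_arctan, sqrt_one_add_sq_scaledAngle hσ]
  rw [show ∀ n D W : ℝ, D ≠ 0 → W ≠ 0 → Real.sin ψ * (1 / (W / D)) + Real.cos ψ * (n / D / (W / D))
      = (Real.sin ψ * D + Real.cos ψ * n) / W by intros; field_simp, div_left_inj' hW]
  · linear_combination σ * Real.sin ψ * Real.sin_sq_add_cos_sq ψ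
  · exact hD
  · exact hW

theorem cos_scaledAngle (hσ : 0 < σ) (ψ : ℝ) :
    Real.cos (scaledAngle σ ψ)
      = Real.cos ψ / Real.sqrt (Real.cos ψ ^ 2 + σ ^ 2 * Real.sin ψ ^ 2) := by
  have hD := (cos_sq_add_mul_sin_sq_pos hσ ψ).ne'
  have hW := (Real.sqrt_pos.2 (cos_sq_add_mul_sin_sq_pos (pow_pos hσ 2) ψ)).ne'
  rw [scaledAngle, Real.cos_add, Real.sin_arctan, Real.cos_arctan, sqrt_one_add_sq_scaledAngle hσ]
  rw [show ∀ n D W : ℝ, D ≠ 0 → W ≠ 0 → Real.cos ψ * (1 / (W / D)) - Real.sin ψ * (n / D / (W / D))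
      = (Real.cos ψ * D - Real.sin ψ * n) / W by intros; field_simp, div_left_inj' hW]
  · linear_combination Real.cos ψ * Real.sin_sq_add_cos_sq ψ
  · exact hD
  · exact hW

/-- The scale may vary with the angle because `geometricRate_add` needs the scale k / `axial`. -/
theorem hasDerivAt_scaledAngle {τ : ℝ → ℝ} {τ' ψ : ℝ} (hτ : HasDerivAt τ τ' ψ)
    (h0 : 0 < τ ψ) :
    HasDerivAt (fun x => scaledAngle (τ x) x)
      ((τ' * Real.sin ψ * Real.cos ψ + τ ψ) / (Real.cos ψ ^ 2 + τ ψ ^ 2 * Real.sin ψ ^ 2)) ψ := by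
  have hD := (cos_sq_add_mul_sin_sq_pos h0 ψ).ne'
  have hW := (cos_sq_add_mul_sin_sq_pos (pow_pos h0 2) ψ).ne'
  have hs := Real.hasDerivAt_sin ψ
  have hc := Real.hasDerivAt_cos ψ
  have h := (hasDerivAt_id ψ).add
    (((((hτ.sub_const 1).mul hs).mul hc).div ((hc.pow 2).add (hτ.mul (hs.pow 2))) hD).arctan)
  refine h.congr_deriv ?_
  simp only [Pi.mul_apply, Pi.add_apply, Pi.pow_apply, Pi.div_apply]
  rw [one_add_sq_scaledAngle h0]
  field_simp
  have hsc := Real.sin_sq_add_cos_sq ψ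
  have : Real.cos ψ ^ 2 = 1 - Real.sin ψ ^ 2 := by linarith
  ring_nf
  simp only [show Real.cos ψ ^ 4 = (Real.cos ψ ^ 2) ^ 2 by ring,
    show Real.cos ψ ^ 3 = Real.cos ψ ^ 2 * Real.cos ψ by ring, this]
  ring

theorem scaledAngle_of_sin_eq_zero {ψ : ℝ} (h : Real.sin ψ = 0) : scaledAngle σ ψ = ψ := by
  simp [scaledAngle, h]

theorem scaledAngle_of_cos_eq_zero {ψ : ℝ} (h : Real.cos ψ = 0) : scaledAngle σ ψ = ψ := by
  simp [scaledAngle, h]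

theorem hasDerivAt_scaledAngle_const (hσ : 0 < σ) (ψ : ℝ) :
    HasDerivAt (scaledAngle σ) (σ / (Real.cos ψ ^ 2 + σ ^ 2 * Real.sin ψ ^ 2)) ψ := by
  simpa using hasDerivAt_scaledAngle (hasDerivAt_const ψ σ) hσ

theorem strictMono_scaledAngle (hσ : 0 < σ) : StrictMono (scaledAngle σ) :=
  strictMono_of_deriv_pos fun ψ => by
    rw [(hasDerivAt_scaledAngle_const hσ ψ).deriv]
    exact div_pos hσ (cos_sq_add_mul_sin_sq_pos (pow_pos hσ 2) ψ)

end ScaledAngle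

/-! ### Periodic integrands and scalar autonomous flows. -/

theorem integral_add_two_pi {w : ℝ → ℝ} (hw : Continuous w)
    (hp : Function.Periodic w (2 * Real.pi)) (x : ℝ) :
    ∫ y in (0 : ℝ)..x + 2 * Real.pi, w y
      = (∫ y in (0 : ℝ)..x, w y) + ∫ y in (0 : ℝ)..2 * Real.pi, w y := by
  have h := hp.intervalIntegral_add_eq x 0
  rw [zero_add] at h
  rw [← h, intervalIntegral.integral_add_adjacent_intervals] <;>
    exact hw.intervalIntegrable _ _

theorem integral_two_pi_mul {w : ℝ → ℝ} (hw : Continuous w)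
    (hp : Function.Periodic w (2 * Real.pi)) (n : ℕ) :
    ∫ y in (0 : ℝ)..2 * Real.pi * n, w y = n * ∫ y in (0 : ℝ)..2 * Real.pi, w y := by
  induction n with
  | zero => simp
  | succ n ih =>
    rw [Nat.cast_succ, mul_add_one, integral_add_two_pi hw hp, ih]
    ring

theorem integral_sin_sq_two_pi {g : ℝ → ℝ} (hg : Continuous fun x => g (Real.sin x ^ 2)) :
    ∫ x in (0 : ℝ)..2 * Real.pi, g (Real.sin x ^ 2)
      = 4 * ∫ x in (0 : ℝ)..Real.pi / 2, g (Real.sin x ^ 2) := by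
  have hi := fun a b => hg.intervalIntegrable (μ := volume) a b
  have h1 : ∫ x in Real.pi..2 * Real.pi, g (Real.sin x ^ 2)
      = ∫ x in (0 : ℝ)..Real.pi, g (Real.sin x ^ 2) := by
    have := intervalIntegral.integral_comp_add_right (a := 0) (b := Real.pi)
      (fun x => g (Real.sin x ^ 2)) Real.pi
    rw [zero_add, ← two_mul] at this
    rw [← this]
    simp
  have h2 : ∫ x in Real.pi / 2..Real.pi, g (Real.sin x ^ 2)
      = ∫ x in (0 : ℝ)..Real.pi / 2, g (Real.sin x ^ 2) := by
    have := intervalIntegral.integral_comp_sub_left (a := 0) (b := Real.pi / 2)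
      (fun x => g (Real.sin x ^ 2)) Real.pi
    rw [sub_zero, sub_half] at this
    rw [← this]
    simp
  rw [← intervalIntegral.integral_add_adjacent_intervals (hi 0 Real.pi) (hi Real.pi _), h1,
    ← intervalIntegral.integral_add_adjacent_intervals (hi 0 (Real.pi / 2)) (hi _ Real.pi), h2]
  ring

section Flow

variable {f ψ : ℝ → ℝ}

/-- Separation of variables: dt = dψ / f(ψ). The integral of 1/f is thus the inverse of ψ, and its
value over one turn is the time that ψ needs for 2π. -/
theorem integral_inv_flow (hf : Continuous f) (hpos : ∀ x, 0 < f x) (h0 : ψ 0 = 0)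
    (hψ : ∀ t, HasDerivAt ψ (f (ψ t)) t) (t : ℝ) : ∫ x in (0 : ℝ)..ψ t, (f x)⁻¹ = t := by
  have hc : Continuous fun x => (f x)⁻¹ := hf.inv₀ fun x => (hpos x).ne'
  have hd : ∀ u, HasDerivAt (fun t => (∫ x in (0 : ℝ)..ψ t, (f x)⁻¹) - t) 0 u := by
    intro u
    have h1 := (hc.integral_hasStrictDerivAt 0 (ψ u)).hasDerivAt.comp u (hψ u)
    rw [inv_mul_cancel₀ (hpos _).ne'] at h1
    exact (h1.sub (hasDerivAt_id u)).congr_deriv (sub_self 1)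
  have := is_const_of_deriv_eq_zero (fun u => (hd u).differentiableAt) (fun u => (hd u).deriv) t 0
  simp only [h0, intervalIntegral.integral_same, sub_zero] at this
  linarith

theorem strictMono_integral_inv (hf : Continuous f) (hpos : ∀ x, 0 < f x) :
    StrictMono fun u => ∫ x in (0 : ℝ)..u, (f x)⁻¹ := by
  have hc : Continuous fun x => (f x)⁻¹ := hf.inv₀ fun x => (hpos x).ne'
  refine strictMono_of_deriv_pos fun u => ?_
  rw [(hc.integral_hasStrictDerivAt 0 u).hasDerivAt.deriv]
  exact inv_pos.2 (hpos u)

theorem flow_integral_inv (hf : Continuous f) (hpos : ∀ x, 0 < f x) (h0 : ψ 0 = 0)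
    (hψ : ∀ t, HasDerivAt ψ (f (ψ t)) t) (x : ℝ) : ψ (∫ y in (0 : ℝ)..x, (f y)⁻¹) = x :=
  (strictMono_integral_inv hf hpos).injective (integral_inv_flow hf hpos h0 hψ _)

theorem strictMono_flow (hpos : ∀ x, 0 < f x) (hψ : ∀ t, HasDerivAt ψ (f (ψ t)) t) :
    StrictMono ψ :=
  strictMono_of_deriv_pos fun t => by
    rw [(hψ t).deriv]
    exact hpos _

theorem flow_add_period (hf : Continuous f) (hpos : ∀ x, 0 < f x)
    (hp : Function.Periodic f (2 * Real.pi)) (h0 : ψ 0 = 0)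
    (hψ : ∀ t, HasDerivAt ψ (f (ψ t)) t) (t : ℝ) :
    ψ (t + ∫ x in (0 : ℝ)..2 * Real.pi, (f x)⁻¹) = ψ t + 2 * Real.pi := by
  have hc : Continuous fun x => (f x)⁻¹ := hf.inv₀ fun x => (hpos x).ne'
  have hp' : Function.Periodic (fun x => (f x)⁻¹) (2 * Real.pi) := fun x => by simp only [hp x]
  have h := integral_add_two_pi hc hp' (ψ t)
  rw [integral_inv_flow hf hpos h0 hψ] at h
  rw [← h, flow_integral_inv hf hpos h0 hψ]

theorem flow_eq_two_pi_mul_iff (hf : Continuous f) (hpos : ∀ x, 0 < f x)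
    (hp : Function.Periodic f (2 * Real.pi)) (h0 : ψ 0 = 0)
    (hψ : ∀ t, HasDerivAt ψ (f (ψ t)) t) (n : ℕ) (t : ℝ) :
    ψ t = 2 * Real.pi * n ↔ t = n * ∫ x in (0 : ℝ)..2 * Real.pi, (f x)⁻¹ := by
  have hc : Continuous fun x => (f x)⁻¹ := hf.inv₀ fun x => (hpos x).ne'
  have hp' : Function.Periodic (fun x => (f x)⁻¹) (2 * Real.pi) := fun x => by simp only [hp x]
  rw [← integral_two_pi_mul hc hp' n]
  constructor
  · intro h
    rw [← h, integral_inv_flow hf hpos h0 hψ]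
  · rintro rfl
    exact flow_integral_inv hf hpos h0 hψ _

end Flow

/-! ### Height and geometric rate along the orbit. -/

/-- The modulus of the component along the twist axis, in units of `l`, on the orbit through
`l (0, c, -s)`, at the angle `ψ`. The orbit is `l (-k c sin ψ, c cos ψ, -axial k s c ψ)`. -/
def axial (k s c ψ : ℝ) : ℝ := Real.sqrt (s ^ 2 + (1 - k ^ 2) * c ^ 2 * Real.sin ψ ^ 2)

/-- The rate at which the azimuth of the twist axis about the angular momentum falls behind. -/
def geometricRate (k s c ψ : ℝ) : ℝ :=
  k * axial k s c ψ / (Real.cos ψ ^ 2 + k ^ 2 * Real.sin ψ ^ 2)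

section Axial

variable {k s c : ℝ}

theorem axial_radicand_pos (hs : 0 < s) (hk1 : k ^ 2 ≤ 1) (x : ℝ) :
    0 < s ^ 2 + (1 - k ^ 2) * c ^ 2 * x ^ 2 := by
  have : 0 ≤ (1 - k ^ 2) * c ^ 2 * x ^ 2 :=
    mul_nonneg (mul_nonneg (sub_nonneg.2 hk1) (sq_nonneg _)) (sq_nonneg _)
  have := pow_pos hs 2
  linarith

theorem axial_pos (hs : 0 < s) (hk1 : k ^ 2 ≤ 1) (ψ : ℝ) : 0 < axial k s c ψ :=
  Real.sqrt_pos.2 (axial_radicand_pos hs hk1 _)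

theorem axial_sq (hs : 0 < s) (hk1 : k ^ 2 ≤ 1) (ψ : ℝ) :
    axial k s c ψ ^ 2 = s ^ 2 + (1 - k ^ 2) * c ^ 2 * Real.sin ψ ^ 2 :=
  Real.sq_sqrt (axial_radicand_pos hs hk1 _).le

theorem continuous_axial : Continuous (axial k s c) := by
  unfold axial
  fun_prop

theorem continuous_geometricRate (hk : 0 < k) : Continuous (geometricRate k s c) := by
  unfold geometricRate
  exact (continuous_const.mul continuous_axial).div (by fun_prop)
    fun ψ => (cos_sq_add_mul_sin_sq_pos (pow_pos hk 2) ψ).ne'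

theorem periodic_axial : Function.Periodic (axial k s c) (2 * Real.pi) := fun ψ => by
  simp [axial]

theorem periodic_geometricRate : Function.Periodic (geometricRate k s c) (2 * Real.pi) :=
  fun ψ => by simp [geometricRate, periodic_axial ψ]

theorem hasDerivAt_axial (hs : 0 < s) (hk1 : k ^ 2 ≤ 1) (ψ : ℝ) :
    HasDerivAt (axial k s c)
      ((1 - k ^ 2) * c ^ 2 * Real.sin ψ * Real.cos ψ / axial k s c ψ) ψ := by
  have h := ((((Real.hasDerivAt_sin ψ).pow 2).const_mul ((1 - k ^ 2) * c ^ 2)).const_add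
    (s ^ 2)).sqrt (axial_radicand_pos hs hk1 _).ne'
  refine h.congr_deriv ?_
  norm_num [axial]
  field_simp

/-- The rate is an exact derivative minus a remainder. The angle with tangent (k / `axial`) tan ψ
gains π/2 over a quarter turn, and the remainder is of the form Π - K. -/
theorem geometricRate_add (hk : 0 < k) (hs : 0 < s) (hk1 : k ^ 2 ≤ 1) (hsc : s ^ 2 + c ^ 2 = 1)
    (ψ : ℝ) :
    HasDerivAt (fun x => scaledAngle (k / axial k s c x) x)
      (geometricRate k s c ψ
        + k * s ^ 2 * c ^ 2 * Real.cos ψ ^ 2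
          / ((1 - c ^ 2 * Real.cos ψ ^ 2) * axial k s c ψ)) ψ := by
  have hz := axial_pos (c := c) hs hk1 ψ
  have hz2 := axial_sq (c := c) hs hk1 ψ
  have hN := cos_sq_add_mul_sin_sq_pos (pow_pos hk 2) ψ
  have h := hasDerivAt_scaledAngle ((hasDerivAt_const ψ k).div (hasDerivAt_axial (c := c) hs hk1 ψ)
    hz.ne') (div_pos hk hz)
  refine h.congr_deriv ?_
  have hsin := Real.sin_sq_add_cos_sq ψ
  have hy : 0 < 1 - c ^ 2 * Real.cos ψ ^ 2 := by
    nlinarith [sq_nonneg (c * Real.sin ψ), pow_pos hs 2]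
  -- This factorisation produces both denominators, that of the geometric rate and that of the
  -- third-kind integrand; it uses s² + c² = 1.
  have hfac : axial k s c ψ ^ 2 * Real.cos ψ ^ 2 + k ^ 2 * Real.sin ψ ^ 2
      = (Real.cos ψ ^ 2 + k ^ 2 * Real.sin ψ ^ 2) * (1 - c ^ 2 * Real.cos ψ ^ 2) := by
    have e1 : Real.cos ψ ^ 2 = 1 - Real.sin ψ ^ 2 := by linarith
    have e2 : s ^ 2 = 1 - c ^ 2 := by linarith
    rw [hz2, e1, e2]
    ring
  have hW : Real.cos ψ ^ 2 + (k / axial k s c ψ) ^ 2 * Real.sin ψ ^ 2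
      = (Real.cos ψ ^ 2 + k ^ 2 * Real.sin ψ ^ 2) * (1 - c ^ 2 * Real.cos ψ ^ 2)
        / axial k s c ψ ^ 2 := by
    rw [← hfac]
    field_simp
  simp only [Pi.div_apply]
  rw [hW, geometricRate]
  field_simp
  have e1 : Real.cos ψ ^ 2 = 1 - Real.sin ψ ^ 2 := by linarith
  have e2 : s ^ 2 = 1 - c ^ 2 := by linarith
  simp only [zero_mul, zero_sub, hz2, e1, e2]
  linear_combination -(Real.sin ψ ^ 2 * k * c ^ 2 * (1 - k ^ 2)) * hsin

end Axial

/-! ### Reduction to complete elliptic integrals. -/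

section Elliptic

variable {k s c : ℝ}

/-- Counting the angle from the other end of the quarter turn makes the coefficient of sin²
negative, which is Legendre's normal form. -/
theorem axial_pi_div_two_sub (hs : 0 < s) (hk1 : k ^ 2 ≤ 1) (θ : ℝ) :
    axial k s c (Real.pi / 2 - θ) = Real.sqrt (s ^ 2 + (1 - k ^ 2) * c ^ 2)
      * Real.sqrt (1 - (1 - k ^ 2) * c ^ 2 / (s ^ 2 + (1 - k ^ 2) * c ^ 2) * Real.sin θ ^ 2) := by
  have h : 0 < s ^ 2 + (1 - k ^ 2) * c ^ 2 := by simpa using axial_radicand_pos (c := c) hs hk1 1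
  rw [axial, ← Real.sqrt_mul h.le, Real.sin_pi_div_two_sub]
  congr 1
  field_simp
  linear_combination (1 - k ^ 2) * c ^ 2 * Real.sin_sq_add_cos_sq θ

theorem integral_inv_axial (hs : 0 < s) (hk1 : k ^ 2 ≤ 1) :
    ∫ ψ in (0 : ℝ)..2 * Real.pi, (axial k s c ψ)⁻¹
      = 4 / Real.sqrt (s ^ 2 + (1 - k ^ 2) * c ^ 2)
        * ellipticK ((1 - k ^ 2) * c ^ 2 / (s ^ 2 + (1 - k ^ 2) * c ^ 2)) := by
  have hc : Continuous fun ψ => (axial k s c ψ)⁻¹ :=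
    continuous_axial.inv₀ fun ψ => (axial_pos hs hk1 ψ).ne'
  have h1 := integral_sin_sq_two_pi
    (g := fun y => (Real.sqrt (s ^ 2 + (1 - k ^ 2) * c ^ 2 * y))⁻¹) hc
  have h2 := intervalIntegral.integral_comp_sub_left (a := 0) (b := Real.pi / 2)
    (fun x => (axial k s c x)⁻¹) (Real.pi / 2)
  rw [sub_zero, sub_self] at h2
  unfold axial at h2 ⊢
  have h3 : ∀ θ, (Real.sqrt (s ^ 2 + (1 - k ^ 2) * c ^ 2 * Real.sin (Real.pi / 2 - θ) ^ 2))⁻¹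
      = (Real.sqrt (s ^ 2 + (1 - k ^ 2) * c ^ 2))⁻¹ * (1 / Real.sqrt
        (1 - (1 - k ^ 2) * c ^ 2 / (s ^ 2 + (1 - k ^ 2) * c ^ 2) * Real.sin θ ^ 2)) := by
    intro θ
    have := axial_pi_div_two_sub (c := c) hs hk1 θ
    unfold axial at this
    rw [this, mul_inv, one_div]
  simp_rw [h3] at h2
  rw [h1, ← h2, ellipticK, intervalIntegral.integral_const_mul]
  ring

theorem one_sub_mul_sin_sq_pos (hs : 0 < s) (hsc : s ^ 2 + c ^ 2 = 1) (θ : ℝ) :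
    0 < 1 - c ^ 2 * Real.sin θ ^ 2 := by
  nlinarith [sq_nonneg (c * Real.cos θ), pow_pos hs 2, Real.sin_sq_add_cos_sq θ]

theorem continuous_inv_sqrt_axial (hs : 0 < s) (hk1 : k ^ 2 ≤ 1) :
    Continuous fun θ => 1 / Real.sqrt
      (1 - (1 - k ^ 2) * c ^ 2 / (s ^ 2 + (1 - k ^ 2) * c ^ 2) * Real.sin θ ^ 2) := by
  refine continuous_const.div (by fun_prop) fun θ => ?_
  have h1 := axial_pi_div_two_sub (c := c) hs hk1 θ
  intro h0
  rw [h0, mul_zero] at h1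
  exact (axial_pos hs hk1 _).ne' h1

theorem integral_geometricRate (hk : 0 < k) (hs : 0 < s) (hk1 : k ^ 2 ≤ 1)
    (hsc : s ^ 2 + c ^ 2 = 1) :
    ∫ ψ in (0 : ℝ)..2 * Real.pi, geometricRate k s c ψ
      = 2 * Real.pi - 4 * (k * s ^ 2 / Real.sqrt (s ^ 2 + (1 - k ^ 2) * c ^ 2))
        * (ellipticPi (c ^ 2) ((1 - k ^ 2) * c ^ 2 / (s ^ 2 + (1 - k ^ 2) * c ^ 2))
          - ellipticK ((1 - k ^ 2) * c ^ 2 / (s ^ 2 + (1 - k ^ 2) * c ^ 2))) := by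
  have hg := continuous_geometricRate (s := s) (c := c) hk
  have hy : ∀ ψ, 0 < 1 - c ^ 2 * Real.cos ψ ^ 2 := fun ψ => by
    simpa [Real.sin_pi_div_two_sub] using one_sub_mul_sin_sq_pos hs hsc (Real.pi / 2 - ψ)
  have hr : Continuous fun ψ => k * s ^ 2 * c ^ 2 * Real.cos ψ ^ 2
      / ((1 - c ^ 2 * Real.cos ψ ^ 2) * axial k s c ψ) :=
    Continuous.div (by fun_prop)
      ((by fun_prop : Continuous fun ψ => 1 - c ^ 2 * Real.cos ψ ^ 2).mul continuous_axial)
      fun ψ => (mul_pos (hy ψ) (axial_pos hs hk1 ψ)).ne'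
  have h1 : ∫ ψ in (0 : ℝ)..2 * Real.pi, geometricRate k s c ψ
      = 4 * ∫ ψ in (0 : ℝ)..Real.pi / 2, geometricRate k s c ψ := by
    have h := integral_sin_sq_two_pi (g := fun y =>
      k * Real.sqrt (s ^ 2 + (1 - k ^ 2) * c ^ 2 * y) / (1 - y + k ^ 2 * y))
    simp only [← Real.cos_sq'] at h
    exact h hg
  have h2 := intervalIntegral.integral_eq_sub_of_hasDerivAt (a := 0) (b := Real.pi / 2)
    (fun ψ _ => geometricRate_add (c := c) hk hs hk1 hsc ψ)
    ((hg.add hr).intervalIntegrable _ _)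
  rw [intervalIntegral.integral_add (hg.intervalIntegrable _ _) (hr.intervalIntegrable _ _),
    scaledAngle_of_cos_eq_zero Real.cos_pi_div_two, scaledAngle_of_sin_eq_zero Real.sin_zero,
    sub_zero] at h2
  have h3 := intervalIntegral.integral_comp_sub_left (a := 0) (b := Real.pi / 2)
    (fun ψ => k * s ^ 2 * c ^ 2 * Real.cos ψ ^ 2
      / ((1 - c ^ 2 * Real.cos ψ ^ 2) * axial k s c ψ)) (Real.pi / 2)
  rw [sub_zero, sub_self] at h3
  have hK := continuous_inv_sqrt_axial (k := k) (c := c) hs hk1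
  have hP : Continuous fun θ => 1 / ((1 - c ^ 2 * Real.sin θ ^ 2) * Real.sqrt
      (1 - (1 - k ^ 2) * c ^ 2 / (s ^ 2 + (1 - k ^ 2) * c ^ 2) * Real.sin θ ^ 2)) := by
    have h : Continuous fun θ => 1 / (1 - c ^ 2 * Real.sin θ ^ 2) :=
      continuous_const.div (by fun_prop) fun θ => (one_sub_mul_sin_sq_pos hs hsc θ).ne'
    refine (h.mul hK).congr fun θ => ?_
    simp only [Pi.mul_apply]
    rw [one_div_mul_one_div]
  -- After ψ = π/2 - θ, the splitting c² sin²θ / (1 - c² sin²θ) = 1 / (1 - c² sin²θ) - 1 gives Π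
  -- with characteristic c² minus K.
  have h4 : ∫ ψ in (0 : ℝ)..Real.pi / 2, k * s ^ 2 * c ^ 2 * Real.cos ψ ^ 2
      / ((1 - c ^ 2 * Real.cos ψ ^ 2) * axial k s c ψ)
      = k * s ^ 2 / Real.sqrt (s ^ 2 + (1 - k ^ 2) * c ^ 2)
        * (ellipticPi (c ^ 2) ((1 - k ^ 2) * c ^ 2 / (s ^ 2 + (1 - k ^ 2) * c ^ 2))
          - ellipticK ((1 - k ^ 2) * c ^ 2 / (s ^ 2 + (1 - k ^ 2) * c ^ 2))) := by
    rw [← h3, ellipticPi, ellipticK, ← intervalIntegral.integral_sub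
      (hP.intervalIntegrable _ _) (hK.intervalIntegrable _ _),
      ← intervalIntegral.integral_const_mul]
    congr 1
    funext θ
    have hz := axial_pos (c := c) hs hk1 (Real.pi / 2 - θ)
    have h0 := (one_sub_mul_sin_sq_pos hs hsc θ).ne'
    rw [axial_pi_div_two_sub hs hk1] at hz ⊢
    have ha := left_ne_zero_of_mul hz.ne'
    have hb := right_ne_zero_of_mul hz.ne'
    rw [Real.cos_pi_div_two_sub]
    generalize Real.sqrt (1 - _) = b at *
    field_simp
    ring
  rw [h1]
  linarith

/-- Here and below s² / (2ρ) stands for h, its value by `paramH_eq`; so 2hρ = s² and ν = c². -/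
theorem paramN_eq {ρ : ℝ} (hρ : 0 < ρ) (hsc : s ^ 2 + c ^ 2 = 1) :
    paramN (s ^ 2 / (2 * ρ)) ρ = c ^ 2 := by
  rw [paramN]
  field_simp
  linarith

theorem radicand_eq {ρ : ℝ} (hkρ : k ^ 2 * (1 + ρ ^ 2) = 1) (hsc : s ^ 2 + c ^ 2 = 1) :
    s ^ 2 + (1 - k ^ 2) * c ^ 2 = k ^ 2 * (s ^ 2 + ρ ^ 2) := by
  linear_combination (1 - k ^ 2) * hsc - hkρ

theorem paramM_eq {ρ : ℝ} (hρ : 0 < ρ) (hk : 0 < k) (hkρ : k ^ 2 * (1 + ρ ^ 2) = 1)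
    (hsc : s ^ 2 + c ^ 2 = 1) :
    paramM (s ^ 2 / (2 * ρ)) ρ = (1 - k ^ 2) * c ^ 2 / (s ^ 2 + (1 - k ^ 2) * c ^ 2) := by
  have hX0 : 0 < s ^ 2 + ρ ^ 2 := by positivity
  have h1 : 1 - k ^ 2 = k ^ 2 * ρ ^ 2 := by linear_combination -hkρ
  have h2 : paramM (s ^ 2 / (2 * ρ)) ρ
      = ρ * paramN (s ^ 2 / (2 * ρ)) ρ / (2 * (s ^ 2 / (2 * ρ)) + ρ) := rfl
  rw [h2, paramN_eq hρ hsc, radicand_eq hkρ hsc, h1]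
  field_simp

theorem sqrt_eq_paramG {ρ : ℝ} (hρ : 0 < ρ) (hk : 0 < k) (hkρ : k ^ 2 * (1 + ρ ^ 2) = 1)
    (hsc : s ^ 2 + c ^ 2 = 1) :
    Real.sqrt (s ^ 2 + (1 - k ^ 2) * c ^ 2) = k * ρ / paramG (s ^ 2 / (2 * ρ)) ρ := by
  have h1 : 1 + 2 * (s ^ 2 / (2 * ρ)) / ρ = (s ^ 2 + ρ ^ 2) / ρ ^ 2 := by
    field_simp
    ring
  rw [paramG, h1, radicand_eq hkρ hsc, Real.sqrt_div' _ (sq_nonneg ρ), Real.sqrt_sq hρ.le,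
    Real.sqrt_mul (sq_nonneg k), Real.sqrt_sq hk.le]
  field_simp

theorem capAngle_eq {ρ : ℝ} (hρ : 0 < ρ) (hk : 0 < k) (hkρ : k ^ 2 * (1 + ρ ^ 2) = 1)
    (hsc : s ^ 2 + c ^ 2 = 1) :
    capAngle (s ^ 2 / (2 * ρ)) ρ
      = 4 * (k * s ^ 2 / Real.sqrt (s ^ 2 + (1 - k ^ 2) * c ^ 2))
        * (ellipticPi (c ^ 2) ((1 - k ^ 2) * c ^ 2 / (s ^ 2 + (1 - k ^ 2) * c ^ 2))
          - ellipticK ((1 - k ^ 2) * c ^ 2 / (s ^ 2 + (1 - k ^ 2) * c ^ 2))) := by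
  rw [capAngle, paramN_eq hρ hsc, paramM_eq hρ hk hkρ hsc, sqrt_eq_paramG hρ hk hkρ hsc]
  have hG : 0 < paramG (s ^ 2 / (2 * ρ)) ρ := one_div_pos.2 (Real.sqrt_pos.2 (by positivity))
  field_simp
  ring

end Elliptic

/-! ### The solid angle as an integral of the height over the azimuth. -/

theorem lintegral_Ioc_ofReal {f : ℝ → ℝ} {a b : ℝ} (hab : a ≤ b) (hf : Continuous f)
    (h0 : ∀ x ∈ Ioc a b, 0 ≤ f x) :
    ∫⁻ x in Ioc a b, ENNReal.ofReal (f x) = ENNReal.ofReal (∫ x in a..b, f x) := by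
  rw [intervalIntegral.integral_of_le hab, ofReal_integral_eq_lintegral_ofReal]
  · exact (hf.integrableOn_Icc (a := a) (b := b)).mono_set Ioc_subset_Icc_self
  · exact (ae_restrict_iff' measurableSet_Ioc).2 (Filter.Eventually.of_forall h0)

/-- For C ≤ B the set is empty and `ofReal` truncates the right side to 0. Otherwise the set lies
between the open and the closed interval from √B to √C, which differ by a null set. -/
theorem lintegral_radius {B : ℝ} (hB : 0 ≤ B) (C : ℝ) :
    ∫⁻ r in {r : ℝ | 0 < r ∧ B ≤ r ^ 2 ∧ r ^ 2 < C}, ENNReal.ofReal r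
      = ENNReal.ofReal ((C - B) / 2) := by
  rcases le_or_gt C B with h | h
  · have : {r : ℝ | 0 < r ∧ B ≤ r ^ 2 ∧ r ^ 2 < C} = ∅ := by
      ext r
      simp only [mem_ofPred_eq, mem_empty_iff_false, iff_false]
      rintro ⟨_, h1, h2⟩
      linarith
    rw [this, setLIntegral_empty, ENNReal.ofReal_of_nonpos (by linarith)]
  · have hC : 0 < C := lt_of_le_of_lt hB h
    have hle : Real.sqrt B ≤ Real.sqrt C := Real.sqrt_le_sqrt h.le
    have hval : ∫⁻ r in Ioc (Real.sqrt B) (Real.sqrt C), ENNReal.ofReal r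
        = ENNReal.ofReal ((C - B) / 2) := by
      rw [lintegral_Ioc_ofReal (f := fun r => r) hle continuous_id
        fun x hx => (Real.sqrt_nonneg B).trans hx.1.le, integral_id, Real.sq_sqrt hC.le, Real.sq_sqrt hB]
    apply le_antisymm
    · rw [← hval, setLIntegral_congr Ioc_ae_eq_Icc]
      refine lintegral_mono_set ?_
      rintro r ⟨hr, h1, h2⟩
      exact ⟨Real.sqrt_le_iff.2 ⟨hr.le, h1⟩, Real.le_sqrt_of_sq_le h2.le⟩
    · rw [← hval, setLIntegral_congr Ioo_ae_eq_Ioc.symm]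
      refine lintegral_mono_set ?_
      rintro r ⟨h1, h2⟩
      have hr : 0 < r := (Real.sqrt_nonneg B).trans_lt h1
      exact ⟨hr, (Real.sqrt_le_iff.1 h1.le).2, (Real.lt_sqrt hr.le).1 h2⟩

/-- The truncation in `ofReal` removes everything below -ζ, so a quadratic is integrated over [-ζ,
0]. -/
theorem lintegral_height {ζ : ℝ} (hζ : 0 < ζ) :
    ∫⁻ z in Iic (0 : ℝ), ENNReal.ofReal ((1 - z ^ 2 / ζ ^ 2) / 2) = ENNReal.ofReal (ζ / 3) := by
  have hsplit : Iic (0 : ℝ) = Iic (-ζ) ∪ Ioc (-ζ) 0 := (Iic_union_Ioc_eq_Iic (by linarith)).symm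
  have hzero : ∫⁻ z in Iic (-ζ), ENNReal.ofReal ((1 - z ^ 2 / ζ ^ 2) / 2) = 0 := by
    rw [setLIntegral_congr_fun measurableSet_Iic (g := fun _ => 0), lintegral_zero]
    intro z hz
    refine ENNReal.ofReal_of_nonpos ?_
    have : 1 ≤ z ^ 2 / ζ ^ 2 := by
      rw [one_le_div (by positivity)]
      nlinarith [mem_Iic.1 hz]
    linarith
  rw [hsplit, lintegral_union measurableSet_Ioc (Iic_disjoint_Ioc le_rfl), hzero, zero_add,
    lintegral_Ioc_ofReal (by linarith) (by fun_prop)]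
  · congr 1
    have : ∀ z : ℝ, (1 - z ^ 2 / ζ ^ 2) / 2 = 1 / 2 - (2 * ζ ^ 2)⁻¹ * z ^ 2 := by
      intro z
      field_simp
    simp_rw [this]
    rw [intervalIntegral.integral_sub (by simp) (by
      apply Continuous.intervalIntegrable; fun_prop),
      intervalIntegral.integral_const_mul, integral_pow]
    simp
    field_simp
    ring
  · intro z hz
    have : z ^ 2 / ζ ^ 2 ≤ 1 := by
      rw [div_le_one (by positivity)]
      nlinarith [hz.1, hz.2]
    linarith

/-- The part of the open unit ball, without its centre, between the equator and the orbit. -/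
def coneSet (c s ρ : ℝ) : Set Vec :=
  {w | w 2 ≤ 0 ∧ c ^ 2 * w 2 ^ 2 ≤ s ^ 2 * (w 0 ^ 2 + w 1 ^ 2) + ρ ^ 2 * w 0 ^ 2 ∧
    0 < w 0 ^ 2 + w 1 ^ 2 + w 2 ^ 2 ∧ w 0 ^ 2 + w 1 ^ 2 + w 2 ^ 2 < 1}

theorem measurableSet_coneSet (c s ρ : ℝ) : MeasurableSet (coneSet c s ρ) := by
  have h1 : MeasurableSet {w : Vec | w 2 ≤ 0} := measurableSet_le (by fun_prop) (by fun_prop)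
  have h2 : MeasurableSet {w : Vec |
      c ^ 2 * w 2 ^ 2 ≤ s ^ 2 * (w 0 ^ 2 + w 1 ^ 2) + ρ ^ 2 * w 0 ^ 2} :=
    measurableSet_le (by fun_prop) (by fun_prop)
  have h3 : MeasurableSet {w : Vec | 0 < w 0 ^ 2 + w 1 ^ 2 + w 2 ^ 2} :=
    measurableSet_lt (by fun_prop) (by fun_prop)
  have h4 : MeasurableSet {w : Vec | w 0 ^ 2 + w 1 ^ 2 + w 2 ^ 2 < 1} :=
    measurableSet_lt (by fun_prop) (by fun_prop)
  exact h1.inter (h2.inter (h3.inter h4))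

/-- At azimuth φ and height z ≤ 0 the cone and the ball confine r² to an interval of length 1 -
z²/ζ², where ζ is the height of the orbit at that azimuth. The slice contributes ζ/3, as in
Archimedes' theorem. -/
theorem volume_coneSet_slice {c s ρ : ℝ} (hs : 0 < s) (hsc : s ^ 2 + c ^ 2 = 1) (φ : ℝ) :
    ∫⁻ z : ℝ, ∫⁻ r in Ioi (0 : ℝ), ENNReal.ofReal r *
      (coneSet c s ρ).indicator 1 ![r * Real.cos φ, r * Real.sin φ, z]
      = ENNReal.ofReal (Real.sqrt ((s ^ 2 + ρ ^ 2 * Real.cos φ ^ 2)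
        / (1 + ρ ^ 2 * Real.cos φ ^ 2)) / 3) := by
  have hA : 0 < s ^ 2 + ρ ^ 2 * Real.cos φ ^ 2 := by positivity
  have hB : 0 < 1 + ρ ^ 2 * Real.cos φ ^ 2 := by positivity
  have hq := div_pos hA hB
  rw [← lintegral_height (Real.sqrt_pos.2 hq), ← lintegral_indicator measurableSet_Iic]
  congr 1
  funext z
  rw [Real.sq_sqrt hq.le]
  have hpyth := Real.sin_sq_add_cos_sq φ
  by_cases hz : z ≤ 0
  · rw [indicator_of_mem (mem_Iic.2 hz)]
    have hset : MeasurableSet {r : ℝ | 0 < r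
        ∧ c ^ 2 * z ^ 2 / (s ^ 2 + ρ ^ 2 * Real.cos φ ^ 2) ≤ r ^ 2 ∧ r ^ 2 < 1 - z ^ 2} := by
      have h3 : MeasurableSet {r : ℝ |
          c ^ 2 * z ^ 2 / (s ^ 2 + ρ ^ 2 * Real.cos φ ^ 2) ≤ r ^ 2} :=
        measurableSet_le (by fun_prop) (by fun_prop)
      have h4 : MeasurableSet {r : ℝ | r ^ 2 < 1 - z ^ 2} :=
        measurableSet_lt (by fun_prop) (by fun_prop)
      exact measurableSet_Ioi.inter (h3.inter h4)
    have h1 := lintegral_radius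
      (B := c ^ 2 * z ^ 2 / (s ^ 2 + ρ ^ 2 * Real.cos φ ^ 2)) (by positivity) (1 - z ^ 2)
    have h2 : (1 - z ^ 2 - c ^ 2 * z ^ 2 / (s ^ 2 + ρ ^ 2 * Real.cos φ ^ 2)) / 2
        = (1 - z ^ 2 / ((s ^ 2 + ρ ^ 2 * Real.cos φ ^ 2) / (1 + ρ ^ 2 * Real.cos φ ^ 2))) / 2 := by
      rw [show (1 : ℝ) + ρ ^ 2 * Real.cos φ ^ 2
        = (s ^ 2 + ρ ^ 2 * Real.cos φ ^ 2) + c ^ 2 by linear_combination -hsc]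
      field_simp
      ring
    rw [← h2, ← h1, ← lintegral_indicator measurableSet_Ioi, ← lintegral_indicator hset]
    congr 1
    funext r
    by_cases hr : 0 < r
    · rw [indicator_of_mem (mem_Ioi.2 hr)]
      have hiff : ![r * Real.cos φ, r * Real.sin φ, z] ∈ coneSet c s ρ ↔ r ∈ {r : ℝ | 0 < r
          ∧ c ^ 2 * z ^ 2 / (s ^ 2 + ρ ^ 2 * Real.cos φ ^ 2) ≤ r ^ 2 ∧ r ^ 2 < 1 - z ^ 2} := by
        have e1 : (r * Real.cos φ) ^ 2 + (r * Real.sin φ) ^ 2 = r ^ 2 := by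
          linear_combination r ^ 2 * hpyth
        have e2 : s ^ 2 * r ^ 2 + ρ ^ 2 * (r * Real.cos φ) ^ 2
            = r ^ 2 * (s ^ 2 + ρ ^ 2 * Real.cos φ ^ 2) := by ring
        simp only [coneSet, mem_ofPred_eq, Matrix.cons_val, e1, e2]
        rw [div_le_iff₀ hA]
        have := pow_pos hr 2
        constructor
        · rintro ⟨-, h1, -, h2⟩
          exact ⟨hr, h1, by linarith⟩
        · rintro ⟨-, h1, h2⟩
          exact ⟨hz, h1, by positivity, by linarith⟩
      by_cases hm : ![r * Real.cos φ, r * Real.sin φ, z] ∈ coneSet c s ρ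
      · rw [indicator_of_mem hm, indicator_of_mem (hiff.1 hm)]
        simp
      · rw [indicator_of_notMem hm, indicator_of_notMem fun h => hm (hiff.2 h)]
        simp
    · rw [indicator_of_notMem (by simpa using hr), indicator_of_notMem fun h => hr h.1]
  · rw [indicator_of_notMem (by simpa using hz)]
    have : ∀ r : ℝ, (coneSet c s ρ).indicator (1 : Vec → ENNReal)
        ![r * Real.cos φ, r * Real.sin φ, z] = 0 :=
      fun r => indicator_of_notMem (fun h => hz h.1) _
    simp [this]

theorem volume_coneSet {c s ρ : ℝ} (hs : 0 < s) (hsc : s ^ 2 + c ^ 2 = 1) :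
    volume (coneSet c s ρ) = ENNReal.ofReal (∫ φ in -Real.pi..Real.pi,
      Real.sqrt ((s ^ 2 + ρ ^ 2 * Real.cos φ ^ 2) / (1 + ρ ^ 2 * Real.cos φ ^ 2)) / 3) := by
  have hf : Continuous fun φ : ℝ =>
      Real.sqrt ((s ^ 2 + ρ ^ 2 * Real.cos φ ^ 2) / (1 + ρ ^ 2 * Real.cos φ ^ 2)) / 3 :=
    (Continuous.sqrt (Continuous.div (by fun_prop) (by fun_prop)
      fun φ => by positivity)).div_const 3
  rw [← lintegral_Ioc_ofReal (by linarith [Real.pi_pos]) hf fun x _ => by positivity,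
    setLIntegral_congr Ioo_ae_eq_Ioc.symm]
  simp_rw [← volume_coneSet_slice (ρ := ρ) hs hsc]
  -- Splitting off the axial coordinate leaves a plane for polar coordinates; Tonelli then puts the
  -- azimuth outermost.
  set e : (ℝ × ℝ × ℝ) → Vec := fun q => ![q.2.1, q.2.2, q.1] with he
  have hmeas : Measurable e := by
    rw [measurable_pi_iff]
    intro i
    fin_cases i
    · exact measurable_snd.fst
    · exact measurable_snd.snd
    · exact measurable_fst
  have hpres : MeasurePreserving e volume volume := by
    have h1 := (volume_preserving_piFinSuccAbove (fun _ : Fin 3 => ℝ) 2).symm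
    have h2 := ((MeasurePreserving.id (volume : Measure ℝ)).prod
      (volume_preserving_finTwoArrow ℝ).symm)
    have h3 := h1.comp h2
    have hcomp : e = (MeasurableEquiv.piFinSuccAbove (fun _ : Fin 3 => ℝ) 2).symm
        ∘ Prod.map id MeasurableEquiv.finTwoArrow.symm := by
      funext q i
      fin_cases i <;> rfl
    rw [hcomp]
    exact h3
  have hind : Measurable ((coneSet c s ρ).indicator (1 : Vec → ENNReal)) :=
    measurable_one.indicator (measurableSet_coneSet c s ρ)
  rw [← lintegral_indicator_one (measurableSet_coneSet c s ρ), ← hpres.lintegral_comp hind,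
    Measure.volume_eq_prod, lintegral_prod (fun q => (coneSet c s ρ).indicator (1 : Vec → ENNReal) (e q)) (hind.comp hmeas).aemeasurable]
  have hpolar : ∀ z : ℝ, ∫⁻ w : ℝ × ℝ, (coneSet c s ρ).indicator (1 : Vec → ENNReal) (e (z, w))
      = ∫⁻ φ in Ioo (-Real.pi) Real.pi, ∫⁻ r in Ioi (0 : ℝ), ENNReal.ofReal r *
        (coneSet c s ρ).indicator 1 ![r * Real.cos φ, r * Real.sin φ, z] := by
    intro z
    rw [← lintegral_comp_polarCoord_symm, polarCoord_target, Measure.volume_eq_prod,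
      setLIntegral_prod_symm]
    · rfl
    · refine Measurable.aemeasurable ?_
      refine (by fun_prop : Measurable fun p : ℝ × ℝ => ENNReal.ofReal p.1).mul ?_
      refine (hind.comp hmeas).comp (measurable_const.prodMk ?_)
      exact continuous_polarCoord_symm.measurable
  simp_rw [hpolar]
  refine lintegral_lintegral_swap (Measurable.aemeasurable ?_)
  refine Measurable.lintegral_prod_right' (f := fun y : (ℝ × ℝ) × ℝ => ENNReal.ofReal y.2 *
    (coneSet c s ρ).indicator 1 ![y.2 * Real.cos y.1.2, y.2 * Real.sin y.1.2, y.1.1]) ?_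
  refine (by fun_prop : Measurable fun y : (ℝ × ℝ) × ℝ => ENNReal.ofReal y.2).mul
    (hind.comp ?_)
  rw [measurable_pi_iff]
  intro i
  fin_cases i <;> simp <;> fun_prop

/-- The measure `toSphere` of a set is the dimension times the volume of the cone over it in the
unit ball without its centre. For a set A invariant under positive scaling this cone is A itself cut
by the ball. -/
theorem toSphere_real_eq (A : Set Vec) (hA : MeasurableSet A)
    (hcone : ∀ (r : ℝ) (w : Vec), 0 < r → (r • w ∈ A ↔ w ∈ A)) :
    (volume : Measure (EuclideanSpace ℝ (Fin 3))).toSphere.real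
      {u | (u : EuclideanSpace ℝ (Fin 3)).ofLp ∈ A}
      = 3 * volume.real {w : Vec | w ∈ A ∧ 0 < w ⬝ᵥ w ∧ w ⬝ᵥ w < 1} := by
  have hm : MeasurableSet {w : Vec | w ∈ A ∧ 0 < w ⬝ᵥ w ∧ w ⬝ᵥ w < 1} := by
    have h3 : MeasurableSet {w : Vec | 0 < w ⬝ᵥ w} := by
      simp only [dotProduct]
      exact measurableSet_lt (by fun_prop) (by fun_prop)
    have h4 : MeasurableSet {w : Vec | w ⬝ᵥ w < 1} := by
      simp only [dotProduct]
      exact measurableSet_lt (by fun_prop) (by fun_prop)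
    exact hA.inter (h3.inter h4)
  have hmS : MeasurableSet {u : Metric.sphere (0 : EuclideanSpace ℝ (Fin 3)) 1 |
      (u : EuclideanSpace ℝ (Fin 3)).ofLp ∈ A} :=
    ((PiLp.volume_preserving_ofLp (Fin 3)).measurable.comp measurable_subtype_coe) hA
  have hnorm : ∀ v : EuclideanSpace ℝ (Fin 3), v.ofLp ⬝ᵥ v.ofLp = ‖v‖ ^ 2 := by
    intro v
    rw [EuclideanSpace.real_norm_sq_eq]
    simp [dotProduct, sq]
  have hset : Ioo (0 : ℝ) 1 • ((↑) '' {u : Metric.sphere (0 : EuclideanSpace ℝ (Fin 3)) 1 |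
      (u : EuclideanSpace ℝ (Fin 3)).ofLp ∈ A})
      = (fun v : EuclideanSpace ℝ (Fin 3) => v.ofLp) ⁻¹'
        {w : Vec | w ∈ A ∧ 0 < w ⬝ᵥ w ∧ w ⬝ᵥ w < 1} := by
    ext v
    simp only [mem_smul, mem_image, mem_preimage, mem_ofPred_eq, hnorm]
    constructor
    · rintro ⟨r, ⟨hr0, hr1⟩, _, ⟨u, hu, rfl⟩, rfl⟩
      have hu1 : ‖(u : EuclideanSpace ℝ (Fin 3))‖ = 1 := by simp
      refine ⟨?_, ?_⟩
      · rw [WithLp.ofLp_smul]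
        exact (hcone r _ hr0).2 hu
      · rw [norm_smul, hu1, mul_one, Real.norm_of_nonneg hr0.le]
        exact ⟨by positivity, by nlinarith⟩
    · rintro ⟨hv, h0, h1⟩
      have hpos : 0 < ‖v‖ := by
        rcases (norm_nonneg v).eq_or_lt with h | h
        · simp [← h] at h0
        · exact h
      refine ⟨‖v‖, ⟨hpos, by nlinarith⟩, ‖v‖⁻¹ • v,
        ⟨⟨‖v‖⁻¹ • v, ?_⟩, ?_, rfl⟩, ?_⟩
      · rw [mem_sphere_zero_iff_norm, norm_smul, norm_inv, norm_norm, inv_mul_cancel₀ hpos.ne']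
      · rw [WithLp.ofLp_smul]
        exact (hcone _ _ (inv_pos.2 hpos)).2 hv
      · rw [smul_smul, mul_inv_cancel₀ hpos.ne', one_smul]
  rw [Measure.real, Measure.toSphere_apply' _ hmS, hset,
    (PiLp.volume_preserving_ofLp (Fin 3)).measure_preimage hm.nullMeasurableSet]
  simp [Measure.real]

theorem measurePreserving_mulVec {Q : Mat} (hQ : Q ∈ Matrix.specialOrthogonalGroup (Fin 3) ℝ) :
    MeasurePreserving (fun w : Vec => Matrix.mulVec Q w) volume volume := by
  have hdet : Q.det = 1 := (Matrix.mem_specialOrthogonalGroup_iff.1 hQ).2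
  have h := Real.map_matrix_volume_pi_eq_smul_volume_pi (M := Q) (by rw [hdet]; exact one_ne_zero)
  rw [hdet] at h
  refine ⟨?_, ?_⟩
  · exact (continuous_const.matrix_mulVec continuous_id).measurable
  · rw [show (fun w : Vec => Matrix.mulVec Q w) = Matrix.toLin' Q from rfl]
    simpa using h

theorem energy_smul (I : Mat) (r : ℝ) (w : Vec) : energy I (r • w) = r ^ 2 * energy I w := by
  rw [energy, energy, Matrix.mulVec_smul, smul_dotProduct, dotProduct_smul, smul_eq_mul,
    smul_eq_mul]
  ring

theorem solidAngle_eq_integral {I Q : Mat} (hQ : Q ∈ Matrix.specialOrthogonalGroup (Fin 3) ℝ)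
    {Jx Jy Jz l s c ρ : ℝ}
    (hI : ∀ w, energy I (Matrix.mulVec Q w)
      = (Jx⁻¹ * w 0 ^ 2 + Jy⁻¹ * w 1 ^ 2 + Jz⁻¹ * w 2 ^ 2) / 2)
    (hl : 0 < l) (hs : 0 < s) (hsc : s ^ 2 + c ^ 2 = 1) (hp : 0 < Jz⁻¹ - Jy⁻¹)
    (hρ : ρ ^ 2 * (Jz⁻¹ - Jy⁻¹) = Jy⁻¹ - Jx⁻¹) :
    solidAngle I (Matrix.mulVec Q ![0, 0, 1]) l (l ^ 2 / 2 * (Jy⁻¹ * c ^ 2 + Jz⁻¹ * s ^ 2))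
      = ∫ φ in -Real.pi..Real.pi,
        Real.sqrt ((s ^ 2 + ρ ^ 2 * Real.cos φ ^ 2) / (1 + ρ ^ 2 * Real.cos φ ^ 2)) := by
  set E := l ^ 2 / 2 * (Jy⁻¹ * c ^ 2 + Jz⁻¹ * s ^ 2) with hE
  -- The factor w · w, equal to 1 on the sphere, makes the energy condition homogeneous and A a
  -- cone.
  set A : Set Vec := {w | Matrix.mulVec Q ![0, 0, 1] ⬝ᵥ w ≤ 0 ∧ energy I (l • w) ≤ E * (w ⬝ᵥ w)}
    with hA
  have hAm : MeasurableSet A := by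
    have h1 : MeasurableSet {w : Vec | Matrix.mulVec Q ![0, 0, 1] ⬝ᵥ w ≤ 0} := by
      simp only [dotProduct]
      exact measurableSet_le (by fun_prop) (by fun_prop)
    have h2 : MeasurableSet {w : Vec | energy I (l • w) ≤ E * (w ⬝ᵥ w)} := by
      simp only [energy_smul]
      simp only [energy, dotProduct, Matrix.mulVec]
      exact measurableSet_le (by fun_prop) (by fun_prop)
    exact h1.inter h2
  have hcone : ∀ (r : ℝ) (w : Vec), 0 < r → (r • w ∈ A ↔ w ∈ A) := by
    intro r w hr
    have h1 : energy I (l • r • w) = r ^ 2 * energy I (l • w) := by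
      rw [smul_comm, energy_smul]
    simp only [hA, mem_ofPred_eq, h1, dotProduct_smul, smul_dotProduct, smul_eq_mul]
    have h2 : E * (r * (r * (w ⬝ᵥ w))) = r ^ 2 * (E * (w ⬝ᵥ w)) := by ring
    rw [h2, mul_le_mul_iff_right₀ (pow_pos hr 2), ← mul_zero r, mul_le_mul_iff_right₀ hr]
    simp
  have hsphere : solidAngle I (Matrix.mulVec Q ![0, 0, 1]) l E
      = (volume : Measure (EuclideanSpace ℝ (Fin 3))).toSphere.real
        {u | (u : EuclideanSpace ℝ (Fin 3)).ofLp ∈ A} := by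
    rw [solidAngle]
    congr 1
    ext u
    have hu : (u : EuclideanSpace ℝ (Fin 3)).ofLp ⬝ᵥ (u : EuclideanSpace ℝ (Fin 3)).ofLp = 1 := by
      have h1 : ‖(u : EuclideanSpace ℝ (Fin 3))‖ ^ 2 = 1 := by simp
      rw [EuclideanSpace.real_norm_sq_eq] at h1
      simpa [dotProduct, sq] using h1
    simp only [hA, mem_ofPred_eq, hu, mul_one]
  have hpre : (fun w : Vec => Matrix.mulVec Q w) ⁻¹' {w : Vec | w ∈ A ∧ 0 < w ⬝ᵥ w ∧ w ⬝ᵥ w < 1}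
      = coneSet c s ρ := by
    ext w
    have hww : w ⬝ᵥ w = w 0 ^ 2 + w 1 ^ 2 + w 2 ^ 2 := by
      simp [dotProduct, Fin.sum_univ_three, sq]
    have hz : ![0, 0, 1] ⬝ᵥ w = w 2 := by simp [dotProduct, Fin.sum_univ_three]
    have hen : energy I (l • Matrix.mulVec Q w) ≤ E * (w 0 ^ 2 + w 1 ^ 2 + w 2 ^ 2)
        ↔ c ^ 2 * w 2 ^ 2 ≤ s ^ 2 * (w 0 ^ 2 + w 1 ^ 2) + ρ ^ 2 * w 0 ^ 2 := by
      rw [energy_smul, hI, ← sub_nonneg, ← sub_nonneg (b := c ^ 2 * w 2 ^ 2)]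
      -- Subtracting Jy⁻¹ times the squared length from both quadratic forms leaves a multiple of
      -- the form that defines `coneSet`.
      have hid : E * (w 0 ^ 2 + w 1 ^ 2 + w 2 ^ 2)
          - l ^ 2 * ((Jx⁻¹ * w 0 ^ 2 + Jy⁻¹ * w 1 ^ 2 + Jz⁻¹ * w 2 ^ 2) / 2)
          = l ^ 2 / 2 * (Jz⁻¹ - Jy⁻¹) * (s ^ 2 * (w 0 ^ 2 + w 1 ^ 2) + ρ ^ 2 * w 0 ^ 2
            - c ^ 2 * w 2 ^ 2) := by
        rw [hE]
        linear_combination l ^ 2 / 2 * (Jy⁻¹ * (w 0 ^ 2 + w 1 ^ 2 + w 2 ^ 2)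
          + (Jz⁻¹ - Jy⁻¹) * w 2 ^ 2) * hsc - l ^ 2 / 2 * w 0 ^ 2 * hρ
      rw [hid]
      exact mul_nonneg_iff_of_pos_left (by positivity)
    simp only [mem_preimage, hA, mem_ofPred_eq, mulVec_dotProduct_mulVec hQ, hz, hww, hen, coneSet,
      and_assoc]
  have hAm' : MeasurableSet {w : Vec | w ∈ A ∧ 0 < w ⬝ᵥ w ∧ w ⬝ᵥ w < 1} := by
    have h3 : MeasurableSet {w : Vec | 0 < w ⬝ᵥ w} := by
      simp only [dotProduct]
      exact measurableSet_lt (by fun_prop) (by fun_prop)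
    have h4 : MeasurableSet {w : Vec | w ⬝ᵥ w < 1} := by
      simp only [dotProduct]
      exact measurableSet_lt (by fun_prop) (by fun_prop)
    exact hAm.inter (h3.inter h4)
  rw [hsphere, toSphere_real_eq A hAm hcone, Measure.real,
    ← (measurePreserving_mulVec hQ).measure_preimage hAm'.nullMeasurableSet, hpre,
    volume_coneSet hs hsc, ENNReal.toReal_ofReal, intervalIntegral.integral_div]
  · ring
  · exact intervalIntegral.integral_nonneg (by linarith [Real.pi_pos]) fun x _ => by positivity

/-- The azimuth on the orbit is `scaledAngle k ψ` up to a quarter turn. Substituting it turns the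
height into `axial`, and its derivative supplies the rest of `geometricRate`. -/
theorem integral_height_eq {k s c ρ : ℝ} (hk : 0 < k) (hkρ : k ^ 2 * (1 + ρ ^ 2) = 1)
    (hsc : s ^ 2 + c ^ 2 = 1) :
    ∫ φ in -Real.pi..Real.pi,
        Real.sqrt ((s ^ 2 + ρ ^ 2 * Real.cos φ ^ 2) / (1 + ρ ^ 2 * Real.cos φ ^ 2))
      = ∫ ψ in (0 : ℝ)..2 * Real.pi, geometricRate k s c ψ := by
  set w : ℝ → ℝ := fun φ =>
    Real.sqrt ((s ^ 2 + ρ ^ 2 * Real.sin φ ^ 2) / (1 + ρ ^ 2 * Real.sin φ ^ 2)) with hw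
  have hwc : Continuous w :=
    Continuous.sqrt (Continuous.div (by fun_prop) (by fun_prop) fun φ => by positivity)
  have hwp : Function.Periodic w (2 * Real.pi) := fun φ => by simp [hw]
  have h1 := intervalIntegral.integral_comp_add_right (a := -Real.pi) (b := Real.pi) w
    (Real.pi / 2)
  have h2 := hwp.intervalIntegral_add_eq (-Real.pi + Real.pi / 2) 0
  rw [zero_add, show -Real.pi + Real.pi / 2 + 2 * Real.pi = Real.pi + Real.pi / 2 by ring] at h2
  have h3 := intervalIntegral.integral_comp_mul_deriv (a := 0) (b := 2 * Real.pi)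
    (fun ψ _ => hasDerivAt_scaledAngle_const hk ψ)
    (Continuous.continuousOn (continuous_const.div (by fun_prop)
      fun ψ => (cos_sq_add_mul_sin_sq_pos (pow_pos hk 2) ψ).ne')) hwc
  rw [scaledAngle_of_sin_eq_zero Real.sin_zero, scaledAngle_of_sin_eq_zero Real.sin_two_pi,
    ← h2, ← h1] at h3
  simp only [hw, Real.sin_add_pi_div_two] at h3
  rw [← h3]
  congr 1
  funext ψ
  have hN := cos_sq_add_mul_sin_sq_pos (pow_pos hk 2) ψ
  have hpyth := Real.sin_sq_add_cos_sq ψ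
  have hsin : Real.sin (scaledAngle k ψ) ^ 2 = k ^ 2 * Real.sin ψ ^ 2
      / (Real.cos ψ ^ 2 + k ^ 2 * Real.sin ψ ^ 2) := by
    rw [sin_scaledAngle hk, div_pow, Real.sq_sqrt hN.le, mul_pow]
  have hval : (s ^ 2 + ρ ^ 2 * Real.sin (scaledAngle k ψ) ^ 2)
      / (1 + ρ ^ 2 * Real.sin (scaledAngle k ψ) ^ 2)
      = s ^ 2 + (1 - k ^ 2) * c ^ 2 * Real.sin ψ ^ 2 := by
    have e1 : ρ ^ 2 * Real.sin (scaledAngle k ψ) ^ 2 = (1 - k ^ 2) * Real.sin ψ ^ 2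
        / (Real.cos ψ ^ 2 + k ^ 2 * Real.sin ψ ^ 2) := by
      rw [hsin, ← mul_div_assoc]
      congr 1
      linear_combination Real.sin ψ ^ 2 * hkρ
    have e2 : 1 + ρ ^ 2 * Real.sin (scaledAngle k ψ) ^ 2
        = 1 / (Real.cos ψ ^ 2 + k ^ 2 * Real.sin ψ ^ 2) := by
      rw [e1]
      field_simp
      linear_combination hpyth
    rw [e2, e1]
    field_simp
    linear_combination s ^ 2 * hpyth - (1 - k ^ 2) * Real.sin ψ ^ 2 * hsc
  simp only [Function.comp, hval, geometricRate, axial]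
  ring

/-! ### Solution of the Euler equations and the twist angle. -/

theorem eq_of_hasDerivAt_zero {f : ℝ → ℝ} (hf : ∀ t, HasDerivAt f 0 t) (a b : ℝ) : f a = f b :=
  is_const_of_deriv_eq_zero (fun t => (hf t).differentiableAt) (fun t => (hf t).deriv) a b

/-- Solution of the Euler equations through `l (0, c, -s)` by an angle `ψ`. -/
theorem exists_angle_of_euler {p q l s c k : ℝ} {x y z : ℝ → ℝ} (hp : 0 < p) (hq : 0 ≤ q)
    (hl : 0 < l) (hs : 0 < s) (hk : 0 < k) (hkp : k ^ 2 * (p + q) = p)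
    (hx : ∀ t, HasDerivAt x (p * y t * z t) t)
    (hy : ∀ t, HasDerivAt y (-((p + q) * x t * z t)) t)
    (hz : ∀ t, HasDerivAt z (q * x t * y t) t)
    (hx0 : x 0 = 0) (hy0 : y 0 = l * c) (hz0 : z 0 = -(l * s)) :
    ∃ ψ : ℝ → ℝ, ψ 0 = 0 ∧ (∀ t, HasDerivAt ψ (p / k * l * axial k s c (ψ t)) t) ∧
      ∀ t, x t = -(k * l * c * Real.sin (ψ t)) ∧ y t = l * c * Real.cos (ψ t) ∧
        z t = -(l * axial k s c (ψ t)) := by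
  have hk1 : k ^ 2 ≤ 1 := by nlinarith [mul_nonneg (sq_nonneg k) hq]
  -- This first integral keeps z away from 0, so z stays negative by continuity.
  have hcons : ∀ t, p * z t ^ 2 - q * x t ^ 2 = p * (l * s) ^ 2 := by
    intro t
    have hd : ∀ t, HasDerivAt (fun t => p * z t ^ 2 - q * x t ^ 2) 0 t := by
      intro t
      refine ((((hz t).pow 2).const_mul p).sub (((hx t).pow 2).const_mul q)).congr_deriv ?_
      norm_num
      ring
    have := eq_of_hasDerivAt_zero hd t 0
    simpa [hx0, hz0] using this
  have hz2 : ∀ t, 0 < z t ^ 2 := by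
    intro t
    have h1 : 0 < p * (l * s) ^ 2 := by positivity
    have h2 : 0 ≤ q * x t ^ 2 := by positivity
    have h3 : 0 < p * z t ^ 2 := by linarith [hcons t]
    exact (mul_pos_iff_of_pos_left hp).1 h3
  have hzc : Continuous z := continuous_iff_continuousAt.2 fun t => (hz t).continuousAt
  have hzneg : ∀ t, z t < 0 := by
    intro t
    by_contra! h
    have hmem : (0 : ℝ) ∈ uIcc (z 0) (z t) := by
      rw [uIcc_of_le (by rw [hz0]; nlinarith [mul_pos hl hs])]
      exact ⟨by rw [hz0]; nlinarith [mul_pos hl hs], h⟩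
    obtain ⟨u, -, hu⟩ := intermediate_value_uIcc hzc.continuousOn hmem
    simpa [hu] using hz2 u
  -- As p + q = p/k², the vector (y, x/k) rotates rigidly at the speed (p/k) z. With ψ as its angle,
  -- `hf` and `hg` say that rotating it back gives the constant (l c, 0).
  set ψ : ℝ → ℝ := fun t => ∫ u in (0 : ℝ)..t, -(p / k) * z u with hψ
  have hψd : ∀ t, HasDerivAt ψ (-(p / k) * z t) t := fun t =>
    ((continuous_const.mul hzc).integral_hasStrictDerivAt 0 t).hasDerivAt
  have hψ0 : ψ 0 = 0 := intervalIntegral.integral_same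
  have hkk : (p + q) = p / k / k := by
    field_simp
    linarith
  have hf : ∀ t, y t * Real.cos (ψ t) - x t / k * Real.sin (ψ t) = l * c := by
    intro t
    have hd : ∀ t, HasDerivAt (fun t => y t * Real.cos (ψ t) - x t / k * Real.sin (ψ t)) 0 t := by
      intro t
      refine (((hy t).mul (hψd t).cos).sub (((hx t).div_const k).mul (hψd t).sin)).congr_deriv ?_
      rw [hkk]
      ring
    have := eq_of_hasDerivAt_zero hd t 0
    simpa [hx0, hy0, hψ0] using this
  have hg : ∀ t, y t * Real.sin (ψ t) + x t / k * Real.cos (ψ t) = 0 := by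
    intro t
    have hd : ∀ t, HasDerivAt (fun t => y t * Real.sin (ψ t) + x t / k * Real.cos (ψ t)) 0 t := by
      intro t
      refine (((hy t).mul (hψd t).sin).add (((hx t).div_const k).mul (hψd t).cos)).congr_deriv ?_
      rw [hkk]
      ring
    have := eq_of_hasDerivAt_zero hd t 0
    simpa [hx0, hy0, hψ0] using this
  have hxs : ∀ t, x t = -(k * l * c * Real.sin (ψ t)) := by
    intro t
    have h : x t / k = -(l * c * Real.sin (ψ t)) := by
      linear_combination Real.cos (ψ t) * hg t - Real.sin (ψ t) * hf t
        - x t / k * Real.sin_sq_add_cos_sq (ψ t)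
    rw [div_eq_iff hk.ne'] at h
    rw [h]
    ring
  have hys : ∀ t, y t = l * c * Real.cos (ψ t) := by
    intro t
    linear_combination Real.sin (ψ t) * hg t + Real.cos (ψ t) * hf t
      - y t * Real.sin_sq_add_cos_sq (ψ t)
  have hzs : ∀ t, z t = -(l * axial k s c (ψ t)) := by
    intro t
    have h : z t ^ 2 = (l * axial k s c (ψ t)) ^ 2 := by
      rw [mul_pow, axial_sq hs hk1]
      have := hcons t
      rw [hxs t] at this
      refine mul_left_cancel₀ hp.ne' ?_
      linear_combination this + (l * c * Real.sin (ψ t)) ^ 2 * hkp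
    have hpos := mul_pos hl (axial_pos (c := c) hs hk1 (ψ t))
    rcases sq_eq_sq_iff_eq_or_eq_neg.1 h with h | h
    · linarith [hzneg t]
    · exact h
  refine ⟨ψ, hψ0, fun t => ?_, fun t => ⟨hxs t, hys t, hzs t⟩⟩
  refine (hψd t).congr_deriv ?_
  rw [hzs t]
  ring

theorem perp_unit (v : Vec) : perp ![0, 0, 1] v = ![v 0, v 1, 0] := by
  have h : dir ![0, 0, 1] = ![0, 0, 1] := by simp [dir, len]
  rw [perp, h]
  ext i
  fin_cases i <;> simp [dotProduct, Fin.sum_univ_three]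

theorem rotAbout_unit (φ a b : ℝ) : Matrix.mulVec (rotAbout ![0, 0, 1] φ) ![a, b, 0]
    = ![Real.cos φ * a - Real.sin φ * b, Real.sin φ * a + Real.cos φ * b, 0] := by
  have h : dir ![0, 0, 1] = ![0, 0, 1] := by simp [dir, len]
  rw [rotAbout_mulVec_of_orthogonal _ _ (by rw [h]; simp [dotProduct, Fin.sum_univ_three]), h]
  ext i
  fin_cases i <;> simp [cross_apply] <;> ring

/-- The projection along the third axis runs on an ellipse with axis ratio k. Its polar angle,
counted from the second axis, is the scaled parameter. -/
theorem turnsBy_scaledAngle {l c k : ℝ} {v : ℝ → Vec} {ψ : ℝ → ℝ} (hlc : l * c ≠ 0) (hk : 0 < k)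
    (hψ : Continuous ψ) (hψ0 : ψ 0 = 0) (hx : ∀ t, v t 0 = -(k * l * c * Real.sin (ψ t)))
    (hy : ∀ t, v t 1 = l * c * Real.cos (ψ t)) (τ : ℝ) :
    TurnsBy ![0, 0, 1] v 0 τ (scaledAngle k (ψ τ)) := by
  have hcont : Continuous (scaledAngle k) :=
    continuous_iff_continuousAt.2 fun t => (hasDerivAt_scaledAngle_const hk t).continuousAt
  have hp0 : perp ![0, 0, 1] (v 0) = ![0, l * c, 0] := by
    rw [perp_unit, hx, hy, hψ0]
    simp
  refine ⟨?_, fun t => scaledAngle k (ψ t),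
    fun t => Real.sqrt (Real.cos (ψ t) ^ 2 + k ^ 2 * Real.sin (ψ t) ^ 2),
    (hcont.comp hψ).continuousOn, ?_, rfl, fun t _ => ?_⟩
  · rw [hp0]
    intro h
    exact hlc (by simpa using congrFun h 1)
  · simp only [hψ0]
    exact scaledAngle_of_sin_eq_zero Real.sin_zero
  · have hpos := Real.sqrt_pos.2 (cos_sq_add_mul_sin_sq_pos (pow_pos hk 2) (ψ t))
    refine ⟨hpos, ?_⟩
    rw [hp0, perp_unit, rotAbout_unit, hx, hy, sin_scaledAngle hk, cos_scaledAngle hk]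
    ext i
    fin_cases i
    · simp
      field_simp
    · simp
      field_simp
    · simp

/-! ### Precession of a principal axis about the angular momentum. -/

/-- The angular velocity in the principal frame relative to the frame that turns with the azimuth
of the third principal axis. -/
theorem frame_identity {A B C l x y z r : ℝ} (hr : r ^ 2 = x ^ 2 + y ^ 2) (hr0 : r ≠ 0)
    (hl : l ≠ 0) :
    ![(-(B - A) * x ^ 2 * y - (C - B) * y * z ^ 2) / r + (B - A) * x * y * z * (-z * x) / r ^ 3,
      (-(B - A) * x * y ^ 2 + (C - A) * x * z ^ 2) / r + (B - A) * x * y * z * (-z * y) / r ^ 3,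
      -2 * (B - A) * x * y * z / r + (B - A) * x * y * z * (x ^ 2 + y ^ 2) / r ^ 3]
    + crossProduct (![A * x, B * y, C * z]
        - (l * (A * x ^ 2 + B * y ^ 2) / (x ^ 2 + y ^ 2)) • (l⁻¹ • ![x, y, z]))
      ![-z * x / r, -z * y / r, (x ^ 2 + y ^ 2) / r] = 0 := by
  have e : r ^ 3 = r * (x ^ 2 + y ^ 2) := by rw [← hr]; ring
  have h0 : x ^ 2 + y ^ 2 ≠ 0 := by rw [← hr]; exact pow_ne_zero 2 hr0
  rw [e]
  ext i
  fin_cases i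
  · simp [cross_apply]
    field_simp
    ring
  · simp [cross_apply]
    field_simp
    ring
  · simp [cross_apply]
    field_simp
    ring

theorem hat_smul (a : ℝ) (v : Vec) : hat (a • v) = a • hat v := by
  ext i j
  fin_cases i <;> fin_cases j <;> simp [hat]

theorem hat_sub (v w : Vec) : hat (v - w) = hat v - hat w := by
  ext i j
  fin_cases i <;> fin_cases j <;> simp [hat] <;> ring

theorem hat_dir_mul {S : Mat} (hS : S ∈ Matrix.specialOrthogonalGroup (Fin 3) ℝ) (ℓ : Vec) :
    hat (dir ℓ) * S = S * hat ((len ℓ)⁻¹ • bodyMomentum ℓ S) := by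
  rw [← mul_hat_transpose_mulVec hS, dir, Matrix.mulVec_smul, bodyMomentum]

theorem mulVec_bodyMomentum {S : Mat} (hS : S ∈ Matrix.specialOrthogonalGroup (Fin 3) ℝ)
    (ℓ : Vec) : Matrix.mulVec S (bodyMomentum ℓ S) = ℓ := by
  rw [bodyMomentum, Matrix.mulVec_mulVec, mul_transpose_self_of_mem hS, Matrix.one_mulVec]

theorem len_bodyMomentum {S : Mat} (hS : S ∈ Matrix.specialOrthogonalGroup (Fin 3) ℝ)
    (ℓ : Vec) : len (bodyMomentum ℓ S) = len ℓ :=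
  len_mulVec (transpose_mem hS) ℓ

/-- The part of the third axis orthogonal to `v`, up to a factor. -/
def axisPart (v : Vec) : Vec :=
  ![-v 2 * v 0 / Real.sqrt (v 0 ^ 2 + v 1 ^ 2), -v 2 * v 1 / Real.sqrt (v 0 ^ 2 + v 1 ^ 2),
    (v 0 ^ 2 + v 1 ^ 2) / Real.sqrt (v 0 ^ 2 + v 1 ^ 2)]

theorem perp_eq_axisPart {v : Vec} (hv : 0 < v 0 ^ 2 + v 1 ^ 2) :
    perp v ![0, 0, 1] = (Real.sqrt (v 0 ^ 2 + v 1 ^ 2) / len v ^ 2) • axisPart v := by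
  have hr := (Real.sqrt_pos.2 hv).ne'
  have hl : len v ^ 2 = v 0 ^ 2 + v 1 ^ 2 + v 2 ^ 2 := by
    rw [len_sq]
    simp [dotProduct, Fin.sum_univ_three, sq]
  have hl0 : 0 < len v ^ 2 := by
    rw [hl]
    positivity
  have hl1 : len v ≠ 0 := fun h => by simp [h] at hl0
  have hz : v ⬝ᵥ ![0, 0, 1] = v 2 := by simp [dotProduct, Fin.sum_univ_three]
  rw [perp, dir, smul_dotProduct, hz, axisPart]
  ext i
  fin_cases i
  · simp
    field_simp
  · simp
    field_simp
  · simp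
    field_simp
    rw [Real.sq_sqrt hv.le]
    linarith

section ThirdAxis

variable {J : Mat} {ℓ : Vec} {S : ℝ → Mat} {A B C : ℝ}

/-- `axisPart` has the constant length |L|, so its body derivative is a pure rotation. The angular
velocity of the body relative to the frame turning with the azimuth is Ω minus the precession rate
times L/l; minus its cross product with the vector is the derivative. -/
theorem IsRigidMotion.hasDerivAt_axisPart (h : IsRigidMotion J ℓ S)
    (hJ : ∀ w, Matrix.mulVec J⁻¹ w = ![A * w 0, B * w 1, C * w 2])
    {t : ℝ} (hxy : 0 < bodyMomentum ℓ (S t) 0 ^ 2 + bodyMomentum ℓ (S t) 1 ^ 2)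
    (hℓ : ℓ ≠ 0) (i : Fin 3) :
    HasDerivAt (fun u => axisPart (bodyMomentum ℓ (S u)) i)
      ((-crossProduct (Matrix.mulVec J⁻¹ (bodyMomentum ℓ (S t))
        - (len ℓ * (A * bodyMomentum ℓ (S t) 0 ^ 2 + B * bodyMomentum ℓ (S t) 1 ^ 2)
          / (bodyMomentum ℓ (S t) 0 ^ 2 + bodyMomentum ℓ (S t) 1 ^ 2))
          • ((len ℓ)⁻¹ • bodyMomentum ℓ (S t))) (axisPart (bodyMomentum ℓ (S t)))) i) t := by
  have hd := h.hasDerivAt_bodyMomentum t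
  have hr0 := (Real.sqrt_pos.2 hxy).ne'
  have hr := Real.sq_sqrt hxy.le
  have hid := frame_identity (A := A) (B := B) (C := C) (l := len ℓ)
    (z := bodyMomentum ℓ (S t) 2) hr hr0 (len_pos hℓ).ne'
  have hv : ![bodyMomentum ℓ (S t) 0, bodyMomentum ℓ (S t) 1, bodyMomentum ℓ (S t) 2]
      = bodyMomentum ℓ (S t) := by
    ext i
    fin_cases i <;> rfl
  rw [hv] at hid
  have hx := hd 0
  have hy := hd 1
  have hz := hd 2
  rw [hJ] at hx hy hz
  simp only [cross_apply, Matrix.cons_val] at hx hy hz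
  have hsq := ((hx.pow 2).add (hy.pow 2)).sqrt hxy.ne'
  rw [hJ, axisPart, ← eq_neg_of_add_eq_zero_left hid]
  simp only [axisPart]
  fin_cases i
  · refine ((hz.neg.mul hx).div hsq hr0).congr_deriv ?_
    simp only [Pi.add_apply, Pi.pow_apply, Pi.neg_apply, Pi.mul_apply]
    simp
    field_simp
    ring
  · refine ((hz.neg.mul hy).div hsq hr0).congr_deriv ?_
    simp only [Pi.add_apply, Pi.pow_apply, Pi.neg_apply, Pi.mul_apply]
    simp
    field_simp
    ring
  · refine (((hx.pow 2).add (hy.pow 2)).div hsq hr0).congr_deriv ?_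
    simp only [Pi.add_apply, Pi.pow_apply]
    simp
    field_simp
    ring

/-- The precession of the third principal axis about the angular momentum. -/
theorem IsRigidMotion.turnsBy_third_axis (h : IsRigidMotion J ℓ S) (hℓ : ℓ ≠ 0)
    (hJ : ∀ w, Matrix.mulVec J⁻¹ w = ![A * w 0, B * w 1, C * w 2])
    (hxy : ∀ t, 0 < bodyMomentum ℓ (S t) 0 ^ 2 + bodyMomentum ℓ (S t) 1 ^ 2)
    {φ : ℝ → ℝ} (hφ0 : φ 0 = 0)
    (hφ : ∀ t, HasDerivAt φ
      (len ℓ * (A * bodyMomentum ℓ (S t) 0 ^ 2 + B * bodyMomentum ℓ (S t) 1 ^ 2)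
          / (bodyMomentum ℓ (S t) 0 ^ 2 + bodyMomentum ℓ (S t) 1 ^ 2)) t) (τ : ℝ) :
    TurnsBy ℓ (fun t => Matrix.mulVec (S t) ![0, 0, 1]) 0 τ (φ τ) := by
  -- Seen in space and turned back about ℓ by φ, the vector does not move, which identifies φ as the
  -- azimuth.
  have hd : ∀ i t, HasDerivAt (fun u => Matrix.mulVec (rotAbout ℓ (-φ u) * S u)
      (axisPart (bodyMomentum ℓ (S u))) i) 0 t := by
    intro i t
    have hS : HasMatDerivWithinAt S _ univ t := (h t).2
    have hF := (hasMatDerivWithinAt_rotAbout hℓ (hφ t).neg.hasDerivWithinAt).mul hS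
    have hFg := hF.mulVec
      (fun i => (h.hasDerivAt_axisPart hJ (hxy t) hℓ i).hasDerivWithinAt) i
    rw [hasDerivWithinAt_univ] at hFg
    refine hFg.congr_deriv ?_
    set a := len ℓ * (A * bodyMomentum ℓ (S t) 0 ^ 2 + B * bodyMomentum ℓ (S t) 1 ^ 2)
          / (bodyMomentum ℓ (S t) 0 ^ 2 + bodyMomentum ℓ (S t) 1 ^ 2)
    have hF' : -a • (rotAbout ℓ (-φ t) * hat (dir ℓ)) * S t + rotAbout ℓ (-φ t)
        * (S t * hat (Matrix.mulVec J⁻¹ (bodyMomentum ℓ (S t))))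
        = rotAbout ℓ (-φ t) * S t * hat (Matrix.mulVec J⁻¹ (bodyMomentum ℓ (S t))
          - a • ((len ℓ)⁻¹ • bodyMomentum ℓ (S t))) := by
      rw [hat_sub, hat_smul, mul_sub, smul_mul_assoc, mul_assoc, hat_dir_mul (h t).1,
        mul_smul_comm, mul_assoc, mul_assoc]
      module
    simp only [Pi.neg_apply]
    rw [hF', ← Matrix.mulVec_mulVec, hat_mulVec, ← Matrix.mulVec_add, add_neg_cancel,
      Matrix.mulVec_zero]
    rfl
  have hconst : ∀ t, Matrix.mulVec (S t) (axisPart (bodyMomentum ℓ (S t)))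
      = Matrix.mulVec (rotAbout ℓ (φ t))
        (Matrix.mulVec (S 0) (axisPart (bodyMomentum ℓ (S 0)))) := by
    intro t
    have h1 : Matrix.mulVec (rotAbout ℓ (-φ t) * S t) (axisPart (bodyMomentum ℓ (S t)))
        = Matrix.mulVec (S 0) (axisPart (bodyMomentum ℓ (S 0))) := by
      ext i
      have := eq_of_hasDerivAt_zero (hd i) t 0
      simpa [hφ0, rotAbout_zero] using this
    rw [← h1, ← Matrix.mulVec_mulVec, Matrix.mulVec_mulVec, rotAbout_mul hℓ, add_neg_cancel,
      rotAbout_zero, Matrix.one_mulVec]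
  have hperp : ∀ t, perp ℓ (Matrix.mulVec (S t) ![0, 0, 1])
      = (Real.sqrt (bodyMomentum ℓ (S t) 0 ^ 2 + bodyMomentum ℓ (S t) 1 ^ 2) / len ℓ ^ 2)
        • Matrix.mulVec (S t) (axisPart (bodyMomentum ℓ (S t))) := by
    intro t
    conv_lhs => rw [← mulVec_bodyMomentum (h t).1 ℓ]
    rw [perp_mulVec (h t).1, perp_eq_axisPart (hxy t), len_bodyMomentum (h t).1,
      Matrix.mulVec_smul]
  have hcoef : ∀ t,
      0 < Real.sqrt (bodyMomentum ℓ (S t) 0 ^ 2 + bodyMomentum ℓ (S t) 1 ^ 2) / len ℓ ^ 2 :=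
    fun t => div_pos (Real.sqrt_pos.2 (hxy t)) (pow_pos (len_pos hℓ) 2)
  have hφc : Continuous φ := continuous_iff_continuousAt.2 fun t => (hφ t).continuousAt
  refine ⟨?_, φ, fun t => (Real.sqrt (bodyMomentum ℓ (S t) 0 ^ 2 + bodyMomentum ℓ (S t) 1 ^ 2)
      / len ℓ ^ 2) / (Real.sqrt (bodyMomentum ℓ (S 0) 0 ^ 2 + bodyMomentum ℓ (S 0) 1 ^ 2)
      / len ℓ ^ 2), hφc.continuousOn, hφ0, rfl, fun t _ => ⟨div_pos (hcoef t) (hcoef 0), ?_⟩⟩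
  · apply perp_ne_zero (h 0).1
    have h1 := hxy 0
    have h2 := bodyMomentum_dotProduct_self (h 0).1 ℓ
    rw [← h2]
    simp only [dotProduct, Fin.sum_univ_three, Matrix.cons_val]
    nlinarith
  · rw [hperp t, hperp 0, hconst t, Matrix.mulVec_smul, smul_smul,
      div_mul_cancel₀ _ (hcoef 0).ne']

end ThirdAxis

/-! ### Kicks. -/

theorem exists_angle_of_sq_add_sq {x y : ℝ} (h : x ^ 2 + y ^ 2 = 1) :
    ∃ θ, Real.cos θ = x ∧ Real.sin θ = y := by
  have hn : ‖(⟨x, y⟩ : ℂ)‖ = 1 := by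
    have h1 := Complex.sq_norm (⟨x, y⟩ : ℂ)
    rw [Complex.normSq_mk, ← sq, ← sq, h] at h1
    exact (pow_eq_one_iff_of_nonneg (norm_nonneg _) two_ne_zero).1 h1
  refine ⟨Complex.arg ⟨x, y⟩, ?_, ?_⟩
  · have := Complex.norm_mul_cos_arg ⟨x, y⟩
    rwa [hn, one_mul] at this
  · have := Complex.norm_mul_sin_arg ⟨x, y⟩
    rwa [hn, one_mul] at this

theorem PosDef.apply_self_pos {I : Mat} (hI : I.PosDef) (i : Fin 3) : 0 < I i i := by
  have h := hI.dotProduct_mulVec_pos (x := Pi.single i 1) (by simp)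
  simpa using h

theorem PosDef.apply_comm {I : Mat} (hI : I.PosDef) (i j : Fin 3) : I i j = I j i := by
  simpa using hI.isHermitian.apply j i

theorem PosDef.inv_mulVec_eq {I : Mat} (hI : I.PosDef) {v w : Vec}
    (h : Matrix.mulVec I v = w) : Matrix.mulVec I⁻¹ w = v := by
  rw [← h, Matrix.mulVec_mulVec, Matrix.nonsing_inv_mul _ hI.det_pos.ne'.isUnit,
    Matrix.one_mulVec]

/-- Since I_xy = I_xz = 0, the x-axis is principal for every arm angle. The angular velocity of the
kick is therefore along x, and the rotation integrates explicitly. -/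
theorem KickModel.IsKick.exists_angle {M : KickModel} {R : ℝ → Mat} (h : M.IsKick R) :
    ∃ θ : ℝ → ℝ, θ Real.pi = M.tilt ∧ ∀ α ∈ Icc 0 Real.pi, R α * rotX (θ α) = R 0 := by
  have hpi := Real.pi_pos
  have hinv : ∀ α ∈ Icc 0 Real.pi, ∀ b : ℝ, Matrix.mulVec (M.inertia α)⁻¹ ![b, 0, 0]
      = ![(M.inertia α 0 0)⁻¹ * b, 0, 0] := by
    intro α hα b
    have hI := M.posDef α hα
    have h00 := (PosDef.apply_self_pos hI 0).ne'
    apply PosDef.inv_mulVec_eq hI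
    ext i
    fin_cases i
    · simp [Matrix.mulVec, dotProduct, Fin.sum_univ_three, h00]
    · simp [Matrix.mulVec, dotProduct, Fin.sum_univ_three, PosDef.apply_comm hI 1 0,
        M.inertia_xy α hα]
    · simp [Matrix.mulVec, dotProduct, Fin.sum_univ_three, PosDef.apply_comm hI 2 0,
        M.inertia_xz α hα]
  have hinv00 : ∀ α ∈ Icc 0 Real.pi, (M.inertia α)⁻¹ 0 0 = (M.inertia α 0 0)⁻¹ := by
    intro α hα
    have := congrFun (hinv α hα 1) 0
    simpa [Matrix.mulVec, dotProduct, Fin.sum_univ_three] using this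
  set w : ℝ → ℝ := fun α => (M.inertia α 0 0)⁻¹ * M.Ax α with hw
  have hwc : ContinuousOn w (Icc 0 Real.pi) := by
    refine ContinuousOn.mul (ContinuousOn.inv₀ ?_ fun α hα =>
      (PosDef.apply_self_pos (M.posDef α hα) 0).ne') M.continuousOn_Ax
    have h1 := continuousOn_pi.1 M.continuousOn_inertia 0
    exact continuousOn_pi.1 h1 0
  -- The rate is continuous only on [0, π]; a continuous extension makes its primitive
  -- differentiable at the end points as well.
  set W : ℝ → ℝ := IccExtend hpi.le ((Icc 0 Real.pi).domRestrict w) with hW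
  have hWc : Continuous W := (continuousOn_iff_continuous_domRestrict.1 hwc).Icc_extend'
  have hWw : ∀ α ∈ Icc 0 Real.pi, W α = w α := fun α hα => IccExtend_of_mem _ _ hα
  set θ : ℝ → ℝ := fun α => ∫ u in (0 : ℝ)..α, W u with hθ
  have hθpi : θ Real.pi = M.tilt := by
    refine intervalIntegral.integral_congr fun α hα => ?_
    rw [uIcc_of_le hpi.le] at hα
    simp only [hWw α hα, hw, hinv00 α hα]
  have he : (![1, 0, 0] : Vec) ≠ 0 := fun h => by simpa using congrFun h 0
  have hdir : dir ![1, 0, 0] = ![1, 0, 0] := by simp [dir, len]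
  have key : ∀ α ∈ Icc 0 Real.pi,
      HasMatDerivWithinAt (fun x => R x * rotAbout ![1, 0, 0] (θ x)) 0 (Icc 0 Real.pi) α := by
    intro α hα
    have h1 : HasMatDerivWithinAt R _ (Icc 0 Real.pi) α := (h α hα).2
    have h2 : HasDerivWithinAt θ (W α) (Icc 0 Real.pi) α :=
      (hWc.integral_hasStrictDerivAt 0 α).hasDerivAt.hasDerivWithinAt
    have h3 := h1.mul (hasMatDerivWithinAt_rotAbout he h2)
    have h4 : -Matrix.mulVec (M.inertia α)⁻¹ ![M.Ax α, 0, 0] = -W α • (![1, 0, 0] : Vec) := by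
      rw [hinv α hα, hWw α hα]
      ext i
      fin_cases i <;> simp [hw]
    rw [h4, hat_smul, rotAbout_mul_hat_dir, hdir] at h3
    convert h3 using 1
    rw [mul_smul_comm, mul_smul_comm, smul_mul_assoc, mul_assoc]
    module
  have hθ0 : θ 0 = 0 := intervalIntegral.integral_same
  refine ⟨θ, hθpi, fun α hα => ?_⟩
  have h5 := eq_of_hasMatDerivWithinAt_zero (convex_Icc 0 Real.pi) key hα
    (left_mem_Icc.2 hpi.le)
  simp only [hθ0, rotAbout_zero, mul_one] at h5
  rw [rotX_eq_rotAbout, h5]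

theorem KickModel.IsKick.eq_mul_rotX {M : KickModel} {R : ℝ → Mat} (h : M.IsKick R) :
    R 0 = R Real.pi * rotX M.tilt := by
  obtain ⟨θ, hθ, H⟩ := h.exists_angle
  rw [← H Real.pi ⟨Real.pi_pos.le, le_rfl⟩, hθ]

theorem KickModel.IsKick.mulVec_unit {M : KickModel} {R : ℝ → Mat} (h : M.IsKick R)
    {α : ℝ} (hα : α ∈ Icc 0 Real.pi) :
    Matrix.mulVec (R α) ![1, 0, 0] = Matrix.mulVec (R 0) ![1, 0, 0] := by
  obtain ⟨θ, -, H⟩ := h.exists_angle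
  have he : (![1, 0, 0] : Vec) ≠ 0 := fun h => by simpa using congrFun h 0
  rw [← H α hα, ← Matrix.mulVec_mulVec, rotX_eq_rotAbout, rotAbout_mulVec_self he]

/-! ### Pure somersaults. -/

/-- Grönwall in both time directions: f e^{-Kt} decreases and f e^{Kt} increases. -/
theorem eq_zero_of_abs_deriv_le {f f' : ℝ → ℝ} {K : ℝ} (hf : ∀ t, HasDerivAt f (f' t) t)
    (h0 : f 0 = 0) (hpos : ∀ t, 0 ≤ f t) (hK : ∀ t, |f' t| ≤ K * f t) (t : ℝ) : f t = 0 := by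
  have hd : ∀ a t : ℝ, HasDerivAt (fun t => f t * Real.exp (a * t))
      ((f' t + a * f t) * Real.exp (a * t)) t := by
    intro a t
    have h1 : HasDerivAt (fun t => Real.exp (a * t)) (Real.exp (a * t) * (a * 1)) t :=
      ((hasDerivAt_id t).const_mul a).exp
    refine ((hf t).mul h1).congr_deriv ?_
    ring
  have hanti : Antitone fun t => f t * Real.exp (-K * t) :=
    antitone_of_deriv_nonpos (fun t => (hd _ t).differentiableAt) fun t => by
      rw [(hd _ t).deriv]
      exact mul_nonpos_of_nonpos_of_nonneg (by linarith [(abs_le.1 (hK t)).2])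
        (Real.exp_pos _).le
  have hmono : Monotone fun t => f t * Real.exp (K * t) :=
    monotone_of_deriv_nonneg (fun t => (hd _ t).differentiableAt) fun t => by
      rw [(hd _ t).deriv]
      exact mul_nonneg (by linarith [(abs_le.1 (hK t)).1]) (Real.exp_pos _).le
  rcases le_total 0 t with h | h
  · have h1 := hanti h
    simp only [h0, zero_mul] at h1
    exact le_antisymm (nonpos_of_mul_nonpos_left h1 (Real.exp_pos _)) (hpos t)
  · have h1 := hmono h
    simp only [h0, zero_mul] at h1
    exact le_antisymm (nonpos_of_mul_nonpos_left h1 (Real.exp_pos _)) (hpos t)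

/-- If the angular momentum of a rigid motion is initially along the second principal axis, it
stays there. -/
theorem IsRigidMotion.bodyMomentum_eq_const {J : Mat} {ℓ : Vec} {S : ℝ → Mat} {A B C : ℝ}
    (h : IsRigidMotion J ℓ S) (hJ : ∀ w, Matrix.mulVec J⁻¹ w = ![A * w 0, B * w 1, C * w 2])
    (h0 : bodyMomentum ℓ (S 0) = ![0, len ℓ, 0]) (t : ℝ) :
    bodyMomentum ℓ (S t) = ![0, len ℓ, 0] := by
  have hd := fun t => h.hasDerivAt_bodyMomentum t
  simp only [hJ] at hd
  have hx := fun t => hd t 0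
  have hy := fun t => hd t 1
  have hz := fun t => hd t 2
  simp only [cross_apply, Matrix.cons_val] at hx hy hz
  have hn : ∀ t, bodyMomentum ℓ (S t) 0 ^ 2 + bodyMomentum ℓ (S t) 1 ^ 2
      + bodyMomentum ℓ (S t) 2 ^ 2 = len ℓ ^ 2 := by
    intro t
    rw [len_sq, ← bodyMomentum_dotProduct_self (h t).1 ℓ]
    simp [dotProduct, Fin.sum_univ_three, sq]
  have hl : 0 ≤ len ℓ := Real.sqrt_nonneg _
  -- The derivative of x² + z² is 2(C - A)xyz, and |y| ≤ l bounds it by a multiple of x² + z². No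
  -- stability of the axis is needed.
  have hxz : ∀ t, bodyMomentum ℓ (S t) 0 ^ 2 + bodyMomentum ℓ (S t) 2 ^ 2 = 0 := by
    refine eq_zero_of_abs_deriv_le (K := |C - A| * len ℓ)
      (fun t => ((hx t).pow 2).add ((hz t).pow 2)) (by simp [h0]) (fun t => by positivity)
      fun t => ?_
    have hyl : |bodyMomentum ℓ (S t) 1| ≤ len ℓ := by
      apply abs_le_of_sq_le_sq _ hl
      nlinarith [hn t, sq_nonneg (bodyMomentum ℓ (S t) 0), sq_nonneg (bodyMomentum ℓ (S t) 2)]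
    have hxzl : |2 * (bodyMomentum ℓ (S t) 0 * bodyMomentum ℓ (S t) 2)|
        ≤ bodyMomentum ℓ (S t) 0 ^ 2 + bodyMomentum ℓ (S t) 2 ^ 2 := by
      rw [abs_le]
      constructor
      · nlinarith [sq_nonneg (bodyMomentum ℓ (S t) 0 + bodyMomentum ℓ (S t) 2)]
      · nlinarith [sq_nonneg (bodyMomentum ℓ (S t) 0 - bodyMomentum ℓ (S t) 2)]
    calc _ = |(C - A) * bodyMomentum ℓ (S t) 1
          * (2 * (bodyMomentum ℓ (S t) 0 * bodyMomentum ℓ (S t) 2))| := by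
          congr 1
          norm_num
          ring
      _ = |C - A| * |bodyMomentum ℓ (S t) 1|
          * |2 * (bodyMomentum ℓ (S t) 0 * bodyMomentum ℓ (S t) 2)| := by
          rw [abs_mul, abs_mul]
      _ ≤ |C - A| * len ℓ * (bodyMomentum ℓ (S t) 0 ^ 2 + bodyMomentum ℓ (S t) 2 ^ 2) := by
          gcongr
  have h1 : ∀ t, bodyMomentum ℓ (S t) 0 = 0 := fun t => by
    nlinarith [hxz t, sq_nonneg (bodyMomentum ℓ (S t) 0), sq_nonneg (bodyMomentum ℓ (S t) 2)]
  have h2 : ∀ t, bodyMomentum ℓ (S t) 2 = 0 := fun t => by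
    nlinarith [hxz t, sq_nonneg (bodyMomentum ℓ (S t) 0), sq_nonneg (bodyMomentum ℓ (S t) 2)]
  have h3 : bodyMomentum ℓ (S t) 1 = len ℓ := by
    have := eq_of_hasDerivAt_zero (fun t => (hy t).congr_deriv (by rw [h1, h2]; ring)) t 0
    simpa [h0] using this
  ext i
  fin_cases i
  · simpa using h1 t
  · simpa using h3
  · simpa using h2 t

/-- A pure somersault: the attitude, the energy and the rotation about the angular momentum. -/
theorem KickModel.somersault (M : KickModel) {ℓ : Vec} (hℓ : ℓ ≠ 0) {R : ℝ → Mat}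
    (h : IsRigidMotion M.Is ℓ R) (h0 : bodyMomentum ℓ (R 0) = ![0, len ℓ, 0]) :
    (∀ t, bodyMomentum ℓ (R t) = ![0, len ℓ, 0]) ∧
    (∀ t, R t = rotAbout ℓ ((2 * energy M.Is ![0, len ℓ, 0] / len ℓ) * t) * R 0) ∧
    ∀ τ, TurnsBy ℓ (fun t => Matrix.mulVec (R t) ![1, 0, 0]) 0 τ
      ((2 * energy M.Is ![0, len ℓ, 0] / len ℓ) * τ) := by
  have hpi : Real.pi ∈ Icc 0 Real.pi := ⟨Real.pi_pos.le, le_rfl⟩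
  have hI : M.Is.PosDef := M.posDef _ hpi
  have h01 : M.Is 0 1 = 0 := M.inertia_xy _ hpi
  have h02 : M.Is 0 2 = 0 := M.inertia_xz _ hpi
  have h12 : M.Is 1 2 = 0 := M.inertia_yz_up
  have h10 : M.Is 1 0 = 0 := by rw [PosDef.apply_comm hI, h01]
  have h20 : M.Is 2 0 = 0 := by rw [PosDef.apply_comm hI, h02]
  have h21 : M.Is 2 1 = 0 := by rw [PosDef.apply_comm hI, h12]
  have hJ : ∀ w, Matrix.mulVec M.Is⁻¹ w
      = ![(M.Is 0 0)⁻¹ * w 0, (M.Is 1 1)⁻¹ * w 1, (M.Is 2 2)⁻¹ * w 2] := by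
    intro w
    have p0 := (PosDef.apply_self_pos hI 0).ne'
    have p1 := (PosDef.apply_self_pos hI 1).ne'
    have p2 := (PosDef.apply_self_pos hI 2).ne'
    apply PosDef.inv_mulVec_eq hI
    ext i
    fin_cases i
    · simp [Matrix.mulVec, dotProduct, Fin.sum_univ_three, h01, h02, p0]
    · simp [Matrix.mulVec, dotProduct, Fin.sum_univ_three, h10, h12, p1]
    · simp [Matrix.mulVec, dotProduct, Fin.sum_univ_three, h20, h21, p2]
  have hl := len_pos hℓ
  have hconst := h.bodyMomentum_eq_const hJ h0
  have hE : 2 * energy M.Is ![0, len ℓ, 0] / len ℓ = (M.Is 1 1)⁻¹ * len ℓ := by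
    rw [energy, hJ]
    simp [dotProduct, Fin.sum_univ_three]
    field_simp
  have hrot := h.eq_rotAbout_mul hℓ (w := 2 * energy M.Is ![0, len ℓ, 0] / len ℓ) fun t => by
    rw [hE, hconst, hJ]
    ext i
    fin_cases i <;> simp
    exact Or.inl (by field_simp)
  refine ⟨hconst, hrot, fun τ => ?_⟩
  have hperp : perp ℓ (Matrix.mulVec (R 0) ![1, 0, 0]) ≠ 0 := by
    apply perp_ne_zero (h 0).1
    rw [h0, ← len_sq]
    simp [dotProduct, Fin.sum_univ_three]
    positivity
  have := turnsBy_rotAbout hℓ hperp (s := 0) (t := τ)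
    (φ := fun t => 2 * energy M.Is ![0, len ℓ, 0] / len ℓ * t) (by fun_prop) (by simp)
  simpa only [Matrix.mulVec_mulVec, ← hrot] using this

/-! ### Passage to the principal frame of the twisting stage. -/

section PrincipalFrame

variable {I : Mat} {P Jx Jy Jz : ℝ}

theorem inertia_pos_of_principal (hI : I.PosDef)
    (hJ : rotX (-P) * I * rotX P = Matrix.diagonal ![Jx, Jy, Jz]) :
    0 < Jx ∧ 0 < Jy ∧ 0 < Jz := by
  have key : ∀ i, 0 < ![Jx, Jy, Jz] i := by
    intro i
    have hne : Matrix.mulVec (rotX P) (Pi.single i 1) ≠ 0 := by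
      intro h
      have h1 := mulVec_dotProduct_mulVec (rotX_mem P) (Pi.single i 1) (Pi.single i 1)
      rw [h] at h1
      simp at h1
    have h := hI.dotProduct_mulVec_pos hne
    have h2 : Matrix.mulVec (rotX P) (Pi.single i 1)
        ⬝ᵥ Matrix.mulVec I (Matrix.mulVec (rotX P) (Pi.single i 1)) = ![Jx, Jy, Jz] i := by
      rw [dotProduct_comm, Matrix.dotProduct_mulVec, ← Matrix.mulVec_transpose, transpose_rotX,
        Matrix.mulVec_mulVec, Matrix.mulVec_mulVec, hJ]
      simp
    rw [← h2]
    simpa using h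
  exact ⟨key 0, key 1, key 2⟩

theorem inv_mulVec_principal (hI : I.PosDef)
    (hJ : rotX (-P) * I * rotX P = Matrix.diagonal ![Jx, Jy, Jz]) (w : Vec) :
    Matrix.mulVec I⁻¹ (Matrix.mulVec (rotX P) w)
      = Matrix.mulVec (rotX P) ![Jx⁻¹ * w 0, Jy⁻¹ * w 1, Jz⁻¹ * w 2] := by
  obtain ⟨hx, hy, hz⟩ := inertia_pos_of_principal hI hJ
  apply PosDef.inv_mulVec_eq hI
  have h : I * rotX P = rotX P * Matrix.diagonal ![Jx, Jy, Jz] := by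
    rw [← hJ, ← mul_assoc, ← mul_assoc, rotX_mul, add_neg_cancel, rotX_zero, one_mul]
  rw [Matrix.mulVec_mulVec, h, ← Matrix.mulVec_mulVec]
  congr 1
  ext i
  rw [Matrix.mulVec_diagonal]
  fin_cases i
  · simp [hx.ne']
  · simp [hy.ne']
  · simp [hz.ne']

theorem inv_diagonal_mulVec (hx : Jx ≠ 0) (hy : Jy ≠ 0) (hz : Jz ≠ 0) (w : Vec) :
    Matrix.mulVec (Matrix.diagonal ![Jx, Jy, Jz])⁻¹ w
      = ![Jx⁻¹ * w 0, Jy⁻¹ * w 1, Jz⁻¹ * w 2] := by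
  have h : (Matrix.diagonal ![Jx, Jy, Jz] : Mat)⁻¹ = Matrix.diagonal ![Jx⁻¹, Jy⁻¹, Jz⁻¹] := by
    apply Matrix.inv_eq_right_inv
    rw [Matrix.diagonal_mul_diagonal, ← Matrix.diagonal_one]
    congr 1
    funext i
    fin_cases i
    · simp [hx]
    · simp [hy]
    · simp [hz]
  rw [h]
  ext i
  rw [Matrix.mulVec_diagonal]
  fin_cases i <;> simp

theorem energy_principal (hI : I.PosDef)
    (hJ : rotX (-P) * I * rotX P = Matrix.diagonal ![Jx, Jy, Jz]) (w : Vec) :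
    energy I (Matrix.mulVec (rotX P) w)
      = (Jx⁻¹ * w 0 ^ 2 + Jy⁻¹ * w 1 ^ 2 + Jz⁻¹ * w 2 ^ 2) / 2 := by
  rw [energy, inv_mulVec_principal hI hJ, mulVec_dotProduct_mulVec (rotX_mem P)]
  simp [dotProduct, Fin.sum_univ_three]
  ring

theorem IsRigidMotion.principal {ℓ : Vec} {R : ℝ → Mat} (hI : I.PosDef)
    (hJ : rotX (-P) * I * rotX P = Matrix.diagonal ![Jx, Jy, Jz]) (h : IsRigidMotion I ℓ R) :
    IsRigidMotion (Matrix.diagonal ![Jx, Jy, Jz]) ℓ fun t => R t * rotX P := by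
  obtain ⟨hx, hy, hz⟩ := inertia_pos_of_principal hI hJ
  intro t
  refine ⟨mul_mem (h t).1 (rotX_mem P), ?_⟩
  have h1 : HasMatDerivWithinAt R _ univ t := (h t).2
  have h2 := h1.mul_const (rotX P)
  have h3 : bodyMomentum ℓ (R t) = Matrix.mulVec (rotX P) (bodyMomentum ℓ (R t * rotX P)) := by
    rw [bodyMomentum, bodyMomentum, Matrix.transpose_mul, Matrix.mulVec_mulVec, ← mul_assoc,
      mul_transpose_self_of_mem (rotX_mem P), one_mul]
  rw [h3, inv_mulVec_principal hI hJ, mul_assoc, ← mul_hat (rotX_mem P), ← mul_assoc,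
    ← inv_diagonal_mulVec hx.ne' hy.ne' hz.ne'] at h2
  exact h2

end PrincipalFrame

/-! ### The orbit of the twisting stage, its precession and its period. -/

/-- The orbit through `l (0, c, -s)` in the principal frame. -/
def orbitPoint (l k s c ψ : ℝ) : Vec :=
  ![-(k * l * c * Real.sin ψ), l * c * Real.cos ψ, -(l * axial k s c ψ)]

section Precession

variable {J : Mat} {ℓ : Vec} {S : ℝ → Mat} {A B C k s c : ℝ}

theorem IsRigidMotion.exists_angle (h : IsRigidMotion J ℓ S) (hℓ : ℓ ≠ 0)
    (hJ : ∀ w, Matrix.mulVec J⁻¹ w = ![A * w 0, B * w 1, C * w 2]) (hBC : B < C) (hAB : A ≤ B)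
    (hs : 0 < s) (hk : 0 < k) (hkp : k ^ 2 * (C - A) = C - B)
    (h0 : bodyMomentum ℓ (S 0) = ![0, len ℓ * c, -(len ℓ * s)]) :
    ∃ ψ : ℝ → ℝ, ψ 0 = 0 ∧
      (∀ t, HasDerivAt ψ ((C - B) / k * len ℓ * axial k s c (ψ t)) t) ∧
      ∀ t, bodyMomentum ℓ (S t) = orbitPoint (len ℓ) k s c (ψ t) := by
  have hd := fun t => h.hasDerivAt_bodyMomentum t
  simp only [hJ] at hd
  have hx := fun t => hd t 0
  have hy := fun t => hd t 1
  have hz := fun t => hd t 2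
  simp only [cross_apply, Matrix.cons_val] at hx hy hz
  obtain ⟨ψ, h1, h2, h3⟩ := exists_angle_of_euler (p := C - B) (q := B - A) (l := len ℓ) (s := s)
    (c := c) (k := k) (sub_pos.2 hBC) (sub_nonneg.2 hAB) (len_pos hℓ) hs hk (by linarith)
    (fun t => (hx t).congr_deriv (by ring)) (fun t => (hy t).congr_deriv (by ring))
    (fun t => (hz t).congr_deriv (by ring)) (by simp [h0]) (by simp [h0]) (by simp [h0])
  refine ⟨ψ, h1, h2, fun t => ?_⟩
  obtain ⟨e0, e1, e2⟩ := h3 t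
  ext i
  fin_cases i
  · simpa [orbitPoint] using e0
  · simpa [orbitPoint] using e1
  · simpa [orbitPoint] using e2

/-- The split into dynamic and geometric phase: 2E/l exceeds the precession rate by (C-B) l `axial`²
/ (cos²ψ + k² sin²ψ), which is `geometricRate` at ψ times ψ'. By the chain rule this excess is the
derivative of the integral up to ψ. -/
theorem IsRigidMotion.turnsBy_precession (h : IsRigidMotion J ℓ S) (hℓ : ℓ ≠ 0)
    (hJ : ∀ w, Matrix.mulVec J⁻¹ w = ![A * w 0, B * w 1, C * w 2]) (hc : c ≠ 0)
    (hsc : s ^ 2 + c ^ 2 = 1) (hs : 0 < s) (hk : 0 < k) (hk1 : k ^ 2 ≤ 1)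
    (hkp : k ^ 2 * (C - A) = C - B)
    {ψ : ℝ → ℝ} (hψ0 : ψ 0 = 0)
    (hψ : ∀ t, HasDerivAt ψ ((C - B) / k * len ℓ * axial k s c (ψ t)) t)
    (hL : ∀ t, bodyMomentum ℓ (S t) = orbitPoint (len ℓ) k s c (ψ t)) (τ : ℝ) :
    TurnsBy ℓ (fun t => Matrix.mulVec (S t) ![0, 0, 1]) 0 τ
      (τ * (2 * (len ℓ ^ 2 / 2 * (B * c ^ 2 + C * s ^ 2)) / len ℓ)
        - ∫ x in (0 : ℝ)..ψ τ, geometricRate k s c x) := by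
  have hl := len_pos hℓ
  have hN := fun t => cos_sq_add_mul_sin_sq_pos (pow_pos hk 2) (ψ t)
  have hxy : ∀ t, bodyMomentum ℓ (S t) 0 ^ 2 + bodyMomentum ℓ (S t) 1 ^ 2
      = len ℓ ^ 2 * c ^ 2 * (Real.cos (ψ t) ^ 2 + k ^ 2 * Real.sin (ψ t) ^ 2) := by
    intro t
    rw [hL, orbitPoint]
    simp
    ring
  refine h.turnsBy_third_axis hℓ hJ (fun t => ?_) (φ := fun t =>
    t * (2 * (len ℓ ^ 2 / 2 * (B * c ^ 2 + C * s ^ 2)) / len ℓ)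
      - ∫ x in (0 : ℝ)..ψ t, geometricRate k s c x) (by simp [hψ0]) (fun t => ?_) τ
  · rw [hxy]
    have := hN t
    positivity
  · have h1 := ((continuous_geometricRate (s := s) (c := c) hk).integral_hasStrictDerivAt 0
      (ψ t)).hasDerivAt.comp t (hψ t)
    refine (((hasDerivAt_id t).mul_const _).sub h1).congr_deriv ?_
    rw [hxy, hL, geometricRate, orbitPoint]
    have hN0 := (hN t).ne'
    have hz2 := axial_sq (c := c) hs hk1 (ψ t)
    have e1 : k * axial k s c (ψ t) / (Real.cos (ψ t) ^ 2 + k ^ 2 * Real.sin (ψ t) ^ 2)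
        * ((C - B) / k * len ℓ * axial k s c (ψ t))
        = (C - B) * len ℓ * axial k s c (ψ t) ^ 2
          / (Real.cos (ψ t) ^ 2 + k ^ 2 * Real.sin (ψ t) ^ 2) := by
      field_simp
    rw [e1, hz2]
    simp
    field_simp
    have e2 : Real.cos (ψ t) ^ 2 = 1 - Real.sin (ψ t) ^ 2 := by
      linarith [Real.sin_sq_add_cos_sq (ψ t)]
    have e3 : c ^ 2 = 1 - s ^ 2 := by linarith
    rw [e2, e3]
    linear_combination Real.sin (ψ t) ^ 2 * hkp

end Precession

theorem bodyMomentum_mul (ℓ : Vec) (R Q : Mat) :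
    bodyMomentum ℓ (R * Q) = Matrix.mulVec Q.transpose (bodyMomentum ℓ R) := by
  rw [bodyMomentum, bodyMomentum, Matrix.transpose_mul, Matrix.mulVec_mulVec]

theorem rotX_mulVec_somersault (θ l : ℝ) :
    Matrix.mulVec (rotX θ).transpose ![0, l, 0] = ![0, l * Real.cos θ, -(l * Real.sin θ)] := by
  ext i
  fin_cases i <;> simp [rotX, Matrix.mulVec, dotProduct, Fin.sum_univ_three] <;> ring

section Orbit

variable {I : Mat} {P Jx Jy Jz l k s c : ℝ}

/-- Serves both conserved quantities: the inverse moments give the energy, and A = B = C = 1, for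
which the condition on k is trivial, gives the length. -/
theorem orbitPoint_quadratic {A B C : ℝ} (hs : 0 < s) (hk1 : k ^ 2 ≤ 1)
    (hkp : k ^ 2 * (C - A) = C - B) (ψ : ℝ) :
    A * orbitPoint l k s c ψ 0 ^ 2 + B * orbitPoint l k s c ψ 1 ^ 2
      + C * orbitPoint l k s c ψ 2 ^ 2 = l ^ 2 * (B * c ^ 2 + C * s ^ 2) := by
  simp only [orbitPoint, Matrix.cons_val, neg_sq, mul_pow, axial_sq hs hk1]
  linear_combination l ^ 2 * c ^ 2 * B * Real.sin_sq_add_cos_sq ψ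
    - l ^ 2 * c ^ 2 * Real.sin ψ ^ 2 * hkp

theorem energy_orbitPoint (hI : I.PosDef)
    (hJ : rotX (-P) * I * rotX P = Matrix.diagonal ![Jx, Jy, Jz]) (hs : 0 < s)
    (hk1 : k ^ 2 ≤ 1) (hkp : k ^ 2 * (Jz⁻¹ - Jx⁻¹) = Jz⁻¹ - Jy⁻¹) (ψ : ℝ) :
    energy I (Matrix.mulVec (rotX P) (orbitPoint l k s c ψ))
      = l ^ 2 / 2 * (Jy⁻¹ * c ^ 2 + Jz⁻¹ * s ^ 2) := by
  rw [energy_principal hI hJ, orbitPoint_quadratic hs hk1 hkp]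
  ring

theorem twistAxis_dotProduct_mulVec (w : Vec) :
    twistAxis P ⬝ᵥ Matrix.mulVec (rotX P) w = w 2 := by
  rw [twistAxis, mulVec_dotProduct_mulVec (rotX_mem P)]
  simp [dotProduct, Fin.sum_univ_three]

/-- Eliminating the third coordinate from length and energy leaves the ellipse x² + k² y² = k² l²
c², which ψ parametrises; the side of the equator fixes the sign of that coordinate. -/
theorem range_eq_orbit (hI : I.PosDef)
    (hJ : rotX (-P) * I * rotX P = Matrix.diagonal ![Jx, Jy, Jz]) (hl : 0 < l) (hs : 0 < s)
    (hc : c ≠ 0) (hsc : s ^ 2 + c ^ 2 = 1) (hk : 0 < k) (hk1 : k ^ 2 ≤ 1)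
    (hp : 0 < Jz⁻¹ - Jy⁻¹) (hkp : k ^ 2 * (Jz⁻¹ - Jx⁻¹) = Jz⁻¹ - Jy⁻¹)
    {L : ℝ → Vec} {ψ : ℝ → ℝ} (hψ : Function.Surjective ψ)
    (hL : ∀ t, L t = Matrix.mulVec (rotX P) (orbitPoint l k s c (ψ t))) :
    range L = orbit I (twistAxis P) l (l ^ 2 / 2 * (Jy⁻¹ * c ^ 2 + Jz⁻¹ * s ^ 2)) := by
  have hdot : ∀ w : Vec, w ⬝ᵥ w = w 0 ^ 2 + w 1 ^ 2 + w 2 ^ 2 := fun w => by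
    simp [dotProduct, Fin.sum_univ_three, sq]
  ext v
  constructor
  · rintro ⟨t, rfl⟩
    rw [hL]
    refine ⟨?_, ?_, energy_orbitPoint hI hJ hs hk1 hkp _⟩
    · rw [mulVec_dotProduct_mulVec (rotX_mem P), hdot]
      have := orbitPoint_quadratic (l := l) (c := c) (A := 1) (B := 1) (C := 1) hs hk1 (by ring)
        (ψ t)
      linear_combination this + l ^ 2 * hsc
    · rw [twistAxis_dotProduct_mulVec]
      have := mul_pos hl (axial_pos (c := c) hs hk1 (ψ t))
      simpa [orbitPoint] using this
  · rintro ⟨h1, h2, h3⟩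
    obtain ⟨w, rfl⟩ : ∃ w, Matrix.mulVec (rotX P) w = v :=
      ⟨Matrix.mulVec (rotX P).transpose v, by
        rw [Matrix.mulVec_mulVec, mul_transpose_self_of_mem (rotX_mem P), Matrix.one_mulVec]⟩
    rw [mulVec_dotProduct_mulVec (rotX_mem P), hdot] at h1
    rw [twistAxis_dotProduct_mulVec] at h2
    rw [energy_principal hI hJ] at h3
    have h4 : (w 1 / (l * c)) ^ 2 + (-(w 0 / (k * l * c))) ^ 2 = 1 := by
      have h5 : k ^ 2 * w 1 ^ 2 + w 0 ^ 2 = k ^ 2 * l ^ 2 * c ^ 2 := by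
        refine mul_left_cancel₀ hp.ne' ?_
        linear_combination k ^ 2 * Jz⁻¹ * h1 - 2 * k ^ 2 * h3 - w 0 ^ 2 * hkp
          - k ^ 2 * l ^ 2 * Jz⁻¹ * hsc
      field_simp
      linear_combination h5
    obtain ⟨θ, hcos, hsin⟩ := exists_angle_of_sq_add_sq h4
    obtain ⟨t, rfl⟩ := hψ θ
    refine ⟨t, ?_⟩
    rw [hL]
    congr 1
    have e0 : orbitPoint l k s c (ψ t) 0 = w 0 := by
      simp only [orbitPoint, Matrix.cons_val, hsin]
      field_simp
    have e1 : orbitPoint l k s c (ψ t) 1 = w 1 := by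
      simp only [orbitPoint, Matrix.cons_val, hcos]
      field_simp
    have e2 : orbitPoint l k s c (ψ t) 2 = w 2 := by
      have h6 := orbitPoint_quadratic (l := l) (c := c) (A := 1) (B := 1) (C := 1) hs hk1 (by ring)
        (ψ t)
      rw [e0, e1] at h6
      have h7 : orbitPoint l k s c (ψ t) 2 ^ 2 = w 2 ^ 2 := by
        linear_combination h6 - h1 + l ^ 2 * hsc
      have h8 : orbitPoint l k s c (ψ t) 2 < 0 := by
        have := mul_pos hl (axial_pos (c := c) hs hk1 (ψ t))
        simpa [orbitPoint] using this
      rcases sq_eq_sq_iff_eq_or_eq_neg.1 h7 with h | h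
      · exact h
      · linarith
    ext i
    fin_cases i
    · exact e0
    · exact e1
    · exact e2

theorem periodic_orbitPoint : Function.Periodic (orbitPoint l k s c) (2 * Real.pi) := fun ψ => by
  simp [orbitPoint, periodic_axial ψ]

theorem isLeast_period (hl : 0 < l) (hc : c ≠ 0) {f ψ : ℝ → ℝ} (hf : Continuous f)
    (hpos : ∀ x, 0 < f x) (hp : Function.Periodic f (2 * Real.pi)) (h0 : ψ 0 = 0)
    (hψ : ∀ t, HasDerivAt ψ (f (ψ t)) t) {L : ℝ → Vec}
    (hL : ∀ t, L t = Matrix.mulVec (rotX P) (orbitPoint l k s c (ψ t))) :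
    IsLeast {τ : ℝ | 0 < τ ∧ Function.Periodic L τ}
      (∫ x in (0 : ℝ)..2 * Real.pi, (f x)⁻¹) := by
  have hpi := Real.pi_pos
  have hG := strictMono_integral_inv hf hpos
  have hmono := strictMono_flow hpos hψ
  refine ⟨⟨?_, fun t => ?_⟩, ?_⟩
  · have := hG (show (0 : ℝ) < 2 * Real.pi by positivity)
    simpa using this
  · rw [hL, hL, flow_add_period hf hpos hp h0 hψ, periodic_orbitPoint]
  · rintro τ ⟨hτ, hper⟩
    have h1 := hper 0
    rw [zero_add, hL, hL] at h1
    have h2 := congrArg (Matrix.mulVec (rotX P).transpose) h1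
    rw [Matrix.mulVec_mulVec, Matrix.mulVec_mulVec, transpose_mul_self_of_mem (rotX_mem P),
      Matrix.one_mulVec, Matrix.one_mulVec] at h2
    have h3 := congrFun h2 1
    -- The second coordinate l c cos ψ takes its maximal modulus at time 0, so a period forces ψ(τ)
    -- to be a positive multiple of 2π.
    simp only [orbitPoint, Matrix.cons_val, h0, Real.cos_zero] at h3
    have h4 : Real.cos (ψ τ) = 1 := mul_left_cancel₀ (mul_ne_zero hl.ne' hc) h3
    obtain ⟨n, hn⟩ := (Real.cos_eq_one_iff _).1 h4
    have h5 : 0 < ψ τ := by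
      have := hmono hτ
      rwa [h0] at this
    have h6 : (1 : ℝ) ≤ n := by
      rw [← hn] at h5
      have : (0 : ℝ) < n := pos_of_mul_pos_left h5 (by positivity)
      exact_mod_cast this
    have h7 : ψ (∫ x in (0 : ℝ)..2 * Real.pi, (f x)⁻¹) ≤ ψ τ := by
      rw [flow_integral_inv hf hpos h0 hψ, ← hn]
      nlinarith
    exact hmono.le_iff_le.1 h7

end Orbit

/-! ### The dimensionless parameters. -/

section Parameters

variable {Jx Jy Jz : ℝ}

/-- With ρ² = (B-A)/(C-B), the relations k²(1 + ρ²) = 1 and k²(C-A) = C-B agree. The symmetric case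
is ρ = 0, k = 1. -/
theorem paramRho_sq (hz : 0 < Jz) (hzy : Jz < Jy) (hyx : Jy ≤ Jx) :
    paramRho Jx Jy Jz ^ 2 * (Jz⁻¹ - Jy⁻¹) = Jy⁻¹ - Jx⁻¹ := by
  have hy : 0 < Jy := hz.trans hzy
  have hx : 0 < Jx := hy.trans_le hyx
  have h1 : 0 ≤ 1 - Jy / Jx := by
    rw [sub_nonneg, div_le_one hx]
    exact hyx
  have h2 : 0 < Jy / Jz - 1 := by
    rw [sub_pos, one_lt_div hz]
    exact hzy
  rw [paramRho, Real.sq_sqrt (div_nonneg h1 h2.le), div_mul_eq_mul_div, div_eq_iff h2.ne']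
  field_simp

theorem paramMu_eq (hz : 0 < Jz) (hzy : Jz < Jy) (hyx : Jy ≤ Jx) :
    paramMu Jx Jy Jz = 2 * (Jy * (Jz⁻¹ - Jy⁻¹)) * paramRho Jx Jy Jz := by
  have hy : 0 < Jy := hz.trans hzy
  have hp : 0 < Jz⁻¹ - Jy⁻¹ := sub_pos.2 (inv_strictAnti₀ hz hzy)
  have hρ := paramRho_sq hz hzy hyx
  have h0 : 0 ≤ paramRho Jx Jy Jz := Real.sqrt_nonneg _
  rw [paramMu, mul_assoc]
  congr 1
  have hx : 0 < Jx := hy.trans_le hyx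
  have h1 : (1 - Jy / Jx) * (Jy / Jz - 1) = (Jy * (Jz⁻¹ - Jy⁻¹) * paramRho Jx Jy Jz) ^ 2 := by
    have e1 : 1 - Jy / Jx = Jy * (Jy⁻¹ - Jx⁻¹) := by field_simp
    have e2 : Jy / Jz - 1 = Jy * (Jz⁻¹ - Jy⁻¹) := by field_simp
    rw [e1, e2]
    linear_combination -(Jy ^ 2 * (Jz⁻¹ - Jy⁻¹)) * hρ
  rw [h1, Real.sqrt_sq (by positivity)]

theorem paramRho_pos (hz : 0 < Jz) (hzy : Jz < Jy) (hyx : Jy < Jx) :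
    0 < paramRho Jx Jy Jz := by
  have hy : 0 < Jy := hz.trans hzy
  refine Real.sqrt_pos.2 (div_pos ?_ ?_)
  · rw [sub_pos, div_lt_one (hy.trans hyx)]
    exact hyx
  · rw [sub_pos, one_lt_div hz]
    exact hzy

theorem paramH_eq {l s c : ℝ} (hl : 0 < l) (hz : 0 < Jz) (hzy : Jz < Jy) (hyx : Jy < Jx)
    (hsc : s ^ 2 + c ^ 2 = 1) :
    paramH Jx Jy Jz l (l ^ 2 / 2 * (Jy⁻¹ * c ^ 2 + Jz⁻¹ * s ^ 2))
      = s ^ 2 / (2 * paramRho Jx Jy Jz) := by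
  have hy : 0 < Jy := hz.trans hzy
  have hp : 0 < Jz⁻¹ - Jy⁻¹ := sub_pos.2 (inv_strictAnti₀ hz hzy)
  have h1 : 2 * (l ^ 2 / 2 * (Jy⁻¹ * c ^ 2 + Jz⁻¹ * s ^ 2)) * Jy / l ^ 2 - 1
      = Jy * (Jz⁻¹ - Jy⁻¹) * s ^ 2 := by
    have e : c ^ 2 = 1 - s ^ 2 := by linarith
    rw [e]
    field_simp
    ring
  have hρ := paramRho_pos hz hzy hyx
  rw [paramH, h1, paramMu_eq hz hzy hyx.le]
  generalize Jz⁻¹ - Jy⁻¹ = p at *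
  field_simp

theorem period_eq {l k s c : ℝ} (hl : 0 < l) (hz : 0 < Jz) (hzy : Jz < Jy) (hyx : Jy < Jx)
    (hs : 0 < s) (hsc : s ^ 2 + c ^ 2 = 1) (hk : 0 < k) (hk1 : k ^ 2 ≤ 1)
    (hkρ : k ^ 2 * (1 + paramRho Jx Jy Jz ^ 2) = 1) :
    ∫ x in (0 : ℝ)..2 * Real.pi, ((Jz⁻¹ - Jy⁻¹) / k * l * axial k s c x)⁻¹
      = 8 * Jy * paramG (s ^ 2 / (2 * paramRho Jx Jy Jz)) (paramRho Jx Jy Jz)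
        / (paramMu Jx Jy Jz * l)
        * ellipticK (paramM (s ^ 2 / (2 * paramRho Jx Jy Jz)) (paramRho Jx Jy Jz)) := by
  have hy : 0 < Jy := hz.trans hzy
  have hp : 0 < Jz⁻¹ - Jy⁻¹ := sub_pos.2 (inv_strictAnti₀ hz hzy)
  have hρ := paramRho_pos hz hzy hyx
  rw [paramMu_eq hz hzy hyx.le]
  generalize paramRho Jx Jy Jz = ρ at *
  generalize Jz⁻¹ - Jy⁻¹ = p at *
  simp_rw [mul_inv]
  rw [intervalIntegral.integral_const_mul, integral_inv_axial hs hk1, paramM_eq hρ hk hkρ hsc,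
    sqrt_eq_paramG hρ hk hkρ hsc]
  have hG : 0 < paramG (s ^ 2 / (2 * ρ)) ρ := one_div_pos.2 (Real.sqrt_pos.2 (by positivity))
  field_simp
  ring

end Parameters

/-! ### Assembling the five stages. -/

/-- The turning angle is unique and equals `scaledAngle k (ψ τ₃)`. It is non-negative, so the
absolute value is harmless, and the scaling is injective and fixes 2πn. -/
theorem performsTwists_iff {M : KickModel} {ℓ : Vec} (D : Dive M ℓ) {P l k s c : ℝ} (hl : 0 < l)
    (hc : c ≠ 0) (hk : 0 < k) {f ψ : ℝ → ℝ} (hf : Continuous f)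
    (hpos : ∀ x, 0 < f x) (hp : Function.Periodic f (2 * Real.pi)) (h0 : ψ 0 = 0)
    (hψ : ∀ t, HasDerivAt ψ (f (ψ t)) t)
    (hL : ∀ t, D.L₃ t = Matrix.mulVec (rotX P) (orbitPoint l k s c (ψ t))) (n : ℕ) :
    D.PerformsTwists P n ↔ D.τ₃ = n * ∫ x in (0 : ℝ)..2 * Real.pi, (f x)⁻¹ := by
  have hψc : Continuous ψ := continuous_iff_continuousAt.2 fun t => (hψ t).continuousAt
  have hturn : TurnsBy (twistAxis P) D.L₃ 0 D.τ₃ (scaledAngle k (ψ D.τ₃)) := by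
    have h := (turnsBy_scaledAngle (v := fun t => orbitPoint l k s c (ψ t))
      (mul_ne_zero hl.ne' hc) hk hψc h0 (fun t => by simp [orbitPoint])
      (fun t => by simp [orbitPoint]) D.τ₃).mulVec (rotX_mem P)
    simp only [← hL] at h
    exact h
  have hne : twistAxis P ≠ 0 := fun h => by
    have := twistAxis_dotProduct_mulVec (P := P) ![0, 0, 1]
    rw [h] at this
    simp at this
  have hmono := strictMono_scaledAngle hk
  have hnonneg : 0 ≤ scaledAngle k (ψ D.τ₃) := by
    have h1 := (strictMono_flow hpos hψ).monotone D.τ₃_nonneg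
    have h2 := hmono.monotone h1
    rwa [h0, scaledAngle_of_sin_eq_zero Real.sin_zero] at h2
  have hn : scaledAngle k (2 * Real.pi * n) = 2 * Real.pi * n := by
    apply scaledAngle_of_sin_eq_zero
    rw [← Real.sin_nat_mul_pi (2 * n)]
    congr 1
    push_cast
    ring
  rw [← flow_eq_two_pi_mul_iff hf hpos hp h0 hψ]
  constructor
  · rintro ⟨δ, hδ, h⟩
    rw [h.unique hne hturn, abs_of_nonneg hnonneg] at hδ
    exact hmono.injective (hδ.trans hn.symm)
  · intro h
    refine ⟨_, ?_, hturn⟩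
    rw [abs_of_nonneg hnonneg, h, hn]

theorem isTotalRotation_iff {M : KickModel} {ℓ : Vec} (hℓ : ℓ ≠ 0) (D : Dive M ℓ)
    {P δ₁ δ₂ δ₃ δ₄ δ₅ : ℝ}
    (h₁ : TurnsBy ℓ (fun t => Matrix.mulVec (D.R₁ t) ![1, 0, 0]) 0 D.τ₁ δ₁)
    (h₂ : TurnsBy ℓ (fun α => Matrix.mulVec (D.R₂ α) ![1, 0, 0]) Real.pi 0 δ₂)
    (h₃ : TurnsBy ℓ (fun t => Matrix.mulVec (D.R₃ t) (twistAxis P)) 0 D.τ₃ δ₃)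
    (h₄ : TurnsBy ℓ (fun α => Matrix.mulVec (D.R₄ α) ![1, 0, 0]) 0 Real.pi δ₄)
    (h₅ : TurnsBy ℓ (fun t => Matrix.mulVec (D.R₅ t) ![1, 0, 0]) 0 D.τ₅ δ₅) (Δ : ℝ) :
    D.IsTotalRotation P Δ ↔ Δ = δ₁ + δ₂ + δ₃ + δ₄ + δ₅ := by
  constructor
  · rintro ⟨d₁, d₂, d₃, d₄, d₅, rfl, g₁, g₂, g₃, g₄, g₅⟩
    rw [g₁.unique hℓ h₁, g₂.unique hℓ h₂, g₃.unique hℓ h₃, g₄.unique hℓ h₄, g₅.unique hℓ h₅]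
  · rintro rfl
    exact ⟨_, _, _, _, _, rfl, h₁, h₂, h₃, h₄, h₅⟩

/-- The body x-axis is fixed in space during a kick; orthogonality to ℓ at one arm angle therefore
makes its azimuth defined, and constant, throughout. -/
theorem KickModel.IsKick.turnsBy_zero {M : KickModel} {ℓ : Vec} (hℓ : ℓ ≠ 0) {R : ℝ → Mat}
    (h : M.IsKick R) {β : ℝ} (hβ : β ∈ Icc 0 Real.pi) (h0 : bodyMomentum ℓ (R β) 0 = 0)
    {a b : ℝ} (hab : uIcc a b ⊆ Icc 0 Real.pi) :
    TurnsBy ℓ (fun α => Matrix.mulVec (R α) ![1, 0, 0]) a b 0 := by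
  refine turnsBy_of_eqOn_const (w := Matrix.mulVec (R β) ![1, 0, 0]) ?_ fun α hα => ?_
  · apply perp_ne_zero (h β hβ).1
    have h1 : bodyMomentum ℓ (R β) ⬝ᵥ ![1, 0, 0] = 0 := by
      simp [dotProduct, Fin.sum_univ_three, h0]
    rw [h1]
    have := dotProduct_self_pos hℓ
    simpa [dotProduct, Fin.sum_univ_three] using this
  · rw [h.mulVec_unit (hab hα), h.mulVec_unit hβ]

/-- If the body momentum returns to its initial value while a body-fixed axis turns by `δ` about
the angular momentum, then the attitude turns by `δ`. -/
theorem eq_rotAbout_mul_of_turnsBy {ℓ v : Vec} (hℓ : ℓ ≠ 0) {R : ℝ → Mat} {τ δ : ℝ}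
    (h0 : R 0 ∈ Matrix.specialOrthogonalGroup (Fin 3) ℝ)
    (hτ : R τ ∈ Matrix.specialOrthogonalGroup (Fin 3) ℝ)
    (hL : bodyMomentum ℓ (R τ) = bodyMomentum ℓ (R 0))
    (hturn : TurnsBy ℓ (fun t => Matrix.mulVec (R t) v) 0 τ δ) :
    R τ = rotAbout ℓ δ * R 0 := by
  obtain ⟨hw, φ, c, -, -, hφ, H⟩ := hturn
  obtain ⟨hc, hperp⟩ := H τ right_mem_uIcc
  have hB := mul_mem hτ (transpose_mem h0)
  have hBℓ : Matrix.mulVec (R τ * (R 0).transpose) ℓ = ℓ := by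
    rw [← Matrix.mulVec_mulVec]
    change Matrix.mulVec (R τ) (bodyMomentum ℓ (R 0)) = ℓ
    rw [← hL, mulVec_bodyMomentum hτ]
  have hBw : Matrix.mulVec (R τ * (R 0).transpose) (perp ℓ (Matrix.mulVec (R 0) v))
      = perp ℓ (Matrix.mulVec (R τ) v) := by
    rw [← perp_mulVec hB, hBℓ, Matrix.mulVec_mulVec, mul_assoc, transpose_mul_self_of_mem h0,
      mul_one]
  have hdot := dir_dotProduct_perp hℓ (Matrix.mulVec (R 0) v)
  -- The relative attitude fixes ℓ, so it carries the initial orthogonal part to the final one;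
  -- being an isometry, it leaves no room for stretching.
  have hc1 : c τ = 1 := by
    have h1 := mulVec_dotProduct_mulVec hB (perp ℓ (Matrix.mulVec (R 0) v))
      (perp ℓ (Matrix.mulVec (R 0) v))
    have hcc : crossProduct (dir ℓ) (perp ℓ (Matrix.mulVec (R 0) v))
        ⬝ᵥ crossProduct (dir ℓ) (perp ℓ (Matrix.mulVec (R 0) v))
        = perp ℓ (Matrix.mulVec (R 0) v) ⬝ᵥ perp ℓ (Matrix.mulVec (R 0) v) := by
      rw [cross_dot_cross, dir_dotProduct_self hℓ, hdot]
      ring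
    have hx : crossProduct (dir ℓ) (perp ℓ (Matrix.mulVec (R 0) v))
        ⬝ᵥ perp ℓ (Matrix.mulVec (R 0) v) = 0 := by rw [dotProduct_comm, dot_cross_self]
    rw [hBw, hperp, rotAbout_mulVec_of_orthogonal ℓ _ hdot] at h1
    simp only [smul_dotProduct, dotProduct_smul, add_dotProduct, dotProduct_add, hcc, hx,
      dot_cross_self, smul_eq_mul, mul_zero, add_zero, zero_add] at h1
    have h2 : c τ ^ 2 = 1 := by
      refine mul_right_cancel₀ (dotProduct_self_pos hw).ne' ?_
      have := Real.sin_sq_add_cos_sq (φ τ)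
      linear_combination h1 - c τ ^ 2 * (perp ℓ (Matrix.mulVec (R 0) v)
        ⬝ᵥ perp ℓ (Matrix.mulVec (R 0) v)) * this
    exact (pow_eq_one_iff_of_nonneg hc.le two_ne_zero).1 h2
  rw [hc1, one_smul, hφ] at hperp
  have := eq_rotAbout hB hℓ hBℓ hdot hw (hBw.trans hperp)
  rw [← this, mul_assoc, transpose_mul_self_of_mem h0, mul_one]

theorem axial_one {s : ℝ} (hs : 0 < s) (c ψ : ℝ) : axial 1 s c ψ = s := by
  simp [axial, Real.sqrt_sq hs.le]

theorem geometricRate_one {s : ℝ} (hs : 0 < s) (c ψ : ℝ) : geometricRate 1 s c ψ = s := by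
  simp [geometricRate, axial_one hs]

end TwistingSomersault

end

theorem mainTheorem3 (M : TwistingSomersault.KickModel) (P Jx Jy Jz : ℝ)
    (hJ : TwistingSomersault.rotX (-P) * M.It * TwistingSomersault.rotX P
      = Matrix.diagonal ![Jx, Jy, Jz])
    (hzy : Jz < Jy) (hyx : Jy ≤ Jx)
    (hsin : 0 < Real.sin (M.tilt + P)) (hcos : Real.cos (M.tilt + P) ≠ 0)
    (ℓ : TwistingSomersault.Vec) (hℓ : ℓ ≠ 0) (D : TwistingSomersault.Dive M ℓ)
    (l S h ρ : ℝ) (hl : l = TwistingSomersault.len ℓ)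
    (hS : S = TwistingSomersault.solidAngle M.It (TwistingSomersault.twistAxis P) l D.Et)
    (hh : h = TwistingSomersault.paramH Jx Jy Jz l D.Et)
    (hρ : ρ = TwistingSomersault.paramRho Jx Jy Jz) :
    -- the orbit of stage 3, and the solid angle between it and the equator
    Set.range D.L₃
      = TwistingSomersault.orbit M.It (TwistingSomersault.twistAxis P) l D.Et ∧
    (Jx = Jy → S = 2 * Real.pi * Real.sin (M.tilt + P)) ∧
    (Jy < Jx → S = 2 * Real.pi - TwistingSomersault.capAngle h ρ) ∧
    -- its period, and the time needed for `n` twists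
    (∃ T : ℝ, IsLeast {s : ℝ | 0 < s ∧ Function.Periodic D.L₃ s} T ∧
      (Jx = Jy → T = 2 * Real.pi / l * (Jz⁻¹ - Jy⁻¹)⁻¹ / Real.sin (M.tilt + P)) ∧
      (Jy < Jx → T = 8 * Jy * TwistingSomersault.paramG h ρ
        / (TwistingSomersault.paramMu Jx Jy Jz * l)
        * TwistingSomersault.ellipticK (TwistingSomersault.paramM h ρ)) ∧
      ∀ n : ℕ, D.PerformsTwists P n ↔ D.τ₃ = n * T) ∧
    -- the total rotation about `ℓ` when `n` twists are performed
    (∀ n : ℕ, D.PerformsTwists P n →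
      (∀ t, TwistingSomersault.energy M.Is (D.L₁ t) = D.Es) ∧
      (∀ t, TwistingSomersault.energy M.It (D.L₃ t) = D.Et) ∧
      (∀ t, TwistingSomersault.energy M.Is (D.L₅ t) = D.Es) ∧
      ∀ Δ : ℝ, D.IsTotalRotation P Δ ↔
        Δ = (D.τ₁ + D.τ₅) * (2 * D.Es / l) + D.τ₃ * (2 * D.Et / l) - n * S) ∧
    -- this angle is realised by the attitude: start and end differ by the rotation about `ℓ`
    (∀ n : ℕ, D.PerformsTwists P n → ∀ Δ : ℝ, D.IsTotalRotation P Δ →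
      D.R₅ D.τ₅ = TwistingSomersault.rotAbout ℓ Δ * D.R₁ 0) := by
  open TwistingSomersault in
  have hpi := Real.pi_pos
  have m0 : (0 : ℝ) ∈ Set.Icc 0 Real.pi := ⟨le_rfl, hpi.le⟩
  have mpi : Real.pi ∈ Set.Icc 0 Real.pi := ⟨hpi.le, le_rfl⟩
  have hI : M.It.PosDef := M.posDef 0 m0
  obtain ⟨hx, hy, hz⟩ := inertia_pos_of_principal hI hJ
  have hlpos : 0 < l := hl ▸ len_pos hℓ
  have hsc := Real.sin_sq_add_cos_sq (M.tilt + P)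
  set s := Real.sin (M.tilt + P) with hsdef
  set c := Real.cos (M.tilt + P) with hcdef
  have hBC : Jy⁻¹ < Jz⁻¹ := inv_strictAnti₀ hz hzy
  have hAB : Jx⁻¹ ≤ Jy⁻¹ := inv_anti₀ hy hyx
  have hp : 0 < Jz⁻¹ - Jy⁻¹ := sub_pos.2 hBC
  have hρ2 := paramRho_sq hz hzy hyx
  rw [← hρ] at hρ2
  -- The axis ratio of the orbit's projection along the twist axis; it lets the symmetric and the
  -- asymmetric case share one argument.
  obtain ⟨k, hk, hkρ⟩ : ∃ k : ℝ, 0 < k ∧ k ^ 2 * (1 + ρ ^ 2) = 1 := by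
    have h1 : 0 < 1 + ρ ^ 2 := by positivity
    refine ⟨(Real.sqrt (1 + ρ ^ 2))⁻¹, inv_pos.2 (Real.sqrt_pos.2 h1), ?_⟩
    rw [inv_pow, Real.sq_sqrt h1.le, inv_mul_cancel₀ h1.ne']
  have hk1 : k ^ 2 ≤ 1 := by nlinarith [mul_nonneg (sq_nonneg k) (sq_nonneg ρ)]
  have hkp : k ^ 2 * (Jz⁻¹ - Jx⁻¹) = Jz⁻¹ - Jy⁻¹ := by
    linear_combination (Jz⁻¹ - Jy⁻¹) * hkρ - k ^ 2 * hρ2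
  have hkone : Jx = Jy → k = 1 := by
    rintro rfl
    exact (pow_eq_one_iff_of_nonneg hk.le two_ne_zero).1
      (mul_right_cancel₀ hp.ne' (hkp.trans (one_mul _).symm))
  -- stages 1 and 2
  obtain ⟨hL1, hR1, hT1⟩ := M.somersault hℓ D.stage1 D.start
  have hEs : D.Es = energy M.Is ![0, len ℓ, 0] := by
    rw [Dive.Es, Dive.L₁, hL1]
  have hR30 : D.R₃ 0 = D.R₁ D.τ₁ * rotX M.tilt := by
    rw [D.join23, D.stage2.eq_mul_rotX, D.join12]
  -- The tilt of the kick and the rotation to the principal frame are about the same axis, so their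
  -- angles add to χ + P.
  have hΛ0 : bodyMomentum ℓ (D.R₃ 0 * rotX P) = ![0, len ℓ * c, -(len ℓ * s)] := by
    rw [hR30, mul_assoc, rotX_mul, bodyMomentum_mul, hL1, rotX_mulVec_somersault]
  -- stage 3
  have h3 := D.stage3.principal hI hJ
  have hJinv := inv_diagonal_mulVec hx.ne' hy.ne' hz.ne'
  obtain ⟨ψ, hψ0, hψ, hΛ⟩ := h3.exists_angle hℓ hJinv hBC hAB hsin hk hkp hΛ0
  have hprec := h3.turnsBy_precession hℓ hJinv hcos hsc hsin hk hk1 hkp hψ0 hψ hΛ D.τ₃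
  rw [← hl] at hΛ hψ hprec
  have hL3 : ∀ t, D.L₃ t = Matrix.mulVec (rotX P) (orbitPoint l k s c (ψ t)) := by
    intro t
    rw [← hΛ t, bodyMomentum_mul, Matrix.mulVec_mulVec, mul_transpose_self_of_mem (rotX_mem P),
      Matrix.one_mulVec, Dive.L₃]
  have hE3 : ∀ t, energy M.It (D.L₃ t) = l ^ 2 / 2 * (Jy⁻¹ * c ^ 2 + Jz⁻¹ * s ^ 2) := by
    intro t
    rw [hL3, energy_orbitPoint hI hJ hsin hk1 hkp]
  have hEt : D.Et = l ^ 2 / 2 * (Jy⁻¹ * c ^ 2 + Jz⁻¹ * s ^ 2) := hE3 0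
  have hSint : S = ∫ x in (0 : ℝ)..2 * Real.pi, geometricRate k s c x := by
    rw [hS, hEt, twistAxis, solidAngle_eq_integral (rotX_mem P) (energy_principal hI hJ) hlpos
      hsin hsc hp hρ2, integral_height_eq hk hkρ hsc]
  set f : ℝ → ℝ := fun x => (Jz⁻¹ - Jy⁻¹) / k * l * axial k s c x with hf
  have hfc : Continuous f := continuous_const.mul continuous_axial
  have hfpos : ∀ x, 0 < f x := fun x =>
    mul_pos (mul_pos (div_pos hp hk) hlpos) (axial_pos hsin hk1 x)
  have hfper : Function.Periodic f (2 * Real.pi) := fun x => by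
    simp only [hf, periodic_axial x]
  have hperf := performsTwists_iff D hlpos hcos hk hfc hfpos hfper hψ0 hψ hL3
  have hψn : ∀ n : ℕ, D.PerformsTwists P n → ψ D.τ₃ = 2 * Real.pi * n := fun n hn =>
    (flow_eq_two_pi_mul_iff hfc hfpos hfper hψ0 hψ n D.τ₃).2 ((hperf n).1 hn)
  -- stages 4 and 5
  have hback : ∀ n : ℕ, D.PerformsTwists P n → D.L₃ D.τ₃ = D.L₃ 0 := by
    intro n hn
    rw [hL3, hL3, hψn n hn, hψ0]
    have := (periodic_orbitPoint (l := l) (k := k) (s := s) (c := c)).nat_mul n 0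
    rw [zero_add, mul_comm] at this
    rw [this]
  -- Stage 4 runs the arm angle from 0 to π, so the tilt enters with the opposite sign.
  have hR5 : D.R₅ 0 = D.R₃ D.τ₃ * rotX (-M.tilt) := by
    rw [D.join45, ← D.join34, D.stage4.eq_mul_rotX, mul_assoc, rotX_mul, add_neg_cancel,
      rotX_zero, mul_one]
  have hL30 : D.L₃ 0 = Matrix.mulVec (rotX M.tilt).transpose ![0, len ℓ, 0] := by
    rw [Dive.L₃, hR30, bodyMomentum_mul, hL1]
  have hL50 : ∀ n : ℕ, D.PerformsTwists P n → bodyMomentum ℓ (D.R₅ 0) = ![0, len ℓ, 0] := by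
    intro n hn
    have h1 : bodyMomentum ℓ (D.R₃ D.τ₃) = _ := (hback n hn).trans hL30
    rw [hR5, bodyMomentum_mul, h1, Matrix.mulVec_mulVec, ← Matrix.transpose_mul, rotX_mul,
      add_neg_cancel, rotX_zero, Matrix.transpose_one, Matrix.one_mulVec]
  have htot : ∀ n : ℕ, D.PerformsTwists P n → ∀ Δ : ℝ, D.IsTotalRotation P Δ ↔
      Δ = 2 * D.Es / l * D.τ₁ + 0 + (D.τ₃ * (2 * D.Et / l) - n * S) + 0
        + 2 * D.Es / l * D.τ₅ := by
    intro n hn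
    obtain ⟨-, -, hT5⟩ := M.somersault hℓ D.stage5 (hL50 n hn)
    rw [hEs, hl]
    refine isTotalRotation_iff hℓ D (hT1 _) ?_ ?_ ?_ (hT5 _)
    · refine D.stage2.turnsBy_zero hℓ mpi ?_ (by rw [Set.uIcc_of_ge hpi.le])
      rw [D.join12, hL1]
      rfl
    · rw [← hEt, hψn n hn, integral_two_pi_mul (continuous_geometricRate hk)
        periodic_geometricRate, ← hSint, hl] at hprec
      simpa only [twistAxis, Matrix.mulVec_mulVec] using hprec
    · refine D.stage4.turnsBy_zero hℓ m0 ?_ (by rw [Set.uIcc_of_le hpi.le])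
      rw [D.join34]
      change D.L₃ D.τ₃ 0 = 0
      rw [hback n hn, hL30, rotX_mulVec_somersault]
      rfl
  refine ⟨?_, ?_, ?_, ⟨_, isLeast_period hlpos hcos hfc hfpos hfper hψ0 hψ hL3, ?_, ?_, hperf⟩,
    ?_, ?_⟩
  · rw [hEt]
    exact range_eq_orbit hI hJ hlpos hsin hcos hsc hk hk1 hp hkp
      (fun x => ⟨_, flow_integral_inv hfc hfpos hψ0 hψ x⟩) hL3
  · intro he
    rw [hSint, hkone he]
    simp [geometricRate_one hsin]
  · intro hlt
    have hρpos : 0 < ρ := hρ ▸ paramRho_pos hz hzy hlt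
    rw [hh, hEt, paramH_eq hlpos hz hzy hlt hsc, ← hρ, capAngle_eq hρpos hk hkρ hsc, hSint,
      integral_geometricRate hk hsin hk1 hsc]
  · intro he
    simp only [hf, hkone he, axial_one hsin, intervalIntegral.integral_const, smul_eq_mul]
    field_simp
    ring
  · intro hlt
    rw [hh, hEt, paramH_eq hlpos hz hzy hlt hsc, hρ]
    exact period_eq hlpos hz hzy hlt hsin hsc hk hk1 (hρ ▸ hkρ)
  · intro n hn
    obtain ⟨hL5, -, -⟩ := M.somersault hℓ D.stage5 (hL50 n hn)
    refine ⟨fun t => ?_, fun t => ?_, fun t => ?_, fun Δ => ?_⟩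
    · rw [hEs, Dive.L₁, hL1]
    · rw [hE3, hEt]
    · rw [hEs, Dive.L₅, hL5]
    · rw [htot n hn Δ]
      constructor <;> rintro rfl <;> ring
  · intro n hn Δ hΔ
    obtain ⟨-, hR5t, -⟩ := M.somersault hℓ D.stage5 (hL50 n hn)
    rw [htot n hn] at hΔ
    rw [← hEt, hψn n hn, integral_two_pi_mul (continuous_geometricRate hk)
        periodic_geometricRate, ← hSint] at hprec
    have hprec' : TurnsBy ℓ (fun t => Matrix.mulVec (D.R₃ t) (twistAxis P)) 0 D.τ₃
        (D.τ₃ * (2 * D.Et / l) - n * S) := by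
      simpa only [twistAxis, Matrix.mulVec_mulVec] using hprec
    have hR3 := eq_rotAbout_mul_of_turnsBy hℓ (D.stage3 0).1 (D.stage3 D.τ₃).1 (hback n hn) hprec'
    rw [hR5t, hR5, hR3, hR30, hR1 D.τ₁, ← hEs, ← hl, hΔ]
    -- The rotations about ℓ multiply from the left and the two tilts from the right; after whole
    -- twists the tilts meet and cancel.
    have hcancel : rotX M.tilt * rotX (-M.tilt) = 1 := by
      rw [rotX_mul, add_neg_cancel, rotX_zero]
    calc _ = rotAbout ℓ (2 * D.Es / l * D.τ₅) * (rotAbout ℓ (D.τ₃ * (2 * D.Et / l) - n * S)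
          * (rotAbout ℓ (2 * D.Es / l * D.τ₁) * (D.R₁ 0 * (rotX M.tilt * rotX (-M.tilt))))) := by
          simp only [mul_assoc]
      _ = _ := by
          rw [hcancel, mul_one, ← mul_assoc, ← mul_assoc, rotAbout_mul hℓ, rotAbout_mul hℓ]
          congr 2
          ring
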